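/- **Graphs.** A graph $G$ consists of a finite vertex set $V(G)$, a finite set $H(G)$ of half-edges, a map $r\colon H(G)\to V(G)$ (incidence) and a fixed-point-free involution $s$ of $H(G)$ (coupling of half-edges). Its edge set is $E(G)=H(G)/(h\sim s(h))$; loops and parallel edges are allowed, and $b^1(G)=|E(G)|-|V(G)|+1$ when $G$ is connected. For $g,n\ge 0$ and $I_n=\{1,\dots,n\}$, a *stable $n$-marked graph of genus $g$* is a triple $\mathbf G=(G,w,m)$ with $G$ a connected (nonempty) graph, $w\colon V(G)\to\mathbb Z_{\ge 0}$ and $m\colon I_n\to V(G)$, such that $b^1(G)+\sum_{v}w(v)=g$ and $2w(v)-2+|r^{-1}(v)|+|m^{-1}(v)|>0$ for every vertex $v$. Isomorphisms are bijections on vertices and half-edges that commute with $r$ and $s$ and preserve $w$ and $m$. Contracting a loop at $v$ deletes it and raises $w(v)$ by $1$; contracting a nonloop edge deletes it and merges its two endpoints into one vertex, whose weight is the sum of their weights and which carries all their markings. For $S\subseteq E(G)$, $\mathbf G/S$ denotes the result of contracting all edges of $S$ (in any order); its edges are identified with $E(G)\smallsetminus S$. **The complex $\Delta_{g,n}$.**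 For $p\ge -1$ let $[p]=\{0,\dots,p\}$, with $[-1]=\varnothing$, and let $\mathrm I$ be the category with objects $[p]$, $p\ge -1$, and morphisms all injections. A symmetric $\Delta$-complex is a functor $\mathrm I^{\mathrm{op}}\to\mathsf{Set}$. Let $\Delta_{g,n}[p]$ be the set of isomorphism classes $[\mathbf G,\tau]$ of pairs of a stable $n$-marked graph $\mathbf G$ of genus $g$ and a bijection $\tau\colon E(\mathbf G)\to[p]$ (isomorphisms have to respect $\tau$). An injection $\iota\colon[p]\to[q]$ sends $[\mathbf G,\tau]\in\Delta_{g,n}[q]$ to $[\mathbf G/S,\tau_\iota]$, where $S=\tau^{-1}([q]\smallsetminus\iota([p]))$ and $\iota\circ\tau_\iota=\tau|_{E(\mathbf G)\smallsetminus S}$. This makes $\Delta_{g,n}$ a symmetric $\Delta$-complex; $\operatorname{Aut}(\Delta_{g,n})$ is its group of natural automorphisms. Let $\mathsf V^2_{g,n}\subseteq\Delta_{g,n}$ be the subfunctor of all $[\mathbf G,\tau]$ with $|V(\mathbf G)|\le 2$, and write $\mathsf V^2_g=\mathsf V^2_{g,0}$. Let $S_n$ be the group of permutations of $I_n$; for $\sigma\in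 S_n$ let $f_\sigma\in\operatorname{Aut}(\Delta_{g,n})$ be the automorphism $[(G,w,m),\tau]\mapsto[(G,w,m\circ\sigma^{-1}),\tau]$. **Theorem.** Let $g,n\ge 0$ be integers with $2g-2+n\ge 3$, and let $\Phi\in\operatorname{Aut}(\Delta_{g,n})$. If $n=0$, then $$\Phi|_{\mathsf V^2_g}=\mathrm{Id}|_{\mathsf V^2_g}.$$ If $n\ge 1$, then there exists a unique $\sigma\in S_n$ such that $$\Phi|_{\mathsf V^2_{g,n}}=f_\sigma|_{\mathsf V^2_{g,n}}.$$ -/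

import Mathlib

open CategoryTheory

namespace TropModuli

/-! ### Graphs -/

/-- A finite graph, given by vertices and half-edges: `r` sends a half-edge to its incident vertex,
and the fixed-point-free involution `s` couples half-edges. Loops and parallel edges are allowed.
Both maps extend by the identity to `X = V ⊔ H`, where their common set of fixed points is `V`. -/
structure HGraph : Type 1 where
  V : Type
  H : Type
  [fintypeV : Fintype V]
  [fintypeH : Fintype H]
  r : H → V
  s : H → H
  s_s : ∀ h, s (s h) = h
  s_ne : ∀ h, s h ≠ h

attribute [instance] HGraph.fintypeV HGraph.fintypeH

namespace HGraph

/-- The relation `h ∼ s h` on half-edges. -/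
def edgeSetoid (G : HGraph) : Setoid G.H where
  r a b := b = a ∨ b = G.s a
  iseqv :=
    { refl := fun _ => Or.inl rfl
      symm := by
        rintro a b (rfl | rfl)
        · exact Or.inl rfl
        · exact Or.inr (G.s_s a).symm
      trans := by
        rintro a b c (rfl | rfl) (rfl | rfl)
        · exact Or.inl rfl
        · exact Or.inr rfl
        · exact Or.inr rfl
        · exact Or.inl (G.s_s a) }

/-- The set of edges `E = H / (h ∼ s h)`. -/
def E (G : HGraph) : Type := Quotient G.edgeSetoid

/-- The edge to which a half-edge belongs. -/
def edge (G : HGraph) (h : G.H) : G.E := Quotient.mk G.edgeSetoid h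

theorem edge_surjective (G : HGraph) : Function.Surjective G.edge := Quotient.mk_surjective

theorem edge_eq_iff (G : HGraph) {a b : G.H} : G.edge a = G.edge b ↔ b = a ∨ b = G.s a :=
  Quotient.eq (r := G.edgeSetoid)

theorem edge_s (G : HGraph) (h : G.H) : G.edge (G.s h) = G.edge h :=
  G.edge_eq_iff.2 (Or.inr (G.s_s h).symm)

instance (G : HGraph) : Finite G.E := Finite.of_surjective _ G.edge_surjective

/-- `a` and `b` are the two endpoints of an edge belonging to `S`. -/
def Link (G : HGraph) (S : Set G.E) (a b : G.V) : Prop :=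
  ∃ h, G.edge h ∈ S ∧ G.r h = a ∧ G.r (G.s h) = b

/-- Two vertices are related when they are joined by a path of edges belonging to `S`. -/
def joined (G : HGraph) (S : Set G.E) : Setoid G.V := Relation.EqvGen.setoid (G.Link S)

/-- The set of connected components of the subgraph with all vertices of `G` and the edges in
`S`. -/
def Comp (G : HGraph) (S : Set G.E) : Type := Quotient (G.joined S)

/-- The component containing a vertex. -/
def comp (G : HGraph) (S : Set G.E) (v : G.V) : G.Comp S := Quotient.mk (G.joined S) v

theorem comp_surjective (G : HGraph) (S : Set G.E) : Function.Surjective (G.comp S) :=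
  Quotient.mk_surjective

theorem comp_eq_iff (G : HGraph) {S : Set G.E} {u v : G.V} :
    G.comp S u = G.comp S v ↔ Relation.EqvGen (G.Link S) u v :=
  Quotient.eq (r := G.joined S)

noncomputable instance (G : HGraph) (S : Set G.E) : Fintype (G.Comp S) :=
  @Fintype.ofFinite _ (Finite.of_surjective _ (G.comp_surjective S))

/-- The graph is connected (and nonempty). -/
def Connected (G : HGraph) : Prop :=
  Nonempty G.V ∧ ∀ u v, (G.joined Set.univ).r u v

/-- The first Betti number `|E| - |V| + 1` of a connected graph. -/
noncomputable def b1 (G : HGraph) : ℤ := (Nat.card G.E : ℤ) - Nat.card G.V + 1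

/-- The valence of a vertex; loops count twice. -/
noncomputable def val (G : HGraph) (v : G.V) : ℕ := Nat.card {h : G.H // G.r h = v}

end HGraph

/-- A graph with vertex weights in `ℕ` and a marking function from `{1, …, n}` to the vertices. -/
structure MarkedGraph (n : ℕ) : Type 1 extends HGraph where
  w : V → ℕ
  m : Fin n → V

/-- An isomorphism of weighted marked graphs: bijections on vertices and half-edges that commute
with `r` and `s` and preserve weights and markings. -/
structure MarkedGraph.Iso {n : ℕ} (G G' : MarkedGraph n) where
  onV : G.V ≃ G'.V
  onH : G.H ≃ G'.H
  r_comm : ∀ h, G'.r (onH h) = onV (G.r h)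
  s_comm : ∀ h, G'.s (onH h) = onH (G.s h)
  w_comm : ∀ v, G'.w (onV v) = G.w v
  m_comm : ∀ i, G'.m i = onV (G.m i)

/-- The map induced on edges by an isomorphism. -/
def MarkedGraph.Iso.onE {n : ℕ} {G G' : MarkedGraph n} (φ : G.Iso G') : G.E → G'.E :=
  Quotient.map' (s₁ := G.edgeSetoid) (s₂ := G'.edgeSetoid) φ.onH (by
    rintro a b (rfl | rfl)
    · exact Or.inl rfl
    · exact Or.inr (φ.s_comm a).symm)

/-- The weighted graph has genus `g`, is connected, and is stable as a marked graph. -/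
structure MarkedGraph.IsStable {n : ℕ} (g : ℕ) (G : MarkedGraph n) : Prop where
  connected : G.Connected
  genus : G.b1 + ∑ v, (G.w v : ℤ) = g
  stable : ∀ v, 0 < 2 * (G.w v : ℤ) - 2 + G.val v + Nat.card {i : Fin n // G.m i = v}

/-! ### Contraction of edges -/


open scoped Classical in
/-- The contraction of all edges in `S`. The half-edges of `S` are removed, and every connected
component `c` of the subgraph formed by all vertices and the edges in `S` is collapsed to
one vertex. The weight of that vertex is the sum of the weights in `c` plus the first Betti number
`|E(c)| - |V(c)| + 1` of `c` (the subtraction does not truncate, see `card_component_le`).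
For one edge this adds `1` to the weight of the vertex of a loop, and adds up the two weights at
the ends of a nonloop edge; in general it is the result of contracting the edges of `S` one after
the other, in any order. -/
noncomputable def MarkedGraph.contract {n : ℕ} (G : MarkedGraph n) (S : Set G.E) :
    MarkedGraph n where
  V := G.Comp S
  H := {h : G.H // G.edge h ∉ S}
  fintypeV := inferInstance
  fintypeH := Fintype.ofFinite _
  r h := G.comp S (G.r h.1)
  s h := ⟨G.s h.1, by rw [G.edge_s]; exact h.2⟩
  s_s h := Subtype.ext (G.s_s h.1)
  s_ne h e := G.s_ne h.1 (congrArg Subtype.val e)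
  w c := (∑ v with G.comp S v = c, G.w v)
    + Nat.card {e : G.E // e ∈ S ∧ ∃ h, G.edge h = e ∧ G.comp S (G.r h) = c}
    + 1 - Nat.card {v : G.V // G.comp S v = c}
  m i := G.comp S (G.m i)


section Counting

open scoped Classical in
theorem sum_card_fiber {α β : Type} [Finite α] [Fintype β] (p : α → Prop) (f : α → β) :
    ∑ c, Nat.card {a // p a ∧ f a = c} = Nat.card {a // p a} := by
  have := Fintype.ofFinite α
  simp only [Nat.card_eq_fintype_card, Fintype.card_subtype]
  rw [Finset.card_eq_sum_card_fiberwise (s := Finset.univ.filter p) (t := Finset.univ) (f := f)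
    (fun _ _ => Finset.mem_coe.2 (Finset.mem_univ _))]
  simp only [Finset.filter_filter]

open scoped Classical in
theorem sum_card_fiber_comp {α β γ : Type} [Finite α] [Fintype β] (k : α → β) (f : β → γ) (c : γ) :
    ∑ b with f b = c, Nat.card {a // k a = b} = Nat.card {a // f (k a) = c} := by
  have := Fintype.ofFinite α
  simp only [Nat.card_eq_fintype_card, Fintype.card_subtype]
  rw [Finset.card_eq_sum_card_fiberwise (s := Finset.univ.filter fun a => f (k a) = c)
    (t := Finset.univ.filter fun b => f b = c) (f := k) (by intro a; simp)]
  refine Finset.sum_congr rfl fun b hb => ?_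
  rw [Finset.filter_filter]
  congr 1
  ext a
  simp only [Finset.mem_filter, Finset.mem_univ, true_and] at hb ⊢
  constructor
  · rintro rfl; exact ⟨hb, rfl⟩
  · exact fun h => h.2

theorem card_add_card_not {α : Type} [Finite α] (p q : α → Prop) :
    Nat.card {a // p a ∧ q a} + Nat.card {a // ¬ p a ∧ q a} = Nat.card {a // q a} := by
  classical
  have := Fintype.ofFinite α
  simp only [Nat.card_eq_fintype_card, Fintype.card_subtype]
  rw [← Finset.card_filter_add_card_filter_not (s := Finset.univ.filter q) p]
  simp only [Finset.filter_filter, and_comm]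

end Counting

namespace HGraph

theorem card_halfEdges (G : HGraph) (T : Set G.E) :
    Nat.card {h : G.H // G.edge h ∈ T} = 2 * Nat.card {e : G.E // e ∈ T} := by
  choose o ho using G.edge_surjective
  let f : {e : G.E // e ∈ T} × Bool → {h : G.H // G.edge h ∈ T} := fun x =>
    if x.2 then ⟨o x.1.1, by rw [ho]; exact x.1.2⟩
    else ⟨G.s (o x.1.1), by rw [G.edge_s, ho]; exact x.1.2⟩
  have hf : Function.Bijective f := by
    constructor
    · rintro ⟨⟨e, he⟩, b⟩ ⟨⟨e', he'⟩, b'⟩ hh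
      have h1 : (f (⟨e, he⟩, b)).1 = (f (⟨e', he'⟩, b')).1 := congrArg Subtype.val hh
      have key : ∀ (x : {e : G.E // e ∈ T} × Bool), G.edge (f x).1 = x.1.1 := by
        rintro ⟨x, _ | _⟩
        · simp [f, G.edge_s, ho]
        · simp [f, ho]
      have h2 : e = e' := by
        have := congrArg G.edge h1
        rwa [key, key] at this
      subst h2
      have h3 : b = b' := by
        cases b <;> cases b' <;> simp [f] at h1 ⊢
        · exact G.s_ne _ h1
        · exact G.s_ne _ h1.symm
      subst h3
      rfl
    · rintro ⟨h, hh⟩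
      rcases G.edge_eq_iff.1 (ho (G.edge h)) with h1 | h1
      · exact ⟨(⟨G.edge h, hh⟩, true), Subtype.ext (by simp [f, ← h1])⟩
      · exact ⟨(⟨G.edge h, hh⟩, false), Subtype.ext (by simp [f, ← h1])⟩
  rw [← Nat.card_congr (Equiv.ofBijective f hf), Nat.card_prod]
  simp [mul_comm]

theorem Link.symm {G : HGraph} {S : Set G.E} {a b : G.V} (h : G.Link S a b) : G.Link S b a := by
  obtain ⟨h, hS, h1, h2⟩ := h
  exact ⟨G.s h, by rwa [G.edge_s], h2, by rwa [G.s_s]⟩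

theorem mk_r_s (G : HGraph) {S : Set G.E} {h : G.H} (hS : G.edge h ∈ S) :
    G.comp S (G.r (G.s h)) = G.comp S (G.r h) :=
  G.comp_eq_iff.2 (Relation.EqvGen.symm _ _ (.rel _ _ ⟨h, hS, rfl, rfl⟩))

/-- A connected graph has at most one vertex more than it has edges. -/
theorem card_component_le (G : HGraph) (S : Set G.E) (c : G.Comp S) :
    Nat.card {v : G.V // G.comp S v = c} ≤
      Nat.card {e : G.E // e ∈ S ∧ ∃ h, G.edge h = e ∧
        G.comp S (G.r h) = c} + 1 := by
  classical
  let C := {v : G.V // G.comp S v = c}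
  let Γ : SimpleGraph C :=
    { Adj := fun a b => a ≠ b ∧ G.Link S a.1 b.1
      symm := ⟨fun a b h => ⟨h.1.symm, h.2.symm⟩⟩
      loopless := ⟨fun a h => h.1 rfl⟩ }
  have reach : ∀ u v, Relation.EqvGen (G.Link S) u v →
      ∀ (hu : G.comp S u = c) (hv : G.comp S v = c),
        Γ.Reachable ⟨u, hu⟩ ⟨v, hv⟩ := by
    intro u v h
    induction h with
    | rel u v h =>
      intro hu hv
      by_cases huv : u = v
      · subst huv; exact SimpleGraph.Reachable.refl _
      · exact SimpleGraph.Adj.reachable ⟨fun e => huv (congrArg Subtype.val e), h⟩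
    | refl u => intro _ _; exact SimpleGraph.Reachable.refl _
    | symm u v _ ih => intro hu hv; exact (ih hv hu).symm
    | trans u v w h1 _ ih1 ih2 =>
      intro hu hw
      have hv : G.comp S v = c := by
        rw [← hu]; exact (G.comp_eq_iff.2 h1).symm
      exact (ih1 hu hv).trans (ih2 hv hw)
  obtain ⟨v0, hv0⟩ := G.comp_surjective S c
  have hconn : Γ.Connected :=
    { preconnected := fun u v => reach u.1 v.1
        (G.comp_eq_iff.1 (u.2.trans v.2.symm)) u.2 v.2
      nonempty := ⟨⟨v0, hv0⟩⟩ }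
  refine hconn.card_vert_le_card_edgeSet_add_one.trans (Nat.add_le_add_right ?_ 1)
  have hex : ∀ x : Γ.edgeSet, ∃ h : G.H, G.edge h ∈ S ∧
      G.comp S (G.r h) = c ∧
      s(G.r h, G.r (G.s h)) = x.1.map Subtype.val := by
    rintro ⟨x, hx⟩
    induction x using Sym2.ind with
    | _ a b =>
      obtain ⟨_, h, hS, h1, h2⟩ := hx
      exact ⟨h, hS, by rw [h1]; exact a.2, by simp [h1, h2]⟩
  choose k hkS hkc hk using hex
  refine Nat.card_le_card_of_injective
    (fun x => ⟨G.edge (k x), hkS x, k x, rfl, hkc x⟩) ?_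
  intro x y hxy
  have h1 : G.edge (k x) = G.edge (k y) := congrArg Subtype.val hxy
  have h2 : x.1.map Subtype.val = y.1.map Subtype.val := by
    rw [← hk, ← hk]
    rcases G.edge_eq_iff.1 h1 with h | h
    · rw [h]
    · rw [h, G.s_s, Sym2.eq_swap]
  exact Subtype.ext (Sym2.map.injective Subtype.val_injective h2)

theorem card_edges_component (G : HGraph) (S : Set G.E) (c : G.Comp S) :
    2 * Nat.card {e : G.E // e ∈ S ∧ ∃ h, G.edge h = e ∧
        G.comp S (G.r h) = c} =
      Nat.card {h : G.H // G.edge h ∈ S ∧ G.comp S (G.r h) = c} := by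
  rw [← Set.coe_ofPred]
  refine (G.card_halfEdges _).symm.trans (Nat.card_congr (Equiv.subtypeEquivRight fun h => ?_))
  constructor
  · rintro ⟨hS, h', he, hc⟩
    refine ⟨hS, ?_⟩
    rcases G.edge_eq_iff.1 he with e | e
    · rw [e, hc]
    · rw [e, G.mk_r_s (by rw [he]; exact hS), hc]
  · rintro ⟨hS, hc⟩
    exact ⟨hS, h, rfl, hc⟩

end HGraph

namespace MarkedGraph

variable {n : ℕ}

open scoped Classical in
theorem contract_w (G : MarkedGraph n) (S : Set G.E) (c : G.Comp S) :
    ((G.contract S).w c : ℤ) - 1 =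
      (∑ v with G.comp S v = c, ((G.w v : ℤ) - 1))
      + Nat.card {e : G.E // e ∈ S ∧ ∃ h, G.edge h = e ∧
          G.comp S (G.r h) = c} := by
  have h1 := G.card_component_le S c
  have h2 : ((∑ v with G.comp S v = c, ((G.w v : ℤ) - 1))) =
      ((∑ v with G.comp S v = c, G.w v : ℕ) : ℤ) -
        Nat.card {v : G.V // G.comp S v = c} := by
    rw [Finset.sum_sub_distrib, Nat.card_eq_fintype_card, Fintype.card_subtype]
    simp
  rw [h2]
  change (((∑ v with G.comp S v = c, G.w v)
    + Nat.card {e : G.E // e ∈ S ∧ ∃ h, G.edge h = e ∧ G.comp S (G.r h) = c}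
    + 1 - Nat.card {v : G.V // G.comp S v = c} : ℕ) : ℤ) - 1 = _
  rw [Nat.cast_sub (by omega)]
  push_cast
  ring

theorem IsStable.contract {g : ℕ} {G : MarkedGraph n} (hG : G.IsStable g) (S : Set G.E) :
    (G.contract S).IsStable g := by
  classical
  have hcard : ∀ T : HGraph, 2 * Nat.card T.E = Nat.card T.H := by
    intro T
    have := T.card_halfEdges Set.univ
    rw [Nat.card_congr (Equiv.subtypeUnivEquiv (fun _ => Set.mem_univ _)),
      Nat.card_congr (Equiv.subtypeUnivEquiv (fun _ => Set.mem_univ _))] at this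
    exact this.symm
  refine ⟨⟨?_, ?_⟩, ?_, ?_⟩
  · obtain ⟨v⟩ := hG.connected.1
    exact ⟨G.comp S v⟩
  · have key : ∀ u v, Relation.EqvGen (G.Link Set.univ) u v →
        ((G.contract S).joined Set.univ).r (G.comp S u)
          (G.comp S v) := by
      intro u v h
      induction h with
      | rel u v h =>
        obtain ⟨h, -, rfl, rfl⟩ := h
        by_cases hS : G.edge h ∈ S
        · rw [G.mk_r_s hS]; exact Relation.EqvGen.refl _
        · exact Relation.EqvGen.rel _ _ ⟨⟨h, hS⟩, Set.mem_univ _, rfl, rfl⟩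
      | refl u => exact Relation.EqvGen.refl _
      | symm u v _ ih => exact Relation.EqvGen.symm _ _ ih
      | trans u v w _ _ ih1 ih2 => exact Relation.EqvGen.trans _ _ _ ih1 ih2
    intro u v
    obtain ⟨u, rfl⟩ := G.comp_surjective S u
    obtain ⟨v, rfl⟩ := G.comp_surjective S v
    exact key u v (hG.connected.2 u v)
  · have h0 := hG.genus
    have e1 : ∑ c : G.Comp S, (((G.contract S).w c : ℤ) - 1) =
        ∑ v, ((G.w v : ℤ) - 1) + Nat.card {e : G.E // e ∈ S} := by
      have a1 : ∑ c : G.Comp S, Nat.card {h : G.H // G.edge h ∈ S ∧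
          G.comp S (G.r h) = c} = Nat.card {h : G.H // G.edge h ∈ S} :=
        sum_card_fiber (fun h => G.edge h ∈ S) (fun h => G.comp S (G.r h))
      rw [G.card_halfEdges] at a1
      have a2 : ∑ c : G.Comp S, Nat.card {e : G.E // e ∈ S ∧ ∃ h, G.edge h = e ∧
          G.comp S (G.r h) = c} = Nat.card {e : G.E // e ∈ S} := by
        have : ∀ c : G.Comp S, _ := fun c => G.card_edges_component S c
        simp only [← this] at a1
        rw [← Finset.mul_sum] at a1
        omega
      rw [Finset.sum_congr rfl fun c _ => G.contract_w S c, Finset.sum_add_distrib, ← a2]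
      congr 1
      · exact Finset.sum_fiberwise (M := ℤ) (κ := G.Comp S) Finset.univ
          (fun v => G.comp S v) _
      · push_cast; rfl
    have e2 : Nat.card (G.contract S).E + Nat.card {e : G.E // e ∈ S} = Nat.card G.E := by
      have b1 := hcard (G.contract S).toHGraph
      have b2 := hcard G.toHGraph
      have b3 := G.card_halfEdges S
      have b4 := card_add_card_not (fun h : G.H => G.edge h ∈ S) (fun _ => True)
      simp only [and_true] at b4
      rw [Nat.card_congr (Equiv.subtypeUnivEquiv (p := fun _ : G.H => True)
        (fun _ => trivial))] at b4
      have b5 : Nat.card (G.contract S).H = Nat.card {h : G.H // ¬ G.edge h ∈ S} := rfl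
      omega
    simp only [Finset.sum_sub_distrib, Finset.sum_const, Finset.card_univ, 
      nsmul_eq_mul, mul_one] at e1
    simp only [HGraph.b1, Nat.card_eq_fintype_card (α := G.V),
      Nat.card_eq_fintype_card (α := (G.contract S).V)] at h0 ⊢
    have e3 : (Nat.card (G.contract S).E : ℤ) + Nat.card {e : G.E // e ∈ S} = Nat.card G.E := by
      exact_mod_cast e2
    have e4 : Fintype.card (G.contract S).V = Fintype.card (G.Comp S) := rfl
    have e5 : ∑ c : (G.contract S).V, ((G.contract S).w c : ℤ) =
      ∑ c : G.Comp S, ((G.contract S).w c : ℤ) := rfl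
    rw [e4, e5]
    linarith
  · intro (c : G.Comp S)
    have hw := G.contract_w S c
    have hv1 : (G.contract S).val c = Nat.card {h : G.H // ¬ G.edge h ∈ S ∧
        G.comp S (G.r h) = c} :=
      Nat.card_congr (Equiv.subtypeSubtypeEquivSubtypeInter (fun h : G.H => ¬ G.edge h ∈ S)
        (fun h => G.comp S (G.r h) = c))
    have hv2 := card_add_card_not (fun h : G.H => G.edge h ∈ S)
      (fun h => G.comp S (G.r h) = c)
    rw [← hv1, ← G.card_edges_component S c, ← sum_card_fiber_comp G.r (G.comp S) c] at hv2
    have hm : Nat.card {i : Fin n // (G.contract S).m i = c} = _ :=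
      (sum_card_fiber_comp G.m (fun v => G.comp S v) c).symm
    have hv2' : (2 * Nat.card {e : G.E // e ∈ S ∧ ∃ h, G.edge h = e ∧
        G.comp S (G.r h) = c} : ℤ) + (G.contract S).val c =
        ∑ v with G.comp S v = c, (G.val v : ℤ) := by
      exact_mod_cast hv2
    have hpos : 0 < ∑ v with G.comp S v = c,
        (2 * (G.w v : ℤ) - 2 + G.val v + Nat.card {i : Fin n // G.m i = v}) := by
      obtain ⟨v, hv⟩ := G.comp_surjective S c
      exact Finset.sum_pos (fun v _ => hG.stable v) ⟨v, by simpa using hv⟩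
    have hsum : ∑ v with G.comp S v = c,
        (2 * (G.w v : ℤ) - 2 + G.val v + Nat.card {i : Fin n // G.m i = v}) =
        2 * (∑ v with G.comp S v = c, ((G.w v : ℤ) - 1)) +
        ∑ v with G.comp S v = c, (G.val v : ℤ) +
        ∑ v with G.comp S v = c, (Nat.card {i : Fin n // G.m i = v} : ℤ) := by
      rw [Finset.mul_sum, ← Finset.sum_add_distrib, ← Finset.sum_add_distrib]
      exact Finset.sum_congr rfl fun v _ => by ring
    rw [hsum] at hpos
    rw [hm]
    push_cast
    linarith

end MarkedGraph

/-- The map `E(G/S) → E(G)` induced by the contraction, which identifies the edges of `G/S` with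
the edges of `G` outside `S`. -/
noncomputable def MarkedGraph.pullE {n : ℕ} (G : MarkedGraph n) (S : Set G.E) : (G.contract S).E → G.E :=
  Quotient.map' (s₁ := (G.contract S).edgeSetoid) (s₂ := G.edgeSetoid) Subtype.val (by
    rintro a b (rfl | rfl)
    · exact Or.inl rfl
    · exact Or.inr rfl)

theorem MarkedGraph.pullE_notMem {n : ℕ} (G : MarkedGraph n) (S : Set G.E)
    (e : (G.contract S).E) : G.pullE S e ∉ S := by
  obtain ⟨h, rfl⟩ := (G.contract S).edge_surjective e
  exact h.2

theorem MarkedGraph.pullE_bijective {n : ℕ} (G : MarkedGraph n) (S : Set G.E) :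
    Function.Bijective (fun e => (⟨G.pullE S e, G.pullE_notMem S e⟩ : {e : G.E // e ∉ S})) := by
  constructor
  · intro a b hab
    obtain ⟨a, rfl⟩ := (G.contract S).edge_surjective a
    obtain ⟨b, rfl⟩ := (G.contract S).edge_surjective b
    have h1 : G.edge a.1 = G.edge b.1 := congrArg Subtype.val hab
    rw [(G.contract S).edge_eq_iff]
    rcases G.edge_eq_iff.1 h1 with h | h
    · exact Or.inl (Subtype.ext h)
    · exact Or.inr (Subtype.ext h)
  · rintro ⟨e, he⟩
    obtain ⟨h, rfl⟩ := G.edge_surjective e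
    exact ⟨(G.contract S).edge ⟨h, he⟩, rfl⟩

/-! ### Edge-labelled pairs -/

/-- A stable `n`-marked graph of genus `g` with a labelling of its edges by `{0, …, k - 1}`. -/
structure EdgeLabelled (g n k : ℕ) : Type 1 where
  graph : MarkedGraph n
  stable : graph.IsStable g
  τ : graph.E ≃ Fin k

namespace EdgeLabelled

variable {g n k l q : ℕ}

/-- Two pairs are isomorphic when there is an isomorphism of the underlying weighted marked graphs
that is compatible with the edge labellings. -/
def IsIso (P Q : EdgeLabelled g n k) : Prop :=
  ∃ φ : P.graph.Iso Q.graph, ∀ e, Q.τ (φ.onE e) = P.τ e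

/-- The edges whose labels are not in the image of `ι`. -/
def offEdges (P : EdgeLabelled g n l) (ι : Fin k ↪ Fin l) : Set P.graph.E :=
  {e | P.τ e ∉ Set.range ι}

/-- The face of `(G, τ)` along an injection `ι`: contract the edges whose labels are not in the
image of `ι`, and label the remaining edges so that `ι ∘ τ_ι` is the restriction of `τ`
(see `face_τ`). -/
noncomputable def face (ι : Fin k ↪ Fin l) (P : EdgeLabelled g n l) : EdgeLabelled g n k where
  graph := P.graph.contract (P.offEdges ι)
  stable := P.stable.contract _
  τ := (Equiv.ofBijective _ (P.graph.pullE_bijective (P.offEdges ι))).trans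
    ((P.τ.subtypeEquiv (p := fun e => e ∉ P.offEdges ι) (q := fun j => j ∈ Set.range ι)
      (fun _ => not_not)).trans (Equiv.ofInjective ι ι.injective).symm)

theorem face_τ (ι : Fin k ↪ Fin l) (P : EdgeLabelled g n l) (e : (P.face ι).graph.E) :
    ι ((P.face ι).τ e) = P.τ (P.graph.pullE (P.offEdges ι) e) :=
  Equiv.apply_ofInjective_symm ι.injective _

/-- The action of a permutation of the markings: the marking function `m` becomes `m ∘ σ⁻¹`. -/
def relabel (σ : Equiv.Perm (Fin n)) (P : EdgeLabelled g n k) : EdgeLabelled g n k where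
  graph := { P.graph with m := P.graph.m ∘ ⇑σ⁻¹ }
  stable :=
    { connected := P.stable.connected
      genus := P.stable.genus
      stable := fun v => by
        have h := P.stable.stable v
        rwa [← Nat.card_congr (σ.symm.subtypeEquiv (p := fun i => P.graph.m (σ.symm i) = v)
          (q := fun i => P.graph.m i = v) (fun _ => Iff.rfl))] at h }
  τ := P.τ

/-! #### Faces are well defined and functorial -/

/-- The label of the edge of a half-edge. -/
def lbl (P : EdgeLabelled g n k) (h : P.graph.H) : Fin k := P.τ (P.graph.edge h)

theorem lbl_s (P : EdgeLabelled g n k) (h : P.graph.H) : P.lbl (P.graph.s h) = P.lbl h :=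
  congrArg P.τ (P.graph.edge_s h)

theorem lbl_eq (P : EdgeLabelled g n k) {a b : P.graph.H} (h : P.lbl a = P.lbl b) :
    b = a ∨ b = P.graph.s a :=
  P.graph.edge_eq_iff.1 (P.τ.injective h)

theorem lbl_surjective (P : EdgeLabelled g n k) : Function.Surjective P.lbl :=
  P.τ.surjective.comp P.graph.edge_surjective

/-- A half-edge of the edge with a given label. -/
noncomputable def half (P : EdgeLabelled g n k) (j : Fin k) : P.graph.H :=
  Function.surjInv P.lbl_surjective j

theorem lbl_half (P : EdgeLabelled g n k) (j : Fin k) : P.lbl (P.half j) = j :=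
  Function.surjInv_eq P.lbl_surjective j

open scoped Classical in
/-- The data exhibiting `Q` as the face of `P` along `ι`. -/
structure FaceData (ι : Fin k ↪ Fin l) (P : EdgeLabelled g n l) (Q : EdgeLabelled g n k) where
  fV : P.graph.V → Q.graph.V
  fH : Q.graph.H → P.graph.H
  fV_surj : Function.Surjective fV
  fH_s : ∀ h, fH (Q.graph.s h) = P.graph.s (fH h)
  fH_r : ∀ h, Q.graph.r h = fV (P.graph.r (fH h))
  fH_lbl : ∀ h, P.lbl (fH h) = ι (Q.lbl h)
  map_m : ∀ i, Q.graph.m i = fV (P.graph.m i)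
  ker : ∀ u v, fV u = fV v ↔ Relation.EqvGen (P.graph.Link (P.offEdges ι)) u v
  map_w : ∀ c, (Q.graph.w c : ℤ) - 1 = ∑ v with fV v = c, ((P.graph.w v : ℤ) - 1) +
    Nat.card {j : Fin l // j ∉ Set.range ι ∧ fV (P.graph.r (P.half j)) = c}

namespace FaceData

variable {ι : Fin k ↪ Fin l} {P : EdgeLabelled g n l} {Q Q' : EdgeLabelled g n k}

theorem fH_injective (f : FaceData ι P Q) : Function.Injective f.fH := by
  intro a b hab
  have h1 : Q.lbl a = Q.lbl b := ι.injective (by rw [← f.fH_lbl, ← f.fH_lbl, hab])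
  rcases Q.lbl_eq h1 with h | h
  · exact h.symm
  · rw [h, f.fH_s] at hab
    exact absurd hab.symm (P.graph.s_ne _)

theorem exists_fH (f : FaceData ι P Q) (h : P.graph.H) (hh : P.lbl h ∈ Set.range ι) :
    ∃ h', f.fH h' = h := by
  obtain ⟨j, hj⟩ := hh
  obtain ⟨h', rfl⟩ := Q.lbl_surjective j
  rw [← f.fH_lbl] at hj
  rcases P.lbl_eq hj with e | e
  · exact ⟨h', e.symm⟩
  · exact ⟨Q.graph.s h', by rw [f.fH_s, e]⟩

theorem fV_r_s (f : FaceData ι P Q) (h : P.graph.H) (hh : P.lbl h ∉ Set.range ι) :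
    f.fV (P.graph.r (P.graph.s h)) = f.fV (P.graph.r h) :=
  ((f.ker _ _).2 (.rel _ _ ⟨h, hh, rfl, rfl⟩)).symm

/-- The face along `ι` is unique up to isomorphism. -/
theorem isIso (f : FaceData ι P Q) (f' : FaceData ι P Q') : Q.IsIso Q' := by
  classical
  have kk : ∀ u v, f.fV u = f.fV v ↔ f'.fV u = f'.fV v := fun u v => by rw [f.ker, f'.ker]
  have hs := Function.surjInv_eq f.fV_surj
  have hs' := Function.surjInv_eq f'.fV_surj
  let eV : Q.graph.V ≃ Q'.graph.V :=
    { toFun := fun c => f'.fV (Function.surjInv f.fV_surj c)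
      invFun := fun c => f.fV (Function.surjInv f'.fV_surj c)
      left_inv := fun c => by
        conv_rhs => rw [← hs c]
        rw [kk, hs']
      right_inv := fun c => by
        conv_rhs => rw [← hs' c]
        rw [← kk, hs] }
  have eV_apply : ∀ v, eV (f.fV v) = f'.fV v := fun v => (kk _ _).1 (hs _)
  have ex : ∀ h, ∃ h', f'.fH h' = f.fH h := fun h =>
    f'.exists_fH _ (by rw [f.fH_lbl]; exact ⟨_, rfl⟩)
  have ex' : ∀ h, ∃ h', f.fH h' = f'.fH h := fun h =>
    f.exists_fH _ (by rw [f'.fH_lbl]; exact ⟨_, rfl⟩)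
  choose a ha using ex
  choose b hb using ex'
  let eH : Q.graph.H ≃ Q'.graph.H :=
    { toFun := a
      invFun := b
      left_inv := fun h => f.fH_injective (by rw [hb, ha])
      right_inv := fun h => f'.fH_injective (by rw [ha, hb]) }
  refine ⟨{ onV := eV, onH := eH, r_comm := ?_, s_comm := ?_, w_comm := ?_, m_comm := ?_ }, ?_⟩
  · intro h
    rw [f'.fH_r, f.fH_r, eV_apply]
    exact congrArg (fun x => f'.fV (P.graph.r x)) (ha h)
  · intro h
    refine f'.fH_injective ?_
    rw [f'.fH_s]
    change P.graph.s (f'.fH (a h)) = f'.fH (a _)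
    rw [ha, ha, f.fH_s]
  · intro c
    obtain ⟨u, rfl⟩ := f.fV_surj c
    have h1 := f.map_w (f.fV u)
    have h2 := f'.map_w (f'.fV u)
    simp only [← kk] at h2
    rw [eV_apply]
    have : ((Q'.graph.w (f'.fV u) : ℤ)) = Q.graph.w (f.fV u) := by linarith
    exact_mod_cast this
  · intro i
    rw [f'.map_m, f.map_m, eV_apply]
  · intro e
    obtain ⟨h, rfl⟩ := Q.graph.edge_surjective e
    refine ι.injective ?_
    change ι (Q'.lbl (a h)) = ι (Q.lbl h)
    rw [← f'.fH_lbl, ha, f.fH_lbl]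

/-- An isomorphism exhibits a face along the identity. -/
theorem nonempty_of_isIso {P Q : EdgeLabelled g n k} (h : P.IsIso Q) :
    Nonempty (FaceData (Function.Embedding.refl _) P Q) := by
  classical
  obtain ⟨φ, hφ⟩ := h
  refine ⟨{
    fV := φ.onV, fH := φ.onH.symm, fV_surj := φ.onV.surjective, fH_s := ?_, fH_r := ?_,
    fH_lbl := ?_, map_m := φ.m_comm, ker := ?_, map_w := ?_ }⟩
  · intro h
    rw [Equiv.symm_apply_eq, ← φ.s_comm, Equiv.apply_symm_apply]
  · intro h
    rw [← φ.r_comm, Equiv.apply_symm_apply]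
  · intro h
    obtain ⟨h, rfl⟩ := φ.onH.surjective h
    rw [Equiv.symm_apply_apply]
    exact (hφ (P.graph.edge h)).symm
  · intro u v
    constructor
    · intro h
      rw [φ.onV.injective h]
      exact .refl _
    · intro h
      induction h with
      | rel u v h =>
        obtain ⟨h, hh, -⟩ := h
        exact absurd ⟨_, rfl⟩ hh
      | refl u => rfl
      | symm u v _ ih => exact ih.symm
      | trans u v w _ _ ih1 ih2 => exact ih1.trans ih2
  · intro c
    obtain ⟨u, rfl⟩ := φ.onV.surjective c
    have h1 : (Finset.univ.filter fun v => φ.onV v = φ.onV u) = {u} := by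
      ext v; simp
    have h2 : IsEmpty {j : Fin k // j ∉ Set.range (Function.Embedding.refl (Fin k)) ∧
        φ.onV (P.graph.r (P.half j)) = φ.onV u} := ⟨fun x => x.2.1 ⟨_, rfl⟩⟩
    rw [h1, Finset.sum_singleton, φ.w_comm, Nat.card_of_isEmpty]
    simp

/-- Faces of faces are faces. -/
theorem nonempty_comp {κ : Fin q ↪ Fin k} {R : EdgeLabelled g n q} (f : FaceData ι P Q)
    (f' : FaceData κ Q R) : Nonempty (FaceData (κ.trans ι) P R) := by
  classical
  have hrange : ∀ {j}, j ∉ Set.range ι → j ∉ Set.range (κ.trans ι) := by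
    rintro j hj ⟨i, rfl⟩
    exact hj ⟨_, rfl⟩
  have hrange' : ∀ {j}, ι j ∉ Set.range (κ.trans ι) ↔ j ∉ Set.range κ := by
    intro j
    refine not_congr ⟨?_, ?_⟩
    · rintro ⟨i, hi⟩; exact ⟨i, ι.injective hi⟩
    · rintro ⟨i, rfl⟩; exact ⟨i, rfl⟩
  refine ⟨{
    fV := f'.fV ∘ f.fV, fH := f.fH ∘ f'.fH, fV_surj := f'.fV_surj.comp f.fV_surj,
    fH_s := ?_, fH_r := ?_, fH_lbl := ?_, map_m := ?_, ker := ?_, map_w := ?_ }⟩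
  · intro h; simp [f.fH_s, f'.fH_s]
  · intro h; simp only [Function.comp]; rw [f'.fH_r, f.fH_r]
  · intro h; simp only [Function.comp]; rw [f.fH_lbl, f'.fH_lbl]; rfl
  · intro i; simp only [Function.comp]; rw [f'.map_m, f.map_m]
  · intro u v
    have up : ∀ u v, f.fV u = f.fV v →
        Relation.EqvGen (P.graph.Link (P.offEdges (κ.trans ι))) u v := by
      intro u v h
      refine Relation.EqvGen.mono ?_ _ _ ((f.ker _ _).1 h)
      rintro a b ⟨h, hh, h1⟩
      exact ⟨h, hrange hh, h1⟩
    constructor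
    · intro h
      have key : ∀ a b, Relation.EqvGen (Q.graph.Link (Q.offEdges κ)) a b → ∀ u v,
          f.fV u = a → f.fV v = b →
          Relation.EqvGen (P.graph.Link (P.offEdges (κ.trans ι))) u v := by
        intro a b hab
        induction hab with
        | rel a b hab =>
          obtain ⟨h, hh, h1, h2⟩ := hab
          intro u v hu hv
          rw [f.fH_r] at h1 h2
          refine (up u _ (hu.trans h1.symm)).trans _ _ _
            (Relation.EqvGen.trans _ _ _ (.rel _ _ ⟨f.fH h, ?_, rfl, rfl⟩) (up _ v ?_))
          · change P.lbl (f.fH h) ∉ _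
            rw [f.fH_lbl, hrange']
            exact hh
          · rw [← f.fH_s, h2, hv]
        | refl a => intro u v hu hv; exact up u v (hu.trans hv.symm)
        | symm a b _ ih => intro u v hu hv; exact (ih v u hv hu).symm
        | trans a b c _ _ ih1 ih2 =>
          intro u v hu hv
          obtain ⟨x, hx⟩ := f.fV_surj b
          exact (ih1 u x hu hx).trans _ _ _ (ih2 x v hx hv)
      exact key _ _ ((f'.ker _ _).1 h) u v rfl rfl
    · intro h
      induction h with
      | rel u v h =>
        obtain ⟨h, hh, rfl, rfl⟩ := h
        by_cases hr : P.lbl h ∈ Set.range ι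
        · obtain ⟨h', rfl⟩ := f.exists_fH h hr
          simp only [Function.comp]
          rw [← f.fH_s, ← f.fH_r, ← f.fH_r]
          refine (f'.fV_r_s h' ?_).symm
          refine hrange'.1 ?_
          rw [← f.fH_lbl]
          exact hh
        · simp only [Function.comp]
          rw [f.fV_r_s h hr]
      | refl u => rfl
      | symm u v _ ih => exact ih.symm
      | trans u v w _ _ ih1 ih2 => exact ih1.trans ih2
  · intro c
    have h1 : ∑ v with (f'.fV ∘ f.fV) v = c, ((P.graph.w v : ℤ) - 1) =
        ∑ b with f'.fV b = c, ∑ v with f.fV v = b, ((P.graph.w v : ℤ) - 1) := by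
      rw [← Finset.sum_fiberwise_of_maps_to (s := Finset.univ.filter fun v => (f'.fV ∘ f.fV) v = c)
        (t := Finset.univ.filter fun b => f'.fV b = c) (g := f.fV) (by intro v; simp)]
      refine Finset.sum_congr rfl fun b hb => Finset.sum_congr ?_ fun _ _ => rfl
      ext v
      simp only [Finset.mem_filter, Finset.mem_univ, true_and, Function.comp] at hb ⊢
      constructor
      · exact fun h => h.2
      · rintro rfl; exact ⟨hb, rfl⟩
    have h2 : ∑ b with f'.fV b = c,
        Nat.card {j : Fin l // j ∉ Set.range ι ∧ f.fV (P.graph.r (P.half j)) = b} =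
        Nat.card {j : Fin l // j ∉ Set.range ι ∧
          f'.fV (f.fV (P.graph.r (P.half j))) = c} := by
      have := sum_card_fiber_comp (fun j : {j : Fin l // j ∉ Set.range ι} =>
        f.fV (P.graph.r (P.half j.1))) f'.fV c
      rw [← Nat.card_congr (Equiv.subtypeSubtypeEquivSubtypeInter
        (fun j : Fin l => j ∉ Set.range ι)
        (fun j => f'.fV (f.fV (P.graph.r (P.half j))) = c)), ← this]
      refine Finset.sum_congr rfl fun b _ => (Nat.card_congr
        (Equiv.subtypeSubtypeEquivSubtypeInter (fun j : Fin l => j ∉ Set.range ι)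
        (fun j => f.fV (P.graph.r (P.half j)) = b))).symm
    have h3 : Nat.card {j : Fin k // j ∉ Set.range κ ∧ f'.fV (Q.graph.r (Q.half j)) = c} =
        Nat.card {j : Fin l // j ∈ Set.range ι ∧ j ∉ Set.range (κ.trans ι) ∧
          f'.fV (f.fV (P.graph.r (P.half j))) = c} := by
      have key : ∀ j : Fin k, j ∉ Set.range κ →
          f'.fV (f.fV (P.graph.r (P.half (ι j)))) = f'.fV (Q.graph.r (Q.half j)) := by
        intro j hj
        have e : P.lbl (f.fH (Q.half j)) = P.lbl (P.half (ι j)) := by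
          rw [f.fH_lbl, Q.lbl_half, P.lbl_half]
        rcases P.lbl_eq e with h | h
        · rw [h, ← f.fH_r]
        · rw [h, ← f.fH_s, ← f.fH_r, f'.fV_r_s _ (by rwa [Q.lbl_half])]
      refine Nat.card_congr (Equiv.ofBijective
        (fun j => ⟨ι j.1, ⟨_, rfl⟩, hrange'.2 j.2.1, by rw [key _ j.2.1]; exact j.2.2⟩) ⟨?_, ?_⟩)
      · intro a b hab
        exact Subtype.ext (ι.injective (congrArg Subtype.val hab))
      · rintro ⟨_, ⟨j, rfl⟩, hj, hc⟩
        exact ⟨⟨j, hrange'.1 hj, by rw [← key _ (hrange'.1 hj)]; exact hc⟩, rfl⟩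
    have h4 := card_add_card_not (fun j => j ∈ Set.range ι) (fun j => j ∉ Set.range (κ.trans ι) ∧
          f'.fV (f.fV (P.graph.r (P.half j))) = c)
    have h5 : Nat.card {j : Fin l // j ∉ Set.range ι ∧ j ∉ Set.range (κ.trans ι) ∧
          f'.fV (f.fV (P.graph.r (P.half j))) = c} = Nat.card {j : Fin l // j ∉ Set.range ι ∧
          f'.fV (f.fV (P.graph.r (P.half j))) = c} :=
      Nat.card_congr (Equiv.subtypeEquivRight fun j =>
        ⟨fun h => ⟨h.1, h.2.2⟩, fun h => ⟨h.1, hrange h.1, h.2⟩⟩)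
    rw [← h3, h5, ← h2] at h4
    rw [f'.map_w, Finset.sum_congr rfl fun b _ => f.map_w b, Finset.sum_add_distrib, h1]
    simp only [Function.comp]
    rw [← h4]
    push_cast
    ring

/-- The face along `ι` is a face along `ι`. -/
theorem nonempty_face (ι : Fin k ↪ Fin l) (P : EdgeLabelled g n l) :
    Nonempty (FaceData ι P (P.face ι)) := by
  classical
  refine ⟨{
    fV := P.graph.comp (P.offEdges ι), fH := Subtype.val,
    fV_surj := P.graph.comp_surjective _, fH_s := fun _ => rfl, fH_r := fun _ => rfl,
    fH_lbl := ?_, map_m := fun _ => rfl, ker := fun u v => P.graph.comp_eq_iff, map_w := ?_ }⟩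
  · intro h
    exact (P.face_τ ι ((P.face ι).graph.edge h)).symm
  · intro c
    refine (P.graph.contract_w (P.offEdges ι) c).trans ?_
    congr 2
    refine Nat.card_congr (P.τ.subtypeEquiv fun e => ?_)
    constructor
    · rintro ⟨he, h, rfl, hc⟩
      refine ⟨he, ?_⟩
      have e1 : P.lbl h = P.lbl (P.half (P.τ (P.graph.edge h))) := by rw [P.lbl_half]; rfl
      rcases P.lbl_eq e1 with e2 | e2
      · rw [e2]; exact hc
      · rw [e2, P.graph.mk_r_s he]; exact hc
    · rintro ⟨he, hc⟩
      exact ⟨he, P.half (P.τ e), P.τ.injective (P.lbl_half _), hc⟩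

/-- The action of a permutation of the markings is compatible with faces. -/
def relabel (σ : Equiv.Perm (Fin n)) (f : FaceData ι P Q) :
    FaceData ι (P.relabel σ) (Q.relabel σ) where
  fV := f.fV
  fH := f.fH
  fV_surj := f.fV_surj
  fH_s := f.fH_s
  fH_r := f.fH_r
  fH_lbl := f.fH_lbl
  map_m i := f.map_m (σ⁻¹ i)
  ker := f.ker
  map_w := f.map_w

end FaceData

theorem IsIso.refl (P : EdgeLabelled g n k) : P.IsIso P :=
  ⟨{ onV := Equiv.refl _, onH := Equiv.refl _, r_comm := fun _ => rfl, s_comm := fun _ => rfl,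
     w_comm := fun _ => rfl, m_comm := fun _ => rfl }, fun e => by
      obtain ⟨h, rfl⟩ := P.graph.edge_surjective e
      rfl⟩

theorem IsIso.symm {P Q : EdgeLabelled g n k} (h : P.IsIso Q) : Q.IsIso P := by
  obtain ⟨f⟩ := FaceData.nonempty_of_isIso h
  obtain ⟨f'⟩ := FaceData.nonempty_of_isIso (IsIso.refl P)
  exact f.isIso f'

theorem IsIso.trans {P Q R : EdgeLabelled g n k} (h : P.IsIso Q) (h' : Q.IsIso R) :
    P.IsIso R := by
  obtain ⟨f⟩ := FaceData.nonempty_of_isIso h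
  obtain ⟨f'⟩ := FaceData.nonempty_of_isIso h'
  obtain ⟨f''⟩ := FaceData.nonempty_comp f f'
  obtain ⟨f₀⟩ := FaceData.nonempty_of_isIso (IsIso.refl P)
  exact f₀.isIso f''

theorem IsIso.face (ι : Fin k ↪ Fin l) {P Q : EdgeLabelled g n l} (h : P.IsIso Q) :
    (P.face ι).IsIso (Q.face ι) := by
  obtain ⟨f⟩ := FaceData.nonempty_face ι P
  obtain ⟨f₁⟩ := FaceData.nonempty_of_isIso h
  obtain ⟨f₂⟩ := FaceData.nonempty_face ι Q
  obtain ⟨f₃⟩ := FaceData.nonempty_comp f₁ f₂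
  exact f.isIso f₃

theorem face_refl (P : EdgeLabelled g n k) : (P.face (Function.Embedding.refl _)).IsIso P := by
  obtain ⟨f⟩ := FaceData.nonempty_face (Function.Embedding.refl _) P
  obtain ⟨f₀⟩ := FaceData.nonempty_of_isIso (IsIso.refl P)
  exact f.isIso f₀

theorem face_trans (κ : Fin q ↪ Fin k) (ι : Fin k ↪ Fin l) (P : EdgeLabelled g n l) :
    (P.face (κ.trans ι)).IsIso ((P.face ι).face κ) := by
  obtain ⟨f⟩ := FaceData.nonempty_face (κ.trans ι) P
  obtain ⟨f₁⟩ := FaceData.nonempty_face ι P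
  obtain ⟨f₂⟩ := FaceData.nonempty_face κ (P.face ι)
  obtain ⟨f₃⟩ := FaceData.nonempty_comp f₁ f₂
  exact f.isIso f₃

theorem face_relabel (σ : Equiv.Perm (Fin n)) (ι : Fin k ↪ Fin l) (P : EdgeLabelled g n l) :
    ((P.face ι).relabel σ).IsIso ((P.relabel σ).face ι) := by
  obtain ⟨f⟩ := FaceData.nonempty_face ι P
  obtain ⟨f₁⟩ := FaceData.nonempty_face ι (P.relabel σ)
  exact (f.relabel σ).isIso f₁

theorem IsIso.relabel (σ : Equiv.Perm (Fin n)) {P Q : EdgeLabelled g n k} (h : P.IsIso Q) :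
    (P.relabel σ).IsIso (Q.relabel σ) := by
  obtain ⟨f⟩ := FaceData.nonempty_of_isIso h
  obtain ⟨f₀⟩ := FaceData.nonempty_of_isIso (IsIso.refl (P.relabel σ))
  exact f₀.isIso (f.relabel σ)

theorem relabel_relabel (σ τ : Equiv.Perm (Fin n)) (P : EdgeLabelled g n k) :
    (P.relabel σ).relabel τ = P.relabel (τ * σ) := by
  unfold EdgeLabelled.relabel
  congr 2

theorem relabel_one (P : EdgeLabelled g n k) : P.relabel 1 = P := rfl

theorem IsIso.card_V {P Q : EdgeLabelled g n k} (h : P.IsIso Q) :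
    Nat.card P.graph.V = Nat.card Q.graph.V :=
  Nat.card_congr h.choose.onV

/-- Isomorphism of edge-labelled pairs is an equivalence relation. -/
def isoSetoid (g n k : ℕ) : Setoid (EdgeLabelled g n k) where
  r := IsIso
  iseqv := ⟨IsIso.refl, IsIso.symm, IsIso.trans⟩

end EdgeLabelled

/-! ### The symmetric Δ-complex -/

/-- The category `I`: its objects are the sets `[p] = {0, …, p}` for `p ≥ -1`, where `[-1] = ∅`,
recorded by their size `p + 1`; its morphisms are all injections. -/
structure SymInd : Type where
  size : ℕ

instance : Category SymInd where
  Hom a b := Fin a.size ↪ Fin b.size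
  id a := Function.Embedding.refl _
  comp f f' := f.trans f'

/-- A symmetric Δ-complex is a functor `Iᵒᵖ ⥤ Set`. -/
abbrev SymDeltaComplex : Type 2 := SymIndᵒᵖ ⥤ Type 1

/-- The set `Δ_{g,n}[k - 1]` of isomorphism classes of edge-labelled pairs with `k` edges. -/
def Simplex (g n k : ℕ) : Type 1 := Quotient (EdgeLabelled.isoSetoid g n k)

namespace Simplex

variable {g n k l : ℕ}

/-- The class `[G, τ]`. -/
def mk (P : EdgeLabelled g n k) : Simplex g n k := Quotient.mk (EdgeLabelled.isoSetoid g n k) P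

theorem mk_surjective : Function.Surjective (mk : EdgeLabelled g n k → Simplex g n k) :=
  Quotient.mk_surjective

theorem mk_eq_iff {P Q : EdgeLabelled g n k} : mk P = mk Q ↔ P.IsIso Q :=
  Quotient.eq (r := EdgeLabelled.isoSetoid g n k)

/-- The face map along an injection. -/
noncomputable def face (ι : Fin k ↪ Fin l) : Simplex g n l → Simplex g n k :=
  Quotient.map' (s₁ := EdgeLabelled.isoSetoid g n l) (s₂ := EdgeLabelled.isoSetoid g n k)
    (EdgeLabelled.face ι) (fun _ _ h => EdgeLabelled.IsIso.face ι h)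

theorem face_mk (ι : Fin k ↪ Fin l) (P : EdgeLabelled g n l) : face ι (mk P) = mk (P.face ι) := rfl

/-- `σ · [G, τ] = [σG, τ]`, where `σG` has the marking function `m ∘ σ⁻¹`. -/
def relabel (σ : Equiv.Perm (Fin n)) : Simplex g n k → Simplex g n k :=
  Quotient.map' (s₁ := EdgeLabelled.isoSetoid g n k) (s₂ := EdgeLabelled.isoSetoid g n k)
    (EdgeLabelled.relabel σ) (fun _ _ h => EdgeLabelled.IsIso.relabel σ h)

theorem relabel_mk (σ : Equiv.Perm (Fin n)) (P : EdgeLabelled g n k) :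
    relabel σ (mk P) = mk (P.relabel σ) := rfl

/-- The number of vertices of `G` in `[G, τ]`. -/
noncomputable def numVertices : Simplex g n k → ℕ :=
  Quotient.lift (s := EdgeLabelled.isoSetoid g n k) (fun P => Nat.card P.graph.V)
    (fun _ _ h => EdgeLabelled.IsIso.card_V h)

theorem numVertices_mk (P : EdgeLabelled g n k) : numVertices (mk P) = Nat.card P.graph.V := rfl

end Simplex

/-- The symmetric Δ-complex `Δ_{g,n}`. -/
noncomputable def Delta (g n : ℕ) : SymDeltaComplex where
  obj a := Simplex g n a.unop.size
  map ι := TypeCat.ofHom (Simplex.face ι.unop)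
  map_id a := by
    ext x
    obtain ⟨P, rfl⟩ := Simplex.mk_surjective x
    exact Simplex.mk_eq_iff.2 P.face_refl
  map_comp ι κ := by
    ext x
    obtain ⟨P, rfl⟩ := Simplex.mk_surjective x
    exact Simplex.mk_eq_iff.2 (P.face_trans κ.unop ι.unop)

/-- The subcomplex `V^i_{g,n}` of `Δ_{g,n}` formed by the graphs with at most `i` vertices. -/
noncomputable def V (g n i : ℕ) : Subfunctor (Delta g n) where
  obj _ := {x | Simplex.numVertices x ≤ i}
  map {a b} ι x hx := by
    obtain ⟨P, rfl⟩ := Simplex.mk_surjective x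
    have hx' : Nat.card P.graph.V ≤ i := hx
    refine le_trans ?_ hx'
    exact Nat.card_le_card_of_surjective _ (P.graph.comp_surjective (P.offEdges ι.unop))

/-- The automorphism `f_σ` of `Δ_{g,n}` given by the action of `σ ∈ S_n` on the markings. -/
noncomputable def f (g n : ℕ) (σ : Equiv.Perm (Fin n)) : Aut (Delta g n) :=
  NatIso.ofComponents
    (fun _ =>
      { hom := TypeCat.ofHom (Simplex.relabel σ)
        inv := TypeCat.ofHom (Simplex.relabel σ⁻¹)
        hom_inv_id := by
          ext x
          obtain ⟨P, rfl⟩ := Simplex.mk_surjective x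
          refine congrArg Simplex.mk ((P.relabel_relabel σ σ⁻¹).trans ?_)
          rw [inv_mul_cancel, P.relabel_one]
        inv_hom_id := by
          ext x
          obtain ⟨P, rfl⟩ := Simplex.mk_surjective x
          refine congrArg Simplex.mk ((P.relabel_relabel σ⁻¹ σ).trans ?_)
          rw [mul_inv_cancel, P.relabel_one] })
    (fun ι => by
      ext x
      obtain ⟨P, rfl⟩ := Simplex.mk_surjective x
      exact (Simplex.mk_eq_iff.2 (P.face_relabel σ ι.unop)).symm)

end TropModuli

/-!
An automorphism `Φ` of `Δ_{g,n}` is a family of bijections between edge-labelled stable graphs that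
commutes with the contraction of edges. It is determined on graphs with few edges by what it does
on graphs with many edges, and conversely the image of a graph is constrained by the images of its
contractions. The proof plays these two observations against each other.

*The number of vertices is preserved* (`FaceAut.numVertices_app`). By induction on the number of
edges, this amounts to the statement that the unique graph with one vertex and a given number of
edges is not sent to a graph `y` with two vertices. The contractions of `y` have one vertex, so `y`
is a banana, and any graph all of whose contractions have one vertex goes to a graph all of whose
contractions are `y`. There is at most one such graph (`eq_of_del_eq_two`, `triangle_of_del_eq`),
or none, whereas its source is not unique. Consequently `Φ` preserves which edges are loops; and
since two loops of a graph with two vertices are at the same vertex precisely when they arise from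
three parallel edges by the contraction of one of them, `Φ` preserves all ends of edges of a graph
with two vertices (`FaceAut.exists_shape_app`). Weights come from the contraction of loops, so it
remains to consider graphs with two vertices of weight zero and their markings
(`FaceAut.app_eq_self`). This settles `n = 0`.

*The markings* are detected by pods, graphs with two vertices one of which has no loops and only
three half-edges and markings in total. Let a vertex `a` of a graph `x` with two vertices carry
some loops `F` and markings `N`. Splitting off a new vertex from `a`, joined to `a` by a new edge
and the edges in `F` and carrying `N`, yields a graph with three vertices. It contracts both to `x`
and, along an old edge, to a graph in which the new vertex has become a pod. If `Φ` fixes this pod,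
then the position of `N` in the image of `x` is controlled (`FaceAut.marks_app_of_split`). Choosing
for `F` a loop and for `N` one marking, or `F` empty and for `N` two markings, shows that `Φ` fixes
all graphs with two vertices once it fixes pods (`FaceAut.app_eq_of_loop`,
`FaceAut.app_eq_of_no_loop`).

*The permutation.* If `g ≥ 1`, then the same construction shows that `Φ` sends the pod with two
edges and the marking `x` to such a pod with a marking `σ x` (`FaceAut.exists_pod_app`). If `g =
0`, then the graphs with one edge are the partitions of the markings into two parts with at least
two elements, and the graphs with two edges determine which of these cross (`Simplex.compat_iff`).
The partitions with a part of two elements are recognised by a domination property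
(`Simplex.isDominated_iff`), so `Φ` permutes the pairs of markings and respects disjointness; as `n
≥ 5`, it comes from a permutation `σ` (`exists_perm_of_pairs`). In both cases the composition of
`Φ` with the action of `σ⁻¹` fixes pods. Pods also show that `σ` is unique
(`perm_eq_of_relabel_eq`).
-/

namespace TropModuli

/-! ### Shapes of edge-labelled graphs -/

/-- The data of an edge-labelled weighted marked graph on a given vertex set `W`, up to
isomorphisms that fix the vertices: the two ends of every edge, the weights and the markings. -/
@[ext]
structure Shape (n k : ℕ) (W : Type) where
  ends : Fin k → Sym2 W
  w : W → ℕ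
  m : Fin n → W

open scoped Classical in
/-- The number of ends of an edge that are equal to `v`. -/
noncomputable def mult {W : Type} (v : W) : Sym2 W → ℕ :=
  Sym2.lift ⟨fun a b => (if a = v then 1 else 0) + (if b = v then 1 else 0),
    fun _ _ => Nat.add_comm _ _⟩

open scoped Classical in
theorem mult_mk {W : Type} (v a b : W) :
    mult v s(a, b) = (if a = v then 1 else 0) + (if b = v then 1 else 0) := rfl

theorem mult_map {W W' : Type} {f : W → W'} (hf : Function.Injective f) (v : W) (s : Sym2 W) :
    mult (f v) (s.map f) = mult v s := by
  classical
  induction s using Sym2.ind with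
  | _ a b =>
    rw [Sym2.map_mk, mult_mk, mult_mk]
    congr 1 <;> exact if_congr hf.eq_iff rfl rfl

theorem one_le_mult {W : Type} {v : W} {s : Sym2 W} (h : v ∈ s) : 1 ≤ mult v s := by
  obtain ⟨b, rfl⟩ := h
  simp [mult_mk]

theorem mult_diag {W : Type} (v : W) : mult v s(v, v) = 2 := by simp [mult_mk]

namespace Shape

variable {g n k : ℕ} {W W' : Type}

/-- The valence of a vertex. -/
noncomputable def val (D : Shape n k W) (v : W) : ℕ := ∑ j, mult v (D.ends j)

/-- The number of markings carried by a vertex. -/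
noncomputable def marks (D : Shape n k W) (v : W) : ℕ := Nat.card {i : Fin n // D.m i = v}

/-- The conditions under which a shape comes from a stable graph of genus `g`. Connectedness is
expressed by the absence of proper nonempty sets of vertices closed under adjacency, and the genus
formula and the stability condition are stated without subtraction. -/
structure Stable (g : ℕ) [Fintype W] (D : Shape n k W) : Prop where
  nonempty : Nonempty W
  conn : ∀ p : W → Prop, (∀ j a b, D.ends j = s(a, b) → p a → p b) → ∀ u v, p u → p v
  genus : k + 1 + ∑ v, D.w v = g + Fintype.card W
  stable : ∀ v, 3 ≤ 2 * D.w v + D.val v + D.marks v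

/-- Transport of a shape along a map of vertex sets, with prescribed weights. -/
def map (D : Shape n k W) (f : W → W') (w : W' → ℕ) : Shape n k W' where
  ends j := (D.ends j).map f
  w := w
  m i := f (D.m i)

end Shape

namespace EdgeLabelled

variable {g n k l : ℕ} {W W' : Type}

/-- The two ends of the edge with label `j`. -/
noncomputable def ends (P : EdgeLabelled g n k) (j : Fin k) : Sym2 P.graph.V :=
  s(P.graph.r (P.half j), P.graph.r (P.graph.s (P.half j)))

theorem ends_lbl (P : EdgeLabelled g n k) (h : P.graph.H) :
    P.ends (P.lbl h) = s(P.graph.r h, P.graph.r (P.graph.s h)) := by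
  rcases P.lbl_eq (P.lbl_half (P.lbl h)) with e | e
  · unfold ends; rw [← e]
  · unfold ends
    conv_rhs => rw [e]
    rw [P.graph.s_s, Sym2.eq_swap]

/-- The shape of an edge-labelled graph, on its own vertex set. -/
noncomputable def shape (P : EdgeLabelled g n k) : Shape n k P.graph.V where
  ends := P.ends
  w := P.graph.w
  m := P.graph.m

/-- The half-edges other than the chosen ones are the images of the chosen ones under `s`. -/
theorem halves_bijective (P : EdgeLabelled g n k) : Function.Bijective
    (fun x : Fin k × Bool => if x.2 then P.half x.1 else P.graph.s (P.half x.1)) := by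
  have key : ∀ x : Fin k × Bool,
      P.lbl (if x.2 then P.half x.1 else P.graph.s (P.half x.1)) = x.1 := by
    rintro ⟨j, _ | _⟩
    · simp [lbl_s, lbl_half]
    · simp [lbl_half]
  constructor
  · rintro ⟨j, b⟩ ⟨j', b'⟩ h
    have h1 : j = j' := by
      have := congrArg P.lbl h
      rwa [key, key] at this
    subst h1
    have h2 := P.graph.s_ne (P.half j)
    cases b <;> cases b' <;> simp at h ⊢
    · exact h2 h
    · exact h2 h.symm
  · intro h
    rcases P.lbl_eq (P.lbl_half (P.lbl h)) with e | e
    · exact ⟨(P.lbl h, true), by simpa using e.symm⟩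
    · exact ⟨(P.lbl h, false), by simpa using e.symm⟩

theorem val_eq (P : EdgeLabelled g n k) (v : P.graph.V) : P.graph.val v = P.shape.val v := by
  classical
  unfold HGraph.val Shape.val
  rw [← Nat.card_congr ((Equiv.ofBijective _ P.halves_bijective).subtypeEquiv
    (p := fun x => P.graph.r ((Equiv.ofBijective _ P.halves_bijective) x) = v)
    (fun _ => Iff.rfl)), Nat.card_eq_fintype_card, Fintype.card_subtype, Finset.card_filter,
    Fintype.sum_prod_type]
  refine Finset.sum_congr rfl fun j _ => ?_
  simp only [Equiv.ofBijective_apply, Fintype.sum_bool, shape, ends, mult_mk]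
  simp

theorem shape_stable (P : EdgeLabelled g n k) : P.shape.Stable g where
  nonempty := P.stable.connected.1
  conn p hp u v hu := by
    have key : ∀ a b, Relation.EqvGen (P.graph.Link Set.univ) a b → (p a ↔ p b) := by
      intro a b h
      induction h with
      | rel a b h =>
        obtain ⟨h, -, rfl, rfl⟩ := h
        have e := P.ends_lbl h
        exact ⟨hp _ _ _ e, hp _ _ _ (e.trans Sym2.eq_swap)⟩
      | refl a => exact Iff.rfl
      | symm a b _ ih => exact ih.symm
      | trans a b c _ _ ih1 ih2 => exact ih1.trans ih2
    exact (key _ _ (P.stable.connected.2 u v)).1 hu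
  genus := by
    have h := P.stable.genus
    unfold HGraph.b1 at h
    rw [Nat.card_congr P.τ, Nat.card_fin, Nat.card_eq_fintype_card] at h
    have : ((k + 1 + ∑ v, P.graph.w v : ℕ) : ℤ) = (g + Fintype.card P.graph.V : ℕ) := by
      push_cast
      linarith
    exact_mod_cast this
  stable v := by
    have h := P.stable.stable v
    rw [P.val_eq v] at h
    change 3 ≤ 2 * P.graph.w v + _ + Nat.card {i : Fin n // P.graph.m i = v}
    omega

/-- `P` is isomorphic to an edge-labelled graph of shape `D`. -/
def HasShape (P : EdgeLabelled g n k) (D : Shape n k W) : Prop :=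
  ∃ e : P.graph.V ≃ W, (∀ j, (P.ends j).map e = D.ends j) ∧ (∀ v, D.w (e v) = P.graph.w v) ∧
    ∀ i, e (P.graph.m i) = D.m i

/-- A map of half-edges is recovered from a map of vertices that is compatible with the ends of
all edges. -/
theorem exists_halfEdgeMap (ι : Fin k ↪ Fin l) (P : EdgeLabelled g n l) (Q : EdgeLabelled g n k)
    (f : P.graph.V → Q.graph.V) (hf : ∀ j, (P.ends (ι j)).map f = Q.ends j) :
    ∃ fH : Q.graph.H → P.graph.H, (∀ h, fH (Q.graph.s h) = P.graph.s (fH h)) ∧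
      (∀ h, Q.graph.r h = f (P.graph.r (fH h))) ∧ ∀ h, P.lbl (fH h) = ι (Q.lbl h) := by
  classical
  have ex : ∀ j, ∃ a, P.lbl a = ι j ∧ f (P.graph.r a) = Q.graph.r (Q.half j) ∧
      f (P.graph.r (P.graph.s a)) = Q.graph.r (Q.graph.s (Q.half j)) := by
    intro j
    have h := hf j
    simp only [ends, Sym2.map_mk, Sym2.eq_iff] at h
    rcases h with h | h
    · exact ⟨_, P.lbl_half _, h⟩
    · exact ⟨P.graph.s (P.half (ι j)), by rw [P.lbl_s, P.lbl_half], h.2, by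
        rw [P.graph.s_s]; exact h.1⟩
  choose a ha1 ha2 ha3 using ex
  refine ⟨fun h => if h = Q.half (Q.lbl h) then a (Q.lbl h) else P.graph.s (a (Q.lbl h)),
    ?_, ?_, ?_⟩
  · intro h
    simp only [Q.lbl_s]
    rcases Q.lbl_eq (Q.lbl_half (Q.lbl h)) with e | e
    · rw [if_pos e, if_neg]
      rw [← e]; exact Q.graph.s_ne h
    · have e' : Q.graph.s h = Q.half (Q.lbl h) := by
        conv_lhs => rw [e]
        rw [Q.graph.s_s]
      rw [if_pos e', if_neg, P.graph.s_s]
      rw [← e']; exact (Q.graph.s_ne h).symm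
  · intro h
    rcases Q.lbl_eq (Q.lbl_half (Q.lbl h)) with e | e
    · simp only [if_pos e, ha2]; rw [← e]
    · have e' : ¬ h = Q.half (Q.lbl h) := by
        intro e''
        rw [← e''] at e
        exact Q.graph.s_ne h e.symm
      simp only [if_neg e', ha3]
      rw [← e]
  · intro h
    dsimp only
    split_ifs
    · exact ha1 _
    · rw [P.lbl_s]; exact ha1 _

theorem isIso_of_hasShape {P Q : EdgeLabelled g n k} {D : Shape n k W} (hP : P.HasShape D)
    (hQ : Q.HasShape D) : P.IsIso Q := by
  classical
  obtain ⟨e, he, hw, hm⟩ := hP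
  obtain ⟨e', he', hw', hm'⟩ := hQ
  let φ := e.trans e'.symm
  obtain ⟨fH, h1, h2, h3⟩ := exists_halfEdgeMap (Function.Embedding.refl _) P Q φ (by
    intro j
    refine Sym2.map.injective e'.injective ?_
    rw [he', ← he, Sym2.map_map]
    refine congrFun (congrArg Sym2.map ?_) _
    funext x
    simp [φ])
  obtain ⟨f⟩ := FaceData.nonempty_of_isIso (IsIso.refl P)
  have hr : ∀ j, j ∈ Set.range (Function.Embedding.refl (Fin k)) := fun j => ⟨j, rfl⟩
  refine f.isIso (Q' := Q) ⟨φ, fH, φ.surjective, h1, h2, h3, ?_, ?_, ?_⟩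
  · intro i
    rw [Equiv.trans_apply, hm, ← hm', Equiv.symm_apply_apply]
  · intro u v
    constructor
    · intro h
      rw [φ.injective h]
      exact .refl _
    · intro h
      induction h with
      | rel u v h =>
        obtain ⟨h, hh, -⟩ := h
        exact absurd (hr _) hh
      | refl u => rfl
      | symm u v _ ih => exact ih.symm
      | trans u v w _ _ ih1 ih2 => exact ih1.trans ih2
  · intro c
    obtain ⟨u, rfl⟩ := φ.surjective c
    have h1 : (Finset.univ.filter fun v => φ v = φ u) = {u} := by
      ext v; simp
    have h2 : IsEmpty {j : Fin k // j ∉ Set.range (Function.Embedding.refl (Fin k)) ∧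
        φ (P.graph.r (P.half j)) = φ u} := ⟨fun x => x.2.1 (hr _)⟩
    rw [h1, Finset.sum_singleton, Nat.card_of_isEmpty, ← hw, ← hw']
    simp [φ]

theorem exists_equiv_of_hasShape {P : EdgeLabelled g n k} {D : Shape n k W} {D' : Shape n k W'}
    (hP : P.HasShape D) (hP' : P.HasShape D') : ∃ φ : W ≃ W', D' = D.map φ D'.w ∧
      ∀ v, D'.w (φ v) = D.w v := by
  obtain ⟨e, he, hw, hm⟩ := hP
  obtain ⟨e', he', hw', hm'⟩ := hP'
  refine ⟨e.symm.trans e', ?_, fun v => ?_⟩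
  · refine Shape.ext (funext fun j => ?_) rfl (funext fun i => ?_)
    · change _ = Sym2.map _ (D.ends j)
      rw [← he, Sym2.map_map, ← he']
      refine congrFun (congrArg Sym2.map ?_) _
      funext x
      simp
    · change _ = (e.symm.trans e') (D.m _)
      rw [← hm, ← hm']
      simp
  · obtain ⟨u, rfl⟩ := e.surjective v
    rw [hw, ← hw']
    simp

theorem HasShape.of_equiv {P : EdgeLabelled g n k} {D : Shape n k W} (hP : P.HasShape D)
    (φ : W ≃ W') : P.HasShape (D.map φ (D.w ∘ φ.symm)) := by
  obtain ⟨e, he, hw, hm⟩ := hP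
  refine ⟨e.trans φ, fun j => ?_, fun v => ?_, fun i => ?_⟩
  · change _ = Sym2.map _ (D.ends j)
    rw [← he, Sym2.map_map]
    rfl
  · simp [Shape.map, hw]
  · simp [Shape.map, hm]

theorem hasShape_shape (P : EdgeLabelled g n k) : P.HasShape P.shape :=
  ⟨Equiv.refl _, fun j => by
    change Sym2.map id (P.ends j) = _
    rw [Sym2.map_id]; rfl, fun _ => rfl, fun _ => rfl⟩

theorem HasShape.stable [Fintype W] {P : EdgeLabelled g n k} {D : Shape n k W}
    (hP : P.HasShape D) : D.Stable g := by
  obtain ⟨e, he, hw, hm⟩ := hP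
  have h := P.shape_stable
  refine ⟨h.nonempty.map e, fun p hp u v hu => ?_, ?_, fun v => ?_⟩
  · have := h.conn (fun x => p (e x)) (fun j a b hj ha => hp j (e a) (e b) ?_ ha) (e.symm u)
      (e.symm v) (by simpa using hu)
    · simpa using this
    · rw [← he]
      exact congrArg (Sym2.map e) hj
  · rw [← Fintype.card_congr e, ← h.genus]
    congr 1
    exact (Fintype.sum_equiv e _ _ fun x => (hw x).symm).symm
  · obtain ⟨u, rfl⟩ := e.surjective v
    have h1 : D.val (e u) = P.shape.val u :=
      Finset.sum_congr rfl fun j _ => by rw [← he, mult_map e.injective]; rfl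
    have h2 : D.marks (e u) = P.shape.marks u :=
      Nat.card_congr (Equiv.subtypeEquivRight fun i => by rw [← hm, e.injective.eq_iff]; rfl)
    rw [h1, h2, hw]
    exact h.stable u

/-- Every shape satisfying the stability conditions comes from a stable graph. -/
theorem exists_hasShape [Fintype W] {D : Shape n k W} (hD : D.Stable g) :
    ∃ P : EdgeLabelled g n k, P.HasShape D := by
  classical
  have ex : ∀ j, ∃ ab : W × W, s(ab.1, ab.2) = D.ends j := fun j => by
    induction h : D.ends j using Sym2.ind with
    | _ a b => exact ⟨(a, b), rfl⟩
  choose ab hab using ex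
  let G : MarkedGraph n :=
    { V := W
      H := Fin k × Bool
      r := fun h => if h.2 then (ab h.1).1 else (ab h.1).2
      s := fun h => (h.1, !h.2)
      s_s := fun h => by simp
      s_ne := fun h e => by simpa using congrArg Prod.snd e
      w := D.w
      m := D.m }
  let t : G.E → Fin k := Quotient.lift (s := G.edgeSetoid) Prod.fst (by
    rintro a b (rfl | rfl) <;> rfl)
  have ht : Function.Bijective t := by
    constructor
    · intro x y hxy
      obtain ⟨⟨j, b⟩, rfl⟩ := G.edge_surjective x
      obtain ⟨⟨j', b'⟩, rfl⟩ := G.edge_surjective y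
      have : j = j' := hxy
      subst this
      rw [G.edge_eq_iff]
      change (j, b') = (j, b) ∨ (j, b') = (j, !b)
      cases b <;> cases b' <;> simp
    · intro j
      exact ⟨G.edge (j, true), rfl⟩
  let τ : G.E ≃ Fin k := Equiv.ofBijective t ht
  have hval : ∀ v, G.val v = D.val v := by
    intro v
    unfold HGraph.val Shape.val
    rw [Nat.card_eq_fintype_card, Fintype.card_subtype, Finset.card_filter]
    change (∑ x : Fin k × Bool, if G.r x = v then 1 else 0) = _
    rw [Fintype.sum_prod_type]
    refine Finset.sum_congr rfl fun j _ => ?_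
    rw [← hab, mult_mk, Fintype.sum_bool]
    simp [G]
  have hst : G.IsStable g := by
    refine ⟨⟨hD.nonempty, fun u v => ?_⟩, ?_, fun v => ?_⟩
    · refine hD.conn (fun x => Relation.EqvGen (G.Link Set.univ) u x) ?_ u v (.refl _)
      intro j a b hj ha
      refine ha.trans _ _ _ ?_
      rw [← hab, Sym2.eq_iff] at hj
      rcases hj with ⟨rfl, rfl⟩ | ⟨rfl, rfl⟩
      · exact .rel _ _ ⟨(j, true), Set.mem_univ _, rfl, rfl⟩
      · exact .rel _ _ ⟨(j, false), Set.mem_univ _, rfl, rfl⟩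
    · have h := hD.genus
      unfold HGraph.b1
      rw [Nat.card_congr τ, Nat.card_fin]
      change (k : ℤ) - Nat.card W + 1 + ∑ v : W, (D.w v : ℤ) = g
      rw [Nat.card_eq_fintype_card]
      have h' : ((k + 1 + ∑ v, D.w v : ℕ) : ℤ) = (g + Fintype.card W : ℕ) := by rw [h]
      push_cast at h'
      linarith
    · have h := hD.stable v
      rw [hval]
      change 0 < 2 * (D.w v : ℤ) - 2 + _ + (D.marks v : ℤ)
      omega
  let P : EdgeLabelled g n k := ⟨G, hst, τ⟩
  refine ⟨P, Equiv.refl _, fun j => ?_, fun _ => rfl, fun _ => rfl⟩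
  change Sym2.map id (P.ends j) = _
  rw [Sym2.map_id, id]
  have h1 : P.lbl (j, true) = j := rfl
  conv_lhs => rw [← h1]
  rw [P.ends_lbl, ← hab]
  rfl

/-- The ends of the edges of a face. -/
theorem FaceData.map_ends {ι : Fin k ↪ Fin l} {P : EdgeLabelled g n l} {Q : EdgeLabelled g n k}
    (f : FaceData ι P Q) (j : Fin k) : (P.ends (ι j)).map f.fV = Q.ends j := by
  obtain ⟨h, rfl⟩ := Q.lbl_surjective j
  rw [← f.fH_lbl, P.ends_lbl, Q.ends_lbl, f.fH_r, f.fH_r, f.fH_s]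
  rfl

end EdgeLabelled

namespace EdgeLabelled

variable {g n k l : ℕ} {W W' : Type}

theorem HasShape.of_isIso {P Q : EdgeLabelled g n k} {D : Shape n k W} (h : P.IsIso Q)
    (hP : P.HasShape D) : Q.HasShape D := by
  obtain ⟨φ, hφ⟩ := h
  obtain ⟨e, he, hw, hm⟩ := hP
  have key : ∀ j, (P.ends j).map φ.onV = Q.ends j := by
    intro j
    obtain ⟨h, rfl⟩ := P.lbl_surjective j
    have e1 : Q.lbl (φ.onH h) = P.lbl h := hφ (P.graph.edge h)
    rw [← e1, Q.ends_lbl, e1, P.ends_lbl, φ.r_comm, φ.s_comm, φ.r_comm]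
    rfl
  refine ⟨φ.onV.symm.trans e, fun j => ?_, fun v => ?_, fun i => ?_⟩
  · rw [← key, Sym2.map_map, ← he]
    refine congrFun (congrArg Sym2.map ?_) _
    funext x
    simp
  · obtain ⟨u, rfl⟩ := φ.onV.surjective v
    rw [φ.w_comm, ← hw]
    simp
  · rw [φ.m_comm, ← hm]
    simp

open scoped Classical in
/-- The shape of the graph obtained by contracting one edge. The map `q` on vertices identifies the
two ends of that edge and nothing else. -/
theorem HasShape.contract_edge [Fintype W] {P : EdgeLabelled g n (k + 1)} {D : Shape n (k + 1) W}
    (hP : P.HasShape D) (j : Fin (k + 1)) {D' : Shape n k W'} (q : W → W')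
    (hq : Function.Surjective q) (hker : ∀ x y, q x = q y ↔ x = y ∨ D.ends j = s(x, y))
    (hends : ∀ i, (D.ends (j.succAbove i)).map q = D'.ends i) (hm : ∀ i, q (D.m i) = D'.m i)
    (hw : ∀ c, D'.w c + (Finset.univ.filter fun x => q x = c).card =
      (∑ x with q x = c, D.w x) + 1 + if (D.ends j).map q = s(c, c) then 1 else 0) :
    (P.face j.succAboveEmb).HasShape D' := by
  obtain ⟨e, he, hwe, hme⟩ := hP
  obtain ⟨f⟩ := FaceData.nonempty_face j.succAboveEmb P
  have hrange : ∀ i, i ∉ Set.range j.succAboveEmb ↔ i = j := fun i => by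
    change i ∉ Set.range j.succAbove ↔ _
    rw [Fin.range_succAbove]; simp
  have hlink : ∀ u v, P.graph.Link (P.offEdges j.succAboveEmb) u v ↔ P.ends j = s(u, v) := by
    intro u v
    constructor
    · rintro ⟨h, hh, rfl, rfl⟩
      have : P.lbl h = j := (hrange _).1 hh
      rw [← this, P.ends_lbl]
    · intro h
      rw [ends, Sym2.eq_iff] at h
      rcases h with h | h
      · exact ⟨P.half j, (hrange _).2 (P.lbl_half j), h⟩
      · refine ⟨P.graph.s (P.half j), (hrange _).2 ?_, h.2, by rw [P.graph.s_s]; exact h.1⟩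
        exact (P.lbl_s _).trans (P.lbl_half j)
  have hker' : ∀ u v, f.fV u = f.fV v ↔ q (e u) = q (e v) := by
    intro u v
    rw [f.ker]
    constructor
    · intro h
      induction h with
      | rel u v h =>
        refine (hker _ _).2 (Or.inr ?_)
        rw [← he, (hlink _ _).1 h]
        rfl
      | refl u => rfl
      | symm u v _ ih => exact ih.symm
      | trans u v w _ _ ih1 ih2 => exact ih1.trans ih2
    · intro h
      rcases (hker _ _).1 h with h | h
      · rw [e.injective h]; exact .refl _
      · refine .rel _ _ ((hlink _ _).2 (Sym2.map.injective e.injective ?_))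
        rw [he, h]
        rfl
  have hs := Function.surjInv_eq f.fV_surj
  let e' : (P.face j.succAboveEmb).graph.V → W' := fun c => q (e (Function.surjInv f.fV_surj c))
  have e'_apply : ∀ u, e' (f.fV u) = q (e u) := fun u => (hker' _ _).1 (hs _)
  have he'b : Function.Bijective e' := by
    constructor
    · intro c c' h
      obtain ⟨u, rfl⟩ := f.fV_surj c
      obtain ⟨u', rfl⟩ := f.fV_surj c'
      rw [e'_apply, e'_apply] at h
      exact (hker' _ _).2 h
    · intro c
      obtain ⟨x, rfl⟩ := hq c
      obtain ⟨u, rfl⟩ := e.surjective x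
      exact ⟨_, e'_apply u⟩
  refine ⟨Equiv.ofBijective e' he'b, fun i => ?_, fun c => ?_, fun i => ?_⟩
  · rw [← f.map_ends, ← hends, Sym2.map_map]
    change _ = Sym2.map q (D.ends (j.succAboveEmb i))
    rw [← he, Sym2.map_map]
    refine congrFun (congrArg Sym2.map ?_) _
    funext u
    exact e'_apply u
  · obtain ⟨u, rfl⟩ := f.fV_surj c
    rw [Equiv.ofBijective_apply, e'_apply]
    have h1 := f.map_w (f.fV u)
    have h2 : ∑ v with f.fV v = f.fV u, ((P.graph.w v : ℤ) - 1) =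
        ∑ x with q x = q (e u), ((D.w x : ℤ) - 1) := by
      refine Finset.sum_equiv e (fun v => ?_) (fun v _ => by rw [hwe])
      simp [hker']
    have h3 : Nat.card {i : Fin (k + 1) // i ∉ Set.range j.succAboveEmb ∧
        f.fV (P.graph.r (P.half i)) = f.fV u} =
        if (D.ends j).map q = s(q (e u), q (e u)) then 1 else 0 := by
      have h4 : (D.ends j).map q = s(q (e u), q (e u)) ↔
          f.fV (P.graph.r (P.half j)) = f.fV u := by
        have h5 : f.fV (P.graph.r (P.half j)) = f.fV (P.graph.r (P.graph.s (P.half j))) :=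
          (f.ker _ _).2 (.rel _ _ ((hlink _ _).2 rfl))
        rw [← he, Sym2.map_map, ends, Sym2.map_mk, Sym2.eq_iff, or_self]
        simp only [Function.comp, ← hker']
        rw [← h5, and_self]
      split_ifs with h
      · refine Nat.card_eq_one_iff_unique.2 ⟨⟨fun a b => Subtype.ext ?_⟩,
          ⟨⟨j, (hrange j).2 rfl, h4.1 h⟩⟩⟩
        rw [(hrange _).1 a.2.1, (hrange _).1 b.2.1]
      · rw [Nat.card_eq_zero]
        refine Or.inl ⟨?_⟩
        rintro ⟨i, hi, hi'⟩
        have := (hrange i).1 hi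
        subst this
        exact h (h4.2 hi')
    rw [h2, h3, Finset.sum_sub_distrib, Finset.sum_const, nsmul_eq_mul, mul_one] at h1
    have h6 := hw (q (e u))
    zify at h6
    push_cast at h1
    have : (D'.w (q (e u)) : ℤ) = (P.face j.succAboveEmb).graph.w (f.fV u) := by linarith
    exact_mod_cast this
  · rw [f.map_m, Equiv.ofBijective_apply, e'_apply, hme, hm]

/-- Relabelling the edges by a permutation. -/
theorem HasShape.permute {P : EdgeLabelled g n k} {D : Shape n k W}
    (hP : P.HasShape D) (π : Equiv.Perm (Fin k)) :
    (P.face π.toEmbedding).HasShape ⟨D.ends ∘ π, D.w, D.m⟩ := by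
  classical
  obtain ⟨e, he, hwe, hme⟩ := hP
  obtain ⟨f⟩ := FaceData.nonempty_face π.toEmbedding P
  have hr : ∀ j, j ∈ Set.range π.toEmbedding := fun j => π.surjective j
  have hinj : Function.Injective f.fV := by
    intro u v h
    have := (f.ker _ _).1 h
    clear h
    induction this with
    | rel u v h =>
      obtain ⟨h, hh, -⟩ := h
      exact absurd (hr _) hh
    | refl u => rfl
    | symm u v _ ih => exact ih.symm
    | trans u v w _ _ ih1 ih2 => exact ih1.trans ih2
  let φ : P.graph.V ≃ (P.face π.toEmbedding).graph.V := Equiv.ofBijective _ ⟨hinj, f.fV_surj⟩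
  refine ⟨φ.symm.trans e, fun j => ?_, fun c => ?_, fun i => ?_⟩
  · rw [← f.map_ends, Sym2.map_map]
    change _ = D.ends (π j)
    rw [← he]
    refine congrFun (congrArg Sym2.map ?_) _
    funext u
    exact congrArg e (φ.symm_apply_apply u)
  · obtain ⟨u, rfl⟩ := φ.surjective c
    have h1 := f.map_w (f.fV u)
    have h2 : (Finset.univ.filter fun v => f.fV v = f.fV u) = {u} := by
      ext v; simp [hinj.eq_iff]
    have h3 : IsEmpty {j : Fin k // j ∉ Set.range π.toEmbedding ∧
        f.fV (P.graph.r (P.half j)) = f.fV u} := ⟨fun x => x.2.1 (hr _)⟩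
    rw [h2, Finset.sum_singleton, Nat.card_of_isEmpty] at h1
    rw [Equiv.trans_apply, φ.symm_apply_apply]
    change D.w (e u) = (P.face π.toEmbedding).graph.w (f.fV u)
    rw [hwe]
    have : (P.graph.w u : ℤ) = (P.face π.toEmbedding).graph.w (f.fV u) := by
      push_cast at h1; linarith
    exact_mod_cast this
  · rw [f.map_m]
    change e (φ.symm (φ (P.graph.m i))) = _
    rw [φ.symm_apply_apply]
    exact hme i

end EdgeLabelled

namespace Simplex

variable {g n k : ℕ} {W W' : Type}

/-- The simplex `x` is the class of an edge-labelled graph of shape `D`. -/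
def HasShape (x : Simplex g n k) (D : Shape n k W) : Prop := ∃ P, mk P = x ∧ P.HasShape D

/-- A simplex is determined by its shape. -/
theorem eq_of_hasShape {x y : Simplex g n k} {D : Shape n k W} (hx : x.HasShape D)
    (hy : y.HasShape D) : x = y := by
  obtain ⟨P, rfl, hP⟩ := hx
  obtain ⟨Q, rfl, hQ⟩ := hy
  exact mk_eq_iff.2 (EdgeLabelled.isIso_of_hasShape hP hQ)

/-- Two shapes of a simplex differ by a bijection of the vertices. -/
theorem HasShape.exists_equiv {x : Simplex g n k} {D : Shape n k W} {D' : Shape n k W'}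
    (hx : x.HasShape D) (hx' : x.HasShape D') : ∃ φ : W ≃ W', D' = D.map φ D'.w ∧
      ∀ v, D'.w (φ v) = D.w v := by
  obtain ⟨P, rfl, hP⟩ := hx
  obtain ⟨Q, hQ', hQ⟩ := hx'
  exact EdgeLabelled.exists_equiv_of_hasShape (hP.of_isIso (mk_eq_iff.1 hQ').symm) hQ

theorem HasShape.of_equiv {x : Simplex g n k} {D : Shape n k W} (hx : x.HasShape D)
    (φ : W ≃ W') : x.HasShape (D.map φ (D.w ∘ φ.symm)) := by
  obtain ⟨P, rfl, hP⟩ := hx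
  exact ⟨P, rfl, hP.of_equiv φ⟩

theorem HasShape.stable [Fintype W] {x : Simplex g n k} {D : Shape n k W} (hx : x.HasShape D) :
    D.Stable g := by
  obtain ⟨P, rfl, hP⟩ := hx
  exact hP.stable

theorem exists_hasShape [Fintype W] {D : Shape n k W} (hD : D.Stable g) :
    ∃ x : Simplex g n k, x.HasShape D := by
  obtain ⟨P, hP⟩ := EdgeLabelled.exists_hasShape hD
  exact ⟨mk P, P, rfl, hP⟩

theorem HasShape.numVertices_eq [Fintype W] {x : Simplex g n k} {D : Shape n k W}
    (hx : x.HasShape D) : x.numVertices = Fintype.card W := by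
  obtain ⟨P, rfl, e, -⟩ := hx
  rw [numVertices_mk, Nat.card_congr e, Nat.card_eq_fintype_card]

theorem exists_shape [Fintype W] (x : Simplex g n k) (h : x.numVertices = Fintype.card W) :
    ∃ D : Shape n k W, x.HasShape D := by
  obtain ⟨P, rfl⟩ := mk_surjective x
  rw [numVertices_mk, Nat.card_eq_fintype_card] at h
  exact ⟨_, P, rfl, P.hasShape_shape.of_equiv (Fintype.equivOfCardEq h)⟩

theorem exists_shape_fin (x : Simplex g n k) :
    ∃ D : Shape n k (Fin x.numVertices), x.HasShape D := x.exists_shape (by simp)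

theorem HasShape.relabel {x : Simplex g n k} {D : Shape n k W} (hx : x.HasShape D)
    (σ : Equiv.Perm (Fin n)) : (x.relabel σ).HasShape ⟨D.ends, D.w, D.m ∘ ⇑σ⁻¹⟩ := by
  obtain ⟨P, rfl, e, he, hw, hm⟩ := hx
  refine ⟨P.relabel σ, rfl, e, fun j => ?_, hw, fun i => hm _⟩
  obtain ⟨h, rfl⟩ := P.lbl_surjective j
  rw [← he, P.ends_lbl]
  exact congrArg (Sym2.map e) ((P.relabel σ).ends_lbl h)

theorem HasShape.permute {x : Simplex g n k} {D : Shape n k W} (hx : x.HasShape D)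
    (π : Equiv.Perm (Fin k)) : (face π.toEmbedding x).HasShape ⟨D.ends ∘ π, D.w, D.m⟩ := by
  obtain ⟨P, rfl, hP⟩ := hx
  exact ⟨_, rfl, hP.permute π⟩

/-- The face of a simplex obtained by contracting the edge with label `j`. -/
noncomputable def del (j : Fin (k + 1)) (x : Simplex g n (k + 1)) : Simplex g n k :=
  face j.succAboveEmb x

open scoped Classical in
/-- Contraction of a loop. -/
theorem HasShape.del_loop {x : Simplex g n (k + 1)} {D : Shape n (k + 1) W}
    (hx : x.HasShape D) {j : Fin (k + 1)} {a : W} (hj : D.ends j = s(a, a)) :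
    (x.del j).HasShape ⟨fun i => D.ends (j.succAbove i),
      fun v => D.w v + if v = a then 1 else 0, D.m⟩ := by
  obtain ⟨P, rfl, hP⟩ := hx
  have : Fintype W := Fintype.ofEquiv _ hP.choose
  refine ⟨_, rfl, hP.contract_edge j id Function.surjective_id ?_ (fun i => ?_) (fun i => rfl) ?_⟩
  · intro x y
    rw [hj, Sym2.eq_iff]
    simp only [id]
    constructor
    · exact Or.inl
    · rintro (h | ⟨h, h'⟩ | ⟨h, h'⟩)
      · exact h
      · exact h.symm.trans h'
      · exact h'.symm.trans h
  · rw [Sym2.map_id]; rfl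
  · intro c
    have h1 : (Finset.univ.filter fun x : W => id x = c) = {c} := by ext; simp
    have h2 : Sym2.map id (D.ends j) = s(c, c) ↔ c = a := by
      rw [hj, Sym2.map_id, id, Sym2.eq_iff]
      constructor
      · rintro (h | h) <;> exact h.1.symm
      · rintro rfl; exact Or.inl ⟨rfl, rfl⟩
    rw [h1]
    simp only [Finset.card_singleton, Finset.sum_singleton, h2]
    ring

open scoped Classical in
/-- Contraction of an edge that is not a loop. -/
theorem HasShape.del_nonloop [Fintype W] {x : Simplex g n (k + 1)} {D : Shape n (k + 1) W}
    (hx : x.HasShape D) {j : Fin (k + 1)} {a b : W} (hj : D.ends j = s(a, b)) (hab : a ≠ b)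
    (q : W → W') (hq : Function.Surjective q)
    (hker : ∀ x y, q x = q y ↔ x = y ∨ (x = a ∧ y = b) ∨ (x = b ∧ y = a)) :
    (x.del j).HasShape ⟨fun i => (D.ends (j.succAbove i)).map q,
      fun c => ∑ x with q x = c, D.w x, q ∘ D.m⟩ := by
  obtain ⟨P, rfl, hP⟩ := hx
  have hqab : q a = q b := (hker a b).2 (Or.inr (Or.inl ⟨rfl, rfl⟩))
  refine ⟨_, rfl, hP.contract_edge j q hq ?_ (fun i => rfl) (fun i => rfl) ?_⟩
  · intro x y
    rw [hker, hj, Sym2.eq_iff]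
    refine or_congr Iff.rfl (or_congr ?_ ?_)
    · exact ⟨fun h => ⟨h.1.symm, h.2.symm⟩, fun h => ⟨h.1.symm, h.2.symm⟩⟩
    · exact ⟨fun h => ⟨h.2.symm, h.1.symm⟩, fun h => ⟨h.2.symm, h.1.symm⟩⟩
  · intro c
    obtain ⟨u, rfl⟩ := hq c
    have h1 : (D.ends j).map q = s(q u, q u) ↔ q a = q u := by
      rw [hj, Sym2.map_mk, Sym2.eq_iff, or_self, ← hqab, and_self]
    simp only [h1]
    rw [add_assoc]
    congr 1
    split_ifs with h
    · have : (Finset.univ.filter fun x => q x = q u) = {a, b} := by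
        ext x
        rw [← h, Finset.mem_filter, hker]
        simp only [Finset.mem_univ, true_and, Finset.mem_insert, Finset.mem_singleton]
        constructor
        · rintro (h | ⟨h, h'⟩ | ⟨h, h'⟩)
          · exact Or.inl h
          · exact Or.inl h
          · exact Or.inr h
        · rintro (h | h)
          · exact Or.inl h
          · exact Or.inr (Or.inr ⟨h, trivial⟩)
      rw [this, Finset.card_pair hab]
    · have : (Finset.univ.filter fun x => q x = q u) = {u} := by
        ext x
        rw [Finset.mem_filter, hker]
        simp only [Finset.mem_univ, true_and, Finset.mem_singleton]
        constructor
        · rintro (h' | ⟨h', h''⟩ | ⟨h', h''⟩)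
          · exact h'
          · exact absurd (by rw [h'', hqab]) h
          · exact absurd (by rw [h'']) h
        · exact Or.inl
      rw [this, Finset.card_singleton]

end Simplex

/-! ### Contracting and splitting -/

namespace Shape

variable {g n k : ℕ} {W : Type}

theorem marks_eq [DecidableEq W] (D : Shape n k W) (v : W) :
    D.marks v = (Finset.univ.filter fun i => D.m i = v).card := by
  rw [marks, Nat.card_eq_fintype_card, Fintype.card_subtype]

theorem le_marks (D : Shape n k W) (v : W) (S : Finset (Fin n)) (hS : ∀ i ∈ S, D.m i = v) :
    S.card ≤ D.marks v := by
  classical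
  rw [marks_eq]
  exact Finset.card_le_card fun i hi => by simpa using hS i hi

theorem marks_le (D : Shape n k W) (v : W) (S : Finset (Fin n)) (hS : ∀ i, D.m i = v → i ∈ S) :
    D.marks v ≤ S.card := by
  classical
  rw [marks_eq]
  exact Finset.card_le_card fun i hi => hS i (by simpa using hi)

theorem Stable.w_eq_zero [Fintype W] {D : Shape n k W} (hD : D.Stable g)
    (h : k + 1 = g + Fintype.card W) (v : W) : D.w v = 0 := by
  have h1 := hD.genus
  have h2 : ∑ v, D.w v = 0 := by omega
  exact (Finset.sum_eq_zero_iff.1 h2) v (Finset.mem_univ v)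

/-- The shape obtained from `D` by splitting off a new vertex `none` of weight zero from the vertex
`p`. It is joined to `p` by a new edge, which gets the label `0`, and by the edges in `F`, which
are loops of `D` at `p`; the markings in `N` move from `p` to the new vertex. -/
def split (D : Shape n k W) (p : W) (F : Finset (Fin k)) (N : Finset (Fin n)) :
    Shape n (k + 1) (Option W) where
  ends := Fin.cons s(none, some p) fun j =>
    if j ∈ F then s(none, some p) else (D.ends j).map some
  w o := o.elim 0 D.w
  m i := if i ∈ N then none else some (D.m i)

theorem split_ends_zero (D : Shape n k W) (p : W) (F : Finset (Fin k)) (N : Finset (Fin n)) :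
    (D.split p F N).ends 0 = s(none, some p) := rfl

theorem split_ends_succ (D : Shape n k W) (p : W) (F : Finset (Fin k)) (N : Finset (Fin n))
    (j : Fin k) : (D.split p F N).ends j.succ =
      if j ∈ F then s(none, some p) else (D.ends j).map some := rfl

theorem mult_none_map_some (s : Sym2 W) : mult (none : Option W) (s.map some) = 0 := by
  induction s using Sym2.ind with
  | _ a b => simp [mult_mk]

theorem mult_some_none {p v : W} [DecidableEq W] :
    mult (some v) s(none, some p) = if v = p then 1 else 0 := by
  simp [mult_mk, eq_comm]

/-- Splitting a vertex yields a stable shape when both parts of the vertex are stable. -/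
theorem Stable.split [Fintype W] {D : Shape n k W} (hD : D.Stable g) {p : W}
    {F : Finset (Fin k)} {N : Finset (Fin n)} (hF : ∀ j ∈ F, D.ends j = s(p, p))
    (hN : ∀ i ∈ N, D.m i = p) (h0 : 2 ≤ F.card + N.card)
    (h1 : 2 + F.card + N.card ≤ 2 * D.w p + D.val p + D.marks p) :
    (D.split p F N).Stable g := by
  classical
  refine ⟨⟨none⟩, fun q hq u v hu => ?_, ?_, fun v => ?_⟩
  · have h2 : q none ↔ q (some p) := ⟨hq 0 _ _ rfl, hq 0 _ _ Sym2.eq_swap⟩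
    have key : ∀ u v, q (some u) → q (some v) := by
      refine hD.conn (fun x => q (some x)) fun j a b hj ha => ?_
      by_cases hjF : j ∈ F
      · rw [hF j hjF, Sym2.eq_iff] at hj
        rcases hj with ⟨rfl, rfl⟩ | ⟨rfl, rfl⟩ <;> exact ha
      · refine hq j.succ _ _ ?_ ha
        rw [split_ends_succ, if_neg hjF, hj]
        rfl
    have hu' : q (some p) := by
      cases u with
      | none => exact h2.1 hu
      | some u => exact key u p hu
    cases v with
    | none => exact h2.2 hu'
    | some v => exact key p v hu'
  · rw [Fintype.card_option, Fintype.sum_option]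
    have := hD.genus
    simp only [Shape.split, Option.elim]
    omega
  · cases v with
    | none =>
      have e1 : (D.split p F N).val none = 1 + F.card := by
        unfold val
        rw [Fin.sum_univ_succ, split_ends_zero]
        congr 1
        · simp [mult_mk]
        rw [Finset.card_eq_sum_ones, ← Finset.sum_filter_add_sum_filter_not Finset.univ (· ∈ F),
          Finset.sum_eq_zero (s := Finset.univ.filter fun j => ¬ j ∈ F), add_zero]
        · rw [Finset.filter_mem_eq_inter, Finset.univ_inter]
          refine Finset.sum_congr rfl fun j hj => ?_
          rw [split_ends_succ, if_pos hj]
          simp [mult_mk]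
        · intro j hj
          rw [split_ends_succ, if_neg (by simpa using hj), mult_none_map_some]
      have e2 : N.card ≤ (D.split p F N).marks none :=
        le_marks _ _ _ fun i hi => if_pos hi
      omega
    | some v =>
      have e3 : ∀ i, (D.split p F N).m i = some v ↔ D.m i = v ∧ i ∉ N := by
        intro i
        by_cases hi : i ∈ N <;> simp [Shape.split, hi]
      have hw : (D.split p F N).w (some v) = D.w v := rfl
      by_cases hv : v = p
      · subst hv
        have e1 : (D.split v F N).val (some v) + F.card = 1 + D.val v := by
          unfold val
          rw [Fin.sum_univ_succ, split_ends_zero, mult_some_none, if_pos rfl, add_assoc]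
          congr 1
          have : F.card = ∑ j, if j ∈ F then 1 else 0 := by simp
          rw [this, ← Finset.sum_add_distrib]
          refine Finset.sum_congr rfl fun j _ => ?_
          rw [split_ends_succ]
          split_ifs with hj
          · rw [mult_some_none, if_pos rfl, hF j hj, mult_diag]
          · rw [mult_map (Option.some_injective _), add_zero]
        have e2 : (D.split v F N).marks (some v) + N.card = D.marks v := by
          rw [marks_eq, marks_eq, ← Finset.card_sdiff_add_card_eq_card (s := N)
            (t := Finset.univ.filter fun i => D.m i = v) (fun i hi => by simpa using hN i hi)]
          congr 2
          ext i
          simp [e3]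
        omega
      · have e1 : (D.split p F N).val (some v) = D.val v := by
          unfold val
          rw [Fin.sum_univ_succ, split_ends_zero, mult_some_none, if_neg hv, zero_add]
          refine Finset.sum_congr rfl fun j _ => ?_
          rw [split_ends_succ]
          split_ifs with hj
          · rw [mult_some_none, if_neg hv, hF j hj, mult_mk, if_neg (Ne.symm hv)]
          · rw [mult_map (Option.some_injective _)]
        have e2 : (D.split p F N).marks (some v) = D.marks v := by
          rw [marks_eq, marks_eq]
          congr 1
          ext i
          simp only [Finset.mem_filter, Finset.mem_univ, true_and, e3]
          exact ⟨fun h => h.1, fun h => ⟨h, fun hi => hv (h.symm.trans (hN i hi))⟩⟩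
        rw [e1, e2, hw]
        exact hD.stable v

end Shape

namespace Simplex

variable {g n k : ℕ} {W W' : Type}

open scoped Classical in
/-- Contraction of an edge joining the vertex `none` to another vertex. -/
theorem HasShape.del_none [Fintype W] {x : Simplex g n (k + 1)} {D : Shape n (k + 1) (Option W)}
    (hx : x.HasShape D) {j : Fin (k + 1)} {p : W} (hj : D.ends j = s(none, some p)) :
    (x.del j).HasShape ⟨fun i => (D.ends (j.succAbove i)).map (Option.getD · p),
      fun c => D.w (some c) + if c = p then D.w none else 0, fun i => (D.m i).getD p⟩ := by
  have h := hx.del_nonloop hj (by simp) (Option.getD · p) (fun c => ⟨some c, rfl⟩) (by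
    intro x y
    cases x <;> cases y <;> simp [eq_comm])
  have e : (fun c : W => ∑ o with Option.getD o p = c, D.w o) =
      fun c => D.w (some c) + if c = p then D.w none else 0 := by
    funext c
    rw [Finset.sum_filter, Fintype.sum_option, add_comm]
    congr 1
    · simp
    · simp only [Option.getD_none, eq_comm]
  rw [e] at h
  exact h

theorem HasShape.exists_option {x : Simplex g n k} {D : Shape n k W} (hx : x.HasShape D)
    {j : Fin k} {a b : W} (hj : D.ends j = s(a, b)) (hab : a ≠ b) :
    ∃ (p : {c // c ≠ a}) (D' : Shape n k (Option {c // c ≠ a})), x.HasShape D' ∧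
      D'.ends j = s(none, some p) := by
  classical
  refine ⟨⟨b, hab.symm⟩, _, hx.of_equiv (Equiv.optionSubtypeNe a).symm, ?_⟩
  simp only [Shape.map, hj, Sym2.map_mk, Equiv.optionSubtypeNe_symm_self]
  rw [Equiv.optionSubtypeNe_symm_of_ne hab.symm]

theorem HasShape.nonempty_fintype {x : Simplex g n k} {D : Shape n k W} (hx : x.HasShape D) :
    Nonempty (Fintype W) := by
  obtain ⟨P, -, e, -⟩ := hx
  exact ⟨Fintype.ofEquiv _ e⟩

theorem HasShape.numVertices_del_of_isDiag {x : Simplex g n (k + 1)} {D : Shape n (k + 1) W}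
    (hx : x.HasShape D) {j : Fin (k + 1)} (hj : (D.ends j).IsDiag) :
    (x.del j).numVertices = x.numVertices := by
  obtain ⟨_⟩ := hx.nonempty_fintype
  induction h : D.ends j using Sym2.ind with
  | _ a b =>
    rw [h, Sym2.mk_isDiag_iff] at hj
    subst hj
    rw [(hx.del_loop h).numVertices_eq, hx.numVertices_eq]

theorem HasShape.numVertices_del_of_not_isDiag {x : Simplex g n (k + 1)}
    {D : Shape n (k + 1) W} (hx : x.HasShape D) {j : Fin (k + 1)} (hj : ¬ (D.ends j).IsDiag) :
    (x.del j).numVertices + 1 = x.numVertices := by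
  classical
  obtain ⟨_⟩ := hx.nonempty_fintype
  induction h : D.ends j using Sym2.ind with
  | _ a b =>
    rw [h, Sym2.mk_isDiag_iff] at hj
    obtain ⟨p, D', hx', hj'⟩ := hx.exists_option h hj
    rw [(hx'.del_none hj').numVertices_eq, hx'.numVertices_eq, Fintype.card_option]

theorem HasShape.isDiag_iff {x : Simplex g n (k + 1)} {D : Shape n (k + 1) W}
    (hx : x.HasShape D) (j : Fin (k + 1)) :
    (D.ends j).IsDiag ↔ (x.del j).numVertices = x.numVertices := by
  refine ⟨hx.numVertices_del_of_isDiag, fun h => ?_⟩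
  by_contra h'
  have := hx.numVertices_del_of_not_isDiag h'
  omega

/-- If the edge `j` of `x` is not a loop, then a shape of the contraction of `j` comes from a shape
of `x` with one more vertex `none`, which is an end of `j`. -/
theorem HasShape.lift [Fintype W'] {x : Simplex g n (k + 1)} {j : Fin (k + 1)} {D' : Shape n k W'}
    (hx : (x.del j).HasShape D') (hv : (x.del j).numVertices + 1 = x.numVertices) :
    ∃ (p : W') (D : Shape n (k + 1) (Option W')), x.HasShape D ∧ D.ends j = s(none, some p) ∧
      (∀ i, (D.ends (j.succAbove i)).map (Option.getD · p) = D'.ends i) ∧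
      ∀ i, (D.m i).getD p = D'.m i := by
  classical
  obtain ⟨D₀, h₀⟩ := x.exists_shape_fin
  have hj : ¬ (D₀.ends j).IsDiag := fun h => by
    have := h₀.numVertices_del_of_isDiag h
    omega
  induction h : D₀.ends j using Sym2.ind with
  | _ a b =>
    rw [h, Sym2.mk_isDiag_iff] at hj
    obtain ⟨p, D₁, h₁, hj₁⟩ := h₀.exists_option h hj
    obtain ⟨φ, hφ, -⟩ := (h₁.del_none hj₁).exists_equiv hx
    refine ⟨φ p, _, h₁.of_equiv φ.optionCongr, ?_, fun i => ?_, fun i => ?_⟩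
    · simp [Shape.map, hj₁]
    · rw [hφ]
      simp only [Shape.map, Sym2.map_map]
      refine congrFun (congrArg Sym2.map ?_) _
      funext o
      cases o <;> simp
    · rw [hφ]
      simp only [Shape.map]
      cases D₁.m i <;> simp

/-- Splitting a vertex is inverse to the contraction of the new edge. -/
theorem HasShape.exists_split [Fintype W] {x : Simplex g n k} {D : Shape n k W}
    (hx : x.HasShape D) {p : W}
    {F : Finset (Fin k)} {N : Finset (Fin n)} (hF : ∀ j ∈ F, D.ends j = s(p, p))
    (hN : ∀ i ∈ N, D.m i = p) (h0 : 2 ≤ F.card + N.card)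
    (h1 : 2 + F.card + N.card ≤ 2 * D.w p + D.val p + D.marks p) :
    ∃ z : Simplex g n (k + 1), z.HasShape (D.split p F N) ∧ z.del 0 = x := by
  classical
  obtain ⟨z, hz⟩ := exists_hasShape (hx.stable.split hF hN h0 h1)
  refine ⟨z, hz, eq_of_hasShape (hz.del_none (D.split_ends_zero p F N)) ?_⟩
  convert hx using 1
  refine Shape.ext (funext fun j => ?_) (funext fun v => ?_) (funext fun i => ?_)
  · simp only [Fin.zero_succAbove, Shape.split_ends_succ]
    split_ifs with hj
    · rw [hF j hj]; rfl
    · rw [Sym2.map_map]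
      change Sym2.map id _ = _
      rw [Sym2.map_id]; rfl
  · simp [Shape.split]
  · by_cases hi : i ∈ N
    · simp [Shape.split, hi, hN i hi]
    · simp [Shape.split, hi]

end Simplex

/-! ### Automorphisms -/

/-- A family of bijections on the sets of simplices that commutes with all face maps. -/
structure FaceAut (g n : ℕ) where
  app {k : ℕ} : Simplex g n k ≃ Simplex g n k
  app_face {k l : ℕ} (ι : Fin k ↪ Fin l) (x : Simplex g n l) :
    app (Simplex.face ι x) = Simplex.face ι (app x)

namespace FaceAut

variable {g n k : ℕ}

/-- The inverse automorphism. -/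
def symm (Φ : FaceAut g n) : FaceAut g n where
  app := Φ.app.symm
  app_face ι x := by rw [Equiv.symm_apply_eq, Φ.app_face, Equiv.apply_symm_apply]

/-- The composition of two automorphisms. -/
def trans (Φ Ψ : FaceAut g n) : FaceAut g n where
  app := Φ.app.trans Ψ.app
  app_face ι x := by simp [Φ.app_face, Ψ.app_face]

theorem app_del (Φ : FaceAut g n) (j : Fin (k + 1)) (x : Simplex g n (k + 1)) :
    Φ.app (x.del j) = (Φ.app x).del j := Φ.app_face _ _

theorem symm_app_app (Φ : FaceAut g n) (x : Simplex g n k) : Φ.symm.app (Φ.app x) = x :=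
  Φ.app.symm_apply_apply x

theorem app_symm_app (Φ : FaceAut g n) (x : Simplex g n k) : Φ.app (Φ.symm.app x) = x :=
  Φ.app.apply_symm_apply x

end FaceAut

/-! ### Automorphisms preserve the number of vertices -/

section FinTwo

theorem fin_two_ne {a b c : Fin 2} (h : a ≠ b) (h' : c ≠ b) : a = c := by omega

theorem sym2_fin_two {s : Sym2 (Fin 2)} (h : ¬ s.IsDiag) : s = s(0, 1) := by
  revert s; decide

theorem sym2_fin_three_pair : ∀ s t : Sym2 (Fin 3), ¬ s.IsDiag → ¬ t.IsDiag → s ≠ t →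
    ∃ π : Equiv.Perm (Fin 3), s.map π = s(1, 2) ∧ t.map π = s(0, 2) := by
  decide

theorem sym2_fin_three_last : ∀ s : Sym2 (Fin 3), ¬ s.IsDiag → s ≠ s(1, 2) → s ≠ s(0, 2) →
    s = s(0, 1) := by
  decide

end FinTwo

namespace Shape

variable {g n k : ℕ}

/-- The shape with two vertices and `k` edges, none of which is a loop. -/
def banana (k : ℕ) (w : Fin 2 → ℕ) (m : Fin n → Fin 2) : Shape n k (Fin 2) where
  ends _ := s(0, 1)
  w := w
  m := m

theorem banana_val (w : Fin 2 → ℕ) (m : Fin n → Fin 2) (v : Fin 2) :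
    (banana k w m).val v = k := by
  have : mult v s((0 : Fin 2), 1) = 1 := by fin_cases v <;> simp [mult_mk]
  simp [val, banana, this]

theorem fin_two_conn {D : Shape n k (Fin 2)} {j : Fin k} (hj : D.ends j = s(0, 1))
    (p : Fin 2 → Prop) (hp : ∀ j a b, D.ends j = s(a, b) → p a → p b) (u v : Fin 2)
    (hu : p u) : p v := by
  have h1 := hp j 0 1 hj
  have h2 := hp j 1 0 (hj.trans Sym2.eq_swap)
  fin_cases u <;> fin_cases v
  · exact hu
  · exact h1 hu
  · exact h2 hu
  · exact hu

theorem Stable.exists_nonloop {D : Shape n k (Fin 2)} (hD : D.Stable g) :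
    ∃ j, D.ends j = s(0, 1) := by
  by_contra! h
  have h' : ∀ j, (D.ends j).IsDiag := fun j => by
    by_contra h'
    exact h j (sym2_fin_two h')
  have := hD.conn (· = 0) (fun j a b hj ha => by
    have := h' j
    rw [hj, Sym2.mk_isDiag_iff] at this
    rw [← this, ha]) 0 1 rfl
  exact absurd this (by decide)

theorem banana_stable {w : Fin 2 → ℕ} {m : Fin n → Fin 2} (hk : 1 ≤ k)
    (hg : k + w 0 + w 1 = g + 1) (h : ∀ v, 3 ≤ 2 * w v + k + (banana k w m).marks v) :
    (banana k w m).Stable g where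
  nonempty := ⟨0⟩
  conn := fin_two_conn (j := ⟨0, hk⟩) rfl
  genus := by simp [banana]; omega
  stable v := by
    rw [banana_val]
    exact h v

end Shape

namespace Simplex

variable {g n k : ℕ}

theorem numVertices_pos (x : Simplex g n k) : 0 < x.numVertices := by
  obtain ⟨D, hD⟩ := x.exists_shape_fin
  obtain ⟨v⟩ := hD.stable.nonempty
  exact v.pos

/-- There is at most one graph with one vertex and a given number of edges. -/
theorem eq_of_numVertices_eq_one {x y : Simplex g n k} (hx : x.numVertices = 1)
    (hy : y.numVertices = 1) : x = y := by
  obtain ⟨D, hD⟩ := x.exists_shape (W := Fin 1) (by simpa using hx)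
  obtain ⟨D', hD'⟩ := y.exists_shape (W := Fin 1) (by simpa using hy)
  have : D = D' := by
    refine Shape.ext (Subsingleton.elim _ _) (funext fun v => ?_) (Subsingleton.elim _ _)
    have h1 := hD.stable.genus
    have h2 := hD'.stable.genus
    have hv : v = 0 := Subsingleton.elim _ _
    simp only [Finset.univ_unique, Fin.default_eq_zero, Finset.sum_singleton] at h1 h2
    subst hv
    omega
  exact eq_of_hasShape hD (this ▸ hD')

theorem le_genus_of_numVertices_eq_one {x : Simplex g n k} (hx : x.numVertices = 1) : k ≤ g := by
  obtain ⟨D, hD⟩ := x.exists_shape (W := Fin 1) (by simpa using hx)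
  have h1 := hD.stable.genus
  simp only [Fintype.card_fin] at h1
  omega

theorem exists_numVertices_eq_one (hgn : 5 ≤ 2 * g + n) (hk : k ≤ g) :
    ∃ x : Simplex g n k, x.numVertices = 1 := by
  let D : Shape n k (Fin 1) := ⟨fun _ => s(0, 0), fun _ => g - k, fun _ => 0⟩
  have hD : D.Stable g :=
    { nonempty := ⟨0⟩
      conn := fun p _ u v hu => by rwa [Subsingleton.elim v u]
      genus := by simp [D]; omega
      stable := fun v => by
        have hv : v = 0 := Subsingleton.elim _ _
        subst hv
        have h1 : D.val 0 = k * 2 := by simp [Shape.val, D, mult_diag]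
        have h2 : n ≤ D.marks 0 := by
          simpa using D.le_marks 0 Finset.univ fun i _ => Subsingleton.elim _ _
        have h3 : D.w 0 = g - k := rfl
        omega }
  obtain ⟨x, hx⟩ := exists_hasShape hD
  exact ⟨x, by simpa using hx.numVertices_eq⟩

theorem numVertices_del_le (x : Simplex g n (k + 1)) (j : Fin (k + 1)) :
    (x.del j).numVertices ≤ x.numVertices ∧ x.numVertices ≤ (x.del j).numVertices + 1 := by
  obtain ⟨D, hD⟩ := x.exists_shape_fin
  by_cases h : (D.ends j).IsDiag
  · have := hD.numVertices_del_of_isDiag h; omega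
  · have := hD.numVertices_del_of_not_isDiag h; omega

/-- A graph with several vertices has an edge that is not a loop. -/
theorem exists_numVertices_del (x : Simplex g n k) (hx : x.numVertices ≠ 1) :
    ∃ (l : ℕ) (hl : k = l + 1) (j : Fin (l + 1)),
      ((hl ▸ x : Simplex g n (l + 1)).del j).numVertices + 1 = x.numVertices := by
  obtain ⟨D, hD⟩ := x.exists_shape_fin
  have hpos := x.numVertices_pos
  by_cases h : ∃ j, ¬ (D.ends j).IsDiag
  · obtain ⟨j, hj⟩ := h
    obtain ⟨l, rfl⟩ : ∃ l, k = l + 1 := ⟨k - 1, by have := j.pos; omega⟩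
    exact ⟨l, rfl, j, hD.numVertices_del_of_not_isDiag hj⟩
  · push Not at h
    have := hD.stable.conn (fun v => v.1 = 0) (fun j a b hj ha => by
      have := h j
      rw [hj, Sym2.mk_isDiag_iff] at this
      rw [← this, ha]) ⟨0, hpos⟩ ⟨1, by omega⟩ rfl
    simp at this

/-- If all faces of codimension one of `Z` coincide and have two vertices and no loops, then `Z`
has three vertices, no loops and no parallel edges. -/
theorem exists_shape_of_del_eq {y : Simplex g n (k + 1)} (hy : y.numVertices = 2)
    (hy' : ∀ j, (y.del j).numVertices = 1) {Z : Simplex g n (k + 2)} (hZ : ∀ j, Z.del j = y) :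
    ∃ D : Shape n (k + 2) (Fin 3), Z.HasShape D ∧ (∀ j, ¬ (D.ends j).IsDiag) ∧
      Function.Injective D.ends := by
  have hloop : ∀ {W : Type} {D : Shape n (k + 1) W}, y.HasShape D → ∀ j, ¬ (D.ends j).IsDiag := by
    intro W D hD j hj
    have h1 := hD.numVertices_del_of_isDiag hj
    have h2 := hy' j
    omega
  obtain ⟨D₀, h₀⟩ := Z.exists_shape_fin
  have hnd : ∀ j, ¬ (D₀.ends j).IsDiag := by
    intro j hj
    obtain ⟨i, hi⟩ := exists_ne j
    obtain ⟨i', rfl⟩ := Fin.exists_succAbove_eq hi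
    have hi' : ¬ (D₀.ends (j.succAbove i')).IsDiag := by
      induction h : D₀.ends j using Sym2.ind with
      | _ a b =>
        rw [h, Sym2.mk_isDiag_iff] at hj
        subst hj
        have := h₀.del_loop h
        rw [hZ] at this
        exact hloop this i'
    have h1 := h₀.numVertices_del_of_isDiag hj
    have h2 := h₀.numVertices_del_of_not_isDiag hi'
    rw [hZ] at h1 h2
    omega
  have h3 : Z.numVertices = 3 := by
    have := h₀.numVertices_del_of_not_isDiag (hnd 0)
    rw [hZ] at this
    omega
  obtain ⟨D, hD⟩ := Z.exists_shape (W := Fin 3) (by simpa using h3)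
  have hnd' : ∀ j, ¬ (D.ends j).IsDiag := fun j hj => by
    rw [hD.isDiag_iff, ← h₀.isDiag_iff] at hj
    exact hnd j hj
  refine ⟨D, hD, hnd', fun i j hij => ?_⟩
  by_contra hne
  obtain ⟨i', rfl⟩ := Fin.exists_succAbove_eq hne
  have hj := hnd' j
  induction h : D.ends j using Sym2.ind with
  | _ a b =>
    rw [h, Sym2.mk_isDiag_iff] at hj
    classical
    have h4 := hD.of_equiv (Equiv.optionSubtypeNe a).symm
    have h5 : (Sym2.map (Equiv.optionSubtypeNe a).symm s(a, b)) =
        s(none, some ⟨b, Ne.symm hj⟩) := by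
      rw [Sym2.map_mk, Equiv.optionSubtypeNe_symm_self,
        Equiv.optionSubtypeNe_symm_of_ne (Ne.symm hj)]
    have h6 := h4.del_none (j := j) (p := ⟨b, Ne.symm hj⟩) (by simp only [Shape.map, h, h5])
    rw [hZ] at h6
    refine hloop h6 i' ?_
    simp only [Shape.map, hij, h, h5]
    exact rfl

/-- The effect on weights and markings of contracting an edge of a graph with three vertices. -/
theorem HasShape.del_three {Z : Simplex g n (k + 1)} {D : Shape n (k + 1) (Fin 3)}
    (hZ : Z.HasShape D) {i : Fin (k + 1)} {a b c : Fin 3} (hab : a ≠ b) (hac : a ≠ c) (hbc : b ≠ c)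
    (hi : D.ends i = s(b, c)) {Y : Shape n k (Fin 2)} (hY : (Z.del i).HasShape Y) :
    ∃ f : Fin 3 → Fin 2, f b = f c ∧ f a ≠ f c ∧ Y.w (f a) = D.w a ∧
      Y.w (f c) = D.w b + D.w c ∧ ∀ t, Y.m t = f (D.m t) := by
  classical
  have hall : ∀ x, x = a ∨ x = b ∨ x = c := by omega
  have h := hZ.del_nonloop hi hbc (fun x : Fin 3 => if x = a then (0 : Fin 2) else 1)
    (by
      intro y
      fin_cases y
      · exact ⟨a, by simp⟩
      · exact ⟨b, by simp [hab.symm]⟩)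
    (by
      intro x y
      rcases hall x with rfl | rfl | rfl <;> rcases hall y with rfl | rfl | rfl <;>
        simp_all [eq_comm])
  obtain ⟨φ, hφ, hw⟩ := h.exists_equiv hY
  refine ⟨fun x => φ (if x = a then (0 : Fin 2) else 1), ?_, ?_, ?_, ?_, fun t => ?_⟩
  · simp [hab.symm, hac.symm]
  · simp [hac.symm]
  · simp only [if_true, hw]
    exact (Finset.sum_congr (s₂ := {a}) (by ext x; simp) fun _ _ => rfl).trans
      (Finset.sum_singleton _ _)
  · simp only [if_neg hac.symm, hw]
    refine (Finset.sum_congr (s₂ := {b, c}) ?_ fun _ _ => rfl).trans (Finset.sum_pair hbc)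
    ext x
    rcases hall x with rfl | rfl | rfl
    · simp [hab, hac]
    · simp [hab.symm]
    · simp [hac.symm]
  · rw [hφ]; rfl

/-- Two edges with the common vertex `c` of valence two have the same contraction only if all
markings are at `c` and the other two ends have the same weight. -/
theorem HasShape.of_del_eq_del {Z : Simplex g n (k + 1)} {D : Shape n (k + 1) (Fin 3)}
    (hZ : Z.HasShape D) {i j : Fin (k + 1)} {a b c : Fin 3} (hab : a ≠ b) (hac : a ≠ c)
    (hbc : b ≠ c) (hi : D.ends i = s(b, c)) (hj : D.ends j = s(a, c)) {Y : Shape n k (Fin 2)}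
    (hYi : (Z.del i).HasShape Y) (hYj : (Z.del j).HasShape Y) (hc : D.val c = 2) :
    ∃ p q : Fin 2, p ≠ q ∧ Y.w p = D.w a ∧ Y.w p = D.w b ∧ Y.w q = D.w a + D.w c ∧
      ∀ t, D.m t = c ∧ Y.m t = q := by
  have hall : ∀ x, x = a ∨ x = b ∨ x = c := by omega
  obtain ⟨f, f1, f2, f3, f4, f5⟩ := hZ.del_three hab hac hbc hi hYi
  obtain ⟨h, h1, h2, h3, h4, h5⟩ := hZ.del_three hab.symm hbc hac hj hYj
  by_cases hfh : f a = h b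
  · have e : h c = f c := fin_two_ne (b := f a) (by rw [hfh]; exact h2.symm) f2.symm
    have hm : ∀ t, D.m t = c := fun t => by
      have e1 := f5 t
      have e2 := h5 t
      rcases hall (D.m t) with ht | ht | ht
      · rw [ht] at e1 e2
        exact absurd (by rw [← h1, ← e2, e1, hfh] : h b = h c) h2
      · rw [ht] at e1 e2
        exact absurd (by rw [hfh, ← e2, e1, f1] : f a = f c) f2
      · exact ht
    refine ⟨f a, f c, f2, f3, by rw [hfh, h3], by rw [← e, h4], fun t => ⟨hm t, ?_⟩⟩
    rw [f5, hm]
  · exfalso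
    have e1 : h b = f c := fin_two_ne (b := f a) (Ne.symm hfh) f2.symm
    have e2 : h c = f a := fin_two_ne (b := f c) (by rw [← e1]; exact h2.symm) f2
    have hw : D.w c = 0 := by
      rw [e2, f3] at h4
      omega
    have hm : D.marks c ≤ 0 := by
      refine (D.marks_le c ∅ fun t ht => ?_).trans (by simp)
      have e3 := f5 t
      rw [h5, ht, e2] at e3
      exact absurd e3 f2
    have := hZ.stable.stable c
    omega

/-- There is at most one path with two edges that have the same contraction. -/
theorem eq_of_del_eq_two {y : Simplex g n 1} (hy : y.numVertices = 2)
    (hy' : ∀ j, (y.del j).numVertices = 1) {Z₁ Z₂ : Simplex g n 2} (h₁ : ∀ j, Z₁.del j = y)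
    (h₂ : ∀ j, Z₂.del j = y) : Z₁ = Z₂ := by
  obtain ⟨Y, hY⟩ := y.exists_shape (W := Fin 2) (by simpa using hy)
  have key : ∀ {Z : Simplex g n 2}, (∀ j, Z.del j = y) → ∃ D : Shape n 2 (Fin 3), Z.HasShape D ∧
      D.ends 0 = s(1, 2) ∧ D.ends 1 = s(0, 2) ∧
      ∃ p q : Fin 2, p ≠ q ∧ Y.w p = D.w 0 ∧ Y.w p = D.w 1 ∧ Y.w q = D.w 0 + D.w 2 ∧
        (∀ t, D.m t = 2 ∧ Y.m t = q) ∧ 3 ≤ 2 * D.w 2 + 2 + D.marks 2 := by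
    intro Z hZ
    obtain ⟨D, hD, h1, h2⟩ := exists_shape_of_del_eq hy hy' hZ
    obtain ⟨π, h3, h4⟩ := sym2_fin_three_pair _ _ (h1 0) (h1 1) (fun h => by simpa using h2 h)
    have h5 := hD.of_equiv π
    set D' := D.map π (D.w ∘ π.symm)
    have e0 : D'.ends 0 = s(1, 2) := h3
    have e1 : D'.ends 1 = s(0, 2) := h4
    have hval : D'.val 2 = 2 := by
      rw [Shape.val, Fin.sum_univ_two, e0, e1]
      simp [mult_mk]
    obtain ⟨p, q, h⟩ := h5.of_del_eq_del (a := 0) (b := 1) (c := 2) (by decide) (by decide)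
      (by decide) e0 e1 (Y := Y) (by rw [hZ]; exact hY) (by rw [hZ]; exact hY) hval
    have hst := h5.stable.stable 2
    rw [hval] at hst
    exact ⟨D', h5, e0, e1, p, q, h.1, h.2.1, h.2.2.1, h.2.2.2.1, h.2.2.2.2, hst⟩
  obtain ⟨D₁, hD₁, a0, a1, p, q, hpq, a3, a4, a5, a6, a7⟩ := key h₁
  obtain ⟨D₂, hD₂, b0, b1, p', q', hpq', b3, b4, b5, b6, b7⟩ := key h₂
  by_cases hp : p = p'
  · subst hp
    obtain rfl : q = q' := fin_two_ne hpq.symm hpq'.symm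
    have : D₁ = D₂ := by
      refine Shape.ext (funext fun j => ?_) (funext fun v => ?_) (funext fun t => ?_)
      · fin_cases j
        · exact a0.trans b0.symm
        · exact a1.trans b1.symm
      · fin_cases v
        · exact a3.symm.trans b3
        · exact a4.symm.trans b4
        · change D₁.w 2 = D₂.w 2
          omega
      · rw [(a6 t).1, (b6 t).1]
    exact eq_of_hasShape hD₁ (this ▸ hD₂)
  · exfalso
    obtain rfl : p' = q := fin_two_ne (Ne.symm hp) hpq.symm
    obtain rfl : q' = p := fin_two_ne hpq'.symm hpq
    have : D₁.marks 2 ≤ 0 := by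
      refine (D₁.marks_le 2 ∅ fun t _ => ?_).trans (by simp)
      exact absurd ((b6 t).2.symm.trans (a6 t).2) hpq
    omega

/-- A triangle all of whose edges have the same contraction has no markings, and its three vertices
have the same weight. -/
theorem triangle_of_del_eq {y : Simplex g n 2} (hy : y.numVertices = 2)
    (hy' : ∀ j, (y.del j).numVertices = 1) {Z : Simplex g n 3} (hZ : ∀ j, Z.del j = y) :
    n = 0 ∧ ∃ D : Shape n 3 (Fin 3), Z.HasShape D ∧
      D.ends 0 = s(1, 2) ∧ D.ends 1 = s(0, 2) ∧ D.ends 2 = s(0, 1) ∧ ∀ v, 3 * D.w v + 1 = g := by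
  obtain ⟨Y, hY⟩ := y.exists_shape (W := Fin 2) (by simpa using hy)
  obtain ⟨D, hD, h1, h2⟩ := exists_shape_of_del_eq hy hy' hZ
  obtain ⟨π, h3, h4⟩ := sym2_fin_three_pair _ _ (h1 0) (h1 1) (fun h => by simpa using h2 h)
  have h5 := hD.of_equiv π
  set D' := D.map π (D.w ∘ π.symm) with hD'
  have hinj : Function.Injective D'.ends := (Sym2.map.injective π.injective).comp h2
  have e0 : D'.ends 0 = s(1, 2) := h3
  have e1 : D'.ends 1 = s(0, 2) := h4
  have e2 : D'.ends 2 = s(0, 1) := by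
    refine sym2_fin_three_last _ (fun h => ?_) (fun h => ?_) (fun h => ?_)
    · rw [h5.isDiag_iff, ← hD.isDiag_iff] at h
      exact h1 2 h
    · have := hinj (h.trans e0.symm)
      exact absurd this (by decide)
    · have := hinj (h.trans e1.symm)
      exact absurd this (by decide)
  have hval : ∀ v, D'.val v = 2 := by
    intro v
    rw [Shape.val, Fin.sum_univ_three, e0, e1, e2]
    fin_cases v <;> simp [mult_mk]
  obtain ⟨p, q, -, a1, a2, -, a3⟩ := h5.of_del_eq_del (a := 0) (b := 1) (c := 2) (by decide)
    (by decide) (by decide) e0 e1 (Y := Y) (by rw [hZ]; exact hY) (by rw [hZ]; exact hY) (hval 2)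
  obtain ⟨p', q', -, b1, b2, -, b3⟩ := h5.of_del_eq_del (a := 0) (b := 2) (c := 1) (by decide)
    (by decide) (by decide) (e0.trans Sym2.eq_swap) e2 (Y := Y) (by rw [hZ]; exact hY)
    (by rw [hZ]; exact hY) (hval 1)
  refine ⟨?_, D', h5, e0, e1, e2, ?_⟩
  · by_contra hn
    have h6 := (a3 ⟨0, by omega⟩).1
    rw [(b3 ⟨0, by omega⟩).1] at h6
    exact absurd h6 (by decide)
  · have h6 := h5.stable.genus
    simp only [Fin.sum_univ_three, Fintype.card_fin] at h6
    have h7 : D'.w 0 = D'.w 1 := a1.symm.trans a2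
    have h8 : D'.w 0 = D'.w 2 := b1.symm.trans b2
    intro v
    fin_cases v <;> simp only [Fin.zero_eta, Fin.mk_one, Fin.reduceFinMk] <;> omega

end Simplex

namespace FaceAut

variable {g n k : ℕ}

open Simplex

/-- A graph with two vertices and no loops; all of its contractions have one vertex. -/
theorem exists_banana {w : Fin 2 → ℕ} {m : Fin n → Fin 2} (hk : 1 ≤ k)
    (hg : k + 1 + w 0 + w 1 = g + 1)
    (h : ∀ v, 3 ≤ 2 * w v + (k + 1) + (Shape.banana (k + 1) w m).marks v) :
    ∃ z : Simplex g n (k + 1), z.HasShape (Shape.banana (k + 1) w m) ∧ z.numVertices = 2 ∧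
      ∀ j, (z.del j).numVertices = 1 := by
  obtain ⟨z, hz⟩ := exists_hasShape (Shape.banana_stable (by omega) hg h)
  have h2 : z.numVertices = 2 := by simpa using hz.numVertices_eq
  refine ⟨z, hz, h2, fun j => ?_⟩
  have := hz.numVertices_del_of_not_isDiag (j := j)
    (show ¬ s((0 : Fin 2), 1).IsDiag by simp)
  omega

/-- The image of a graph with one vertex has one vertex, if automorphisms preserve the number of
vertices of graphs with fewer edges. Otherwise there are several graphs with one more edge all of
whose contractions have one vertex, and their images have to coincide. -/
theorem numVertices_app_eq_one (hgn : 5 ≤ 2 * g + n) (Φ : FaceAut g n)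
    (ih : ∀ x : Simplex g n k, (Φ.app x).numVertices = x.numVertices)
    (x : Simplex g n (k + 1)) (hx : x.numVertices = 1) : (Φ.app x).numVertices = 1 := by
  by_contra hne
  have hkg := le_genus_of_numVertices_eq_one hx
  have hdel : ∀ j, ((Φ.app x).del j).numVertices = 1 := by
    intro j
    rw [← Φ.app_del, ih]
    have h1 := (x.numVertices_del_le j).1
    have h2 := (x.del j).numVertices_pos
    omega
  have h2 : (Φ.app x).numVertices = 2 := by
    have h3 := ((Φ.app x).numVertices_del_le 0).2
    rw [hdel] at h3
    have h4 := (Φ.app x).numVertices_pos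
    omega
  have hZ : ∀ {z : Simplex g n (k + 2)}, (∀ j, (z.del j).numVertices = 1) →
      ∀ j, (Φ.app z).del j = Φ.app x := by
    intro z hz j
    rw [← Φ.app_del, eq_of_numVertices_eq_one (hz j) hx]
  -- Besides bananas, the graphs with one vertex have this property.
  have hrose : ∀ {z : Simplex g n (k + 2)}, z.numVertices = 1 →
      ∀ j, (z.del j).numVertices = 1 := by
    intro z hz j
    have h3 := (z.numVertices_del_le j).1
    have h4 := (z.del j).numVertices_pos
    omega
  rcases Nat.lt_or_ge 0 k with hk | hk
  · obtain ⟨z, hz, hz2, hzd⟩ := exists_banana (g := g) (k := k + 1) (w := ![g - (k + 1), 0])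
      (m := fun _ : Fin n => 0) (by omega) (by simp; omega) (fun v => by omega)
    -- The image of `z` has `k + 2` edges among three vertices, none of which are parallel.
    have hk1 : k = 1 := by
      obtain ⟨D, hD, hnd, hinj⟩ := exists_shape_of_del_eq h2 hdel (hZ hzd)
      have h5 := Fintype.card_le_of_injective
        (fun j => (⟨D.ends j, hnd j⟩ : {s : Sym2 (Fin 3) // ¬ s.IsDiag}))
        (fun i j hij => hinj (congrArg Subtype.val hij))
      rw [Sym2.card_subtype_not_diag] at h5
      simp at h5
      have : Nat.choose 3 2 = 3 := rfl
      omega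
    subst hk1
    obtain ⟨hn, D, hD, d0, d1, d2, hw⟩ := triangle_of_del_eq h2 hdel (hZ hzd)
    have h0 := hw 0
    -- Here `3 ∣ g - 1` and `2 ≤ g`, so there is also a graph with one vertex and three loops.
    obtain ⟨z', hz'⟩ := exists_numVertices_eq_one (k := 3) hgn (by omega)
    obtain ⟨-, D', hD', d0', d1', d2', hw'⟩ := triangle_of_del_eq h2 hdel (hZ (hrose hz'))
    have hDD : D = D' := by
      refine Shape.ext (funext fun j => ?_) (funext fun v => ?_) (funext fun t => ?_)
      · fin_cases j
        · exact d0.trans d0'.symm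
        · exact d1.trans d1'.symm
        · exact d2.trans d2'.symm
      · have := hw v
        have := hw' v
        omega
      · subst hn; exact t.elim0
    have := Φ.app.injective (eq_of_hasShape hD (hDD ▸ hD'))
    rw [this] at hz2
    omega
  · obtain rfl : k = 0 := by omega
    rcases Nat.lt_or_ge 1 g with hg | hg
    · obtain ⟨z, hz, hz2, hzd⟩ := exists_banana (g := g) (k := 1) (w := ![1, g - 2])
        (m := fun _ : Fin n => 1) le_rfl (by simp; omega) (fun v => by
          fin_cases v
          · simp; omega
          · have := (Shape.banana 2 ![1, g - 2] fun _ : Fin n => 1).le_marks 1 Finset.univ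
              fun _ _ => rfl
            simp at this ⊢
            omega)
      obtain ⟨z', hz'⟩ := exists_numVertices_eq_one (k := 2) hgn (by omega)
      have := Φ.app.injective (eq_of_del_eq_two h2 hdel (hZ hzd) (hZ (hrose hz')))
      rw [this] at hz2
      omega
    -- In genus one there is no graph with one vertex and two loops, but at least three markings,
    -- which can be distributed over a banana in several ways.
    · obtain rfl : g = 1 := by omega
      have ex : ∀ i : Fin n, ∃ z : Simplex 1 n 2,
          z.HasShape (Shape.banana 2 ![0, 0] fun t => if t = i then 0 else 1) ∧
            ∀ j, (z.del j).numVertices = 1 := by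
        intro i
        obtain ⟨z, hz, -, hzd⟩ := exists_banana (g := 1) (k := 1) (w := ![0, 0])
          (m := fun t : Fin n => if t = i then 0 else 1) le_rfl (by simp) (fun v => by
            have : 1 ≤ (Shape.banana 2 ![0, 0]
                fun t : Fin n => if t = i then 0 else 1).marks v := by
              fin_cases v
              · simpa using (Shape.banana 2 ![0, 0]
                  fun t : Fin n => if t = i then 0 else 1).le_marks 0 {i} (by simp [Shape.banana])
              · have : ∃ t : Fin n, t ≠ i := by
                  have : Nontrivial (Fin n) := Fin.nontrivial_iff_two_le.2 (by omega)
                  exact exists_ne i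
                obtain ⟨t, ht⟩ := this
                simpa using (Shape.banana 2 ![0, 0]
                  fun t : Fin n => if t = i then 0 else 1).le_marks 1 {t}
                    (by simp [Shape.banana, ht])
            change 3 ≤ _ + 2 + (Shape.banana 2 _ _).marks v
            omega)
        exact ⟨z, hz, hzd⟩
      obtain ⟨z, hz, hzd⟩ := ex ⟨0, by omega⟩
      obtain ⟨z', hz', hzd'⟩ := ex ⟨1, by omega⟩
      have := Φ.app.injective (eq_of_del_eq_two h2 hdel (hZ hzd) (hZ hzd'))
      subst this
      obtain ⟨φ, hφ, -⟩ := hz.exists_equiv hz'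
      have hm : ∀ t : Fin n, (if t = ⟨1, by omega⟩ then (0 : Fin 2) else 1) =
          φ (if t = ⟨0, by omega⟩ then (0 : Fin 2) else 1) :=
        fun t => congrFun (congrArg Shape.m hφ) t
      have h3 := hm ⟨1, by omega⟩
      have h4 := hm ⟨2, by omega⟩
      simp at h3 h4
      rw [← h3] at h4
      exact absurd h4 (by decide)

/-- Automorphisms preserve the number of vertices. -/
theorem numVertices_app (hgn : 5 ≤ 2 * g + n) (Φ : FaceAut g n) (x : Simplex g n k) :
    (Φ.app x).numVertices = x.numVertices := by
  induction k generalizing Φ with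
  | zero =>
    have h : ∀ y : Simplex g n 0, y.numVertices = 1 := fun y => by
      by_contra hy
      obtain ⟨l, hl, -⟩ := y.exists_numVertices_del hy
      omega
    rw [h, h]
  | succ k ih =>
    by_cases h1 : x.numVertices = 1
    · rw [h1]
      exact Φ.numVertices_app_eq_one hgn (ih Φ) x h1
    · by_cases h2 : (Φ.app x).numVertices = 1
      · have := Φ.symm.numVertices_app_eq_one hgn (ih Φ.symm) _ h2
        rw [Φ.symm_app_app] at this
        exact absurd this h1
      · refine le_antisymm ?_ ?_
        · obtain ⟨l, hl, j, hj⟩ := x.exists_numVertices_del h1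
          obtain rfl : k = l := by omega
          have h3 := ((Φ.app x).numVertices_del_le j).2
          rw [← Φ.app_del, ih] at h3
          exact h3.trans hj.le
        · obtain ⟨l, hl, j, hj⟩ := (Φ.app x).exists_numVertices_del h2
          obtain rfl : k = l := by omega
          have h3 := (x.numVertices_del_le j).2
          rw [← ih Φ, Φ.app_del] at h3
          exact h3.trans hj.le

end FaceAut

/-! ### Automorphisms preserve the positions of loops -/

theorem sym2_option_eq {W : Type} {s : Sym2 (Option W)} {p : W} (h : ¬ s.IsDiag)
    (h' : (s.map (Option.getD · p)).IsDiag) : s = s(none, some p) := by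
  induction s using Sym2.ind with
  | _ a b =>
    rw [Sym2.mk_isDiag_iff] at h
    rw [Sym2.map_mk, Sym2.mk_isDiag_iff] at h'
    cases a <;> cases b <;> simp_all

namespace Shape

variable {g n k : ℕ} {W : Type}

theorem sum_mult_le_val (D : Shape n k W) (v : W) (S : Finset (Fin k)) :
    ∑ j ∈ S, mult v (D.ends j) ≤ D.val v :=
  Finset.sum_le_sum_of_subset (Finset.subset_univ S)

/-- The shape with all weights zero. -/
def plain (E : Fin k → Sym2 W) (m : Fin n → W) : Shape n k W := ⟨E, fun _ => 0, m⟩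

end Shape

namespace FaceAut

variable {g n k : ℕ} {W W' : Type}

open Simplex

theorem isDiag_app_iff (hgn : 5 ≤ 2 * g + n) (Φ : FaceAut g n) {x : Simplex g n k}
    {D : Shape n k W} (hx : x.HasShape D) {D' : Shape n k W'} (hx' : (Φ.app x).HasShape D')
    (j : Fin k) : (D'.ends j).IsDiag ↔ (D.ends j).IsDiag := by
  cases k with
  | zero => exact j.elim0
  | succ k =>
    rw [hx.isDiag_iff, hx'.isDiag_iff, ← Φ.app_del, Φ.numVertices_app hgn, Φ.numVertices_app hgn]

/-- Two loops at the same vertex arise from three parallel edges by the contraction of one of them.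
Hence automorphisms preserve the relation of two loops being at the same vertex. -/
theorem same_loop_app (hgn : 5 ≤ 2 * g + n) (Φ : FaceAut g n) {x : Simplex g n k}
    {D : Shape n k (Fin 2)} (hx : x.HasShape D) {D' : Shape n k (Fin 2)}
    (hx' : (Φ.app x).HasShape D') {i j : Fin k} {p : Fin 2} (hij : i ≠ j)
    (hi : D.ends i = s(p, p)) (hj : D.ends j = s(p, p)) :
    ∃ q, D'.ends i = s(q, q) ∧ D'.ends j = s(q, q) := by
  have hF : ∀ t ∈ ({i, j} : Finset (Fin k)), D.ends t = s(p, p) := by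
    intro t ht
    rcases Finset.mem_insert.1 ht with rfl | ht
    · exact hi
    · rw [Finset.mem_singleton.1 ht, hj]
  have hcard : ({i, j} : Finset (Fin k)).card = 2 := Finset.card_pair hij
  have hval := D.sum_mult_le_val p {i, j}
  rw [Finset.sum_pair hij, hi, hj, mult_diag] at hval
  obtain ⟨z, hz, hzx⟩ := hx.exists_split (F := {i, j}) (N := ∅) hF (by simp) (by simp [hcard])
    (by rw [hcard, Finset.card_empty]; omega)
  have hdel : (Φ.app z).del 0 = Φ.app x := by rw [← Φ.app_del, hzx]
  obtain ⟨q, D'', hz'', h0, hends, -⟩ := HasShape.lift (x := Φ.app z) (j := 0) (D' := D')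
    (by rw [hdel]; exact hx') (by
      rw [hdel, Φ.numVertices_app hgn, Φ.numVertices_app hgn, hx.numVertices_eq,
        hz.numVertices_eq]
      simp)
  have key : ∀ t ∈ ({i, j} : Finset (Fin k)), D'.ends t = s(q, q) := by
    intro t ht
    have h1 : ¬ (D''.ends t.succ).IsDiag := by
      rw [Φ.isDiag_app_iff hgn hz hz'', Shape.split_ends_succ, if_pos ht]
      simp
    have h2 : (D'.ends t).IsDiag := by
      rw [Φ.isDiag_app_iff hgn hx hx', hF t ht]
      simp
    have h3 := hends t
    rw [Fin.zero_succAbove] at h3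
    rw [← h3] at h2 ⊢
    rw [sym2_option_eq h1 h2]
    rfl
  exact ⟨q, key i (by simp), key j (by simp)⟩

/-- The image of a graph with two vertices has the same loops and the same other edges. -/
theorem exists_shape_app (hgn : 5 ≤ 2 * g + n) (Φ : FaceAut g n) {x : Simplex g n k}
    {D : Shape n k (Fin 2)} (hx : x.HasShape D) :
    ∃ D' : Shape n k (Fin 2), (Φ.app x).HasShape D' ∧ D'.ends = D.ends := by
  obtain ⟨D₁, h₁⟩ := (Φ.app x).exists_shape (W := Fin 2) (by
    rw [Φ.numVertices_app hgn, hx.numVertices_eq])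
  have hd := fun {D₁ : Shape n k (Fin 2)} (h₁ : (Φ.app x).HasShape D₁) =>
    Φ.isDiag_app_iff hgn hx h₁
  have diag : ∀ {s : Sym2 (Fin 2)}, s.IsDiag → ∃ a, s = s(a, a) := by
    intro s hs
    induction s using Sym2.ind with
    | _ a b =>
      rw [Sym2.mk_isDiag_iff] at hs
      exact ⟨a, by rw [hs]⟩
  by_cases hl : ∃ i, (D.ends i).IsDiag
  · obtain ⟨i, hi⟩ := hl
    obtain ⟨q, hq⟩ := diag ((hd h₁ i).2 hi)
    obtain ⟨p, hp⟩ := diag hi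
    have h₂ := h₁.of_equiv (Equiv.swap q p)
    set D₂ := D₁.map (Equiv.swap q p) (D₁.w ∘ (Equiv.swap q p).symm)
    have hi₂ : D₂.ends i = s(p, p) := by
      change (D₁.ends i).map (Equiv.swap q p) = _
      rw [hq, Sym2.map_mk, Equiv.swap_apply_left]
    refine ⟨D₂, h₂, funext fun j => ?_⟩
    by_cases hj : (D.ends j).IsDiag
    · obtain ⟨p', hp'⟩ := diag hj
      by_cases hij : i = j
      · subst hij; rw [hi₂, hp]
      by_cases hpp : p' = p
      · subst hpp
        obtain ⟨q', h3, h4⟩ := Φ.same_loop_app hgn hx h₂ hij hp hp'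
        rw [h4, ← h3, hi₂, hp']
      · obtain ⟨q', hq'⟩ := diag ((hd h₂ j).2 hj)
        by_cases hqp : q' = p
        · subst hqp
          obtain ⟨r, h3, h4⟩ := Φ.symm.same_loop_app hgn h₂
            (by rw [Φ.symm_app_app]; exact hx) hij hi₂ hq'
          rw [hp, Sym2.eq_iff, or_self] at h3
          rw [hp', Sym2.eq_iff, or_self] at h4
          exact absurd (h4.1.trans h3.1.symm) hpp
        · rw [hq', hp', fin_two_ne (a := q') (b := p) (c := p') hqp hpp]
    · rw [sym2_fin_two hj, sym2_fin_two fun h => hj ((hd h₂ j).1 h)]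
  · push Not at hl
    refine ⟨D₁, h₁, funext fun j => ?_⟩
    rw [sym2_fin_two (hl j), sym2_fin_two fun h => hl j ((hd h₁ j).1 h)]

/-- The first Betti number is at most the genus; if `k + 1 = g + |W|` then they are
equal and all weights are zero. -/
theorem _root_.TropModuli.Simplex.HasShape.eq_plain [Fintype W] {x : Simplex g n k}
    {D : Shape n k W} (hx : x.HasShape D) (hk : k + 1 = g + Fintype.card W) :
    D = Shape.plain D.ends D.m :=
  Shape.ext rfl (funext (hx.stable.w_eq_zero hk)) rfl

/-- On graphs with two vertices of weight zero, automorphisms only affect the markings. -/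
theorem exists_plain_app (hgn : 5 ≤ 2 * g + n) (Φ : FaceAut g n) {x : Simplex g n (g + 1)}
    {E : Fin (g + 1) → Sym2 (Fin 2)} {m : Fin n → Fin 2} (hx : x.HasShape (Shape.plain E m)) :
    ∃ m' : Fin n → Fin 2, (Φ.app x).HasShape (Shape.plain E m') := by
  obtain ⟨D', hD', h⟩ := Φ.exists_shape_app hgn hx
  refine ⟨D'.m, ?_⟩
  have h' := hD'.eq_plain (by simp)
  rw [h] at h'
  exact h' ▸ hD'

/-- Every graph with two vertices is obtained from one with all weights zero by the contraction of
loops. Hence an automorphism that fixes the latter fixes all graphs with two vertices. -/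
theorem app_eq_self_of_two (Φ : FaceAut g n)
    (h : ∀ x : Simplex g n (g + 1), x.numVertices = 2 → Φ.app x = x) (d : ℕ) :
    ∀ {k : ℕ} (_ : g + 1 = k + d) (x : Simplex g n k), x.numVertices = 2 → Φ.app x = x := by
  classical
  induction d with
  | zero =>
    intro k hk x hx
    obtain rfl : k = g + 1 := hk.symm
    exact h x hx
  | succ d ih =>
    intro k hk x hx
    obtain ⟨D, hD⟩ := x.exists_shape (W := Fin 2) (by simpa using hx)
    have hst := hD.stable
    have hgen := hst.genus
    obtain ⟨v, hv⟩ : ∃ v, D.w v ≠ 0 := by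
      by_contra! h0
      simp only [h0, Finset.sum_const_zero, Fintype.card_fin] at hgen
      omega
    let D' : Shape n (k + 1) (Fin 2) :=
      ⟨Fin.cons s(v, v) D.ends, fun u => D.w u - if u = v then 1 else 0, D.m⟩
    have hw : ∀ u, D'.w u + (if u = v then 1 else 0) = D.w u := by
      intro u
      change D.w u - _ + _ = _
      split_ifs with hu
      · subst hu; omega
      · omega
    have hst' : D'.Stable g := by
      refine ⟨⟨v⟩, fun p hp => hst.conn p fun j a b hj => hp j.succ a b hj, ?_, fun u => ?_⟩
      · have : ∑ u, D'.w u + 1 = ∑ u, D.w u := by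
          rw [← Finset.sum_congr rfl fun u _ => hw u, Finset.sum_add_distrib]
          simp
        omega
      · have h1 : D'.val u = mult u s(v, v) + D.val u := by
          unfold Shape.val
          rw [Fin.sum_univ_succ]
          rfl
        have h2 : D'.marks u = D.marks u := rfl
        have h3 := hst.stable u
        have h4 := hw u
        rw [h1, h2]
        split_ifs at h4 with hu
        · subst hu
          rw [mult_diag]
          omega
        · omega
    obtain ⟨z, hz⟩ := exists_hasShape hst'
    have hzx : z.del 0 = x := by
      refine eq_of_hasShape (hz.del_loop (j := 0) (a := v) rfl) ?_
      convert hD using 1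
      refine Shape.ext (funext fun j => ?_) (funext fun u => ?_) rfl
      · change D'.ends (Fin.succAbove 0 j) = _
        rw [Fin.zero_succAbove]; rfl
      · refine Eq.trans ?_ (hw u)
        by_cases hu : u = v <;> simp [hu]
    rw [← hzx, Φ.app_del, ih (by omega) z (by simpa using hz.numVertices_eq)]

theorem le_of_numVertices_eq_two {x : Simplex g n k} (hx : x.numVertices = 2) : k ≤ g + 1 := by
  obtain ⟨D, hD⟩ := x.exists_shape (W := Fin 2) (by simpa using hx)
  have := hD.stable.genus
  simp only [Fintype.card_fin] at this
  omega

/-- An automorphism that fixes all graphs with two vertices of weight zero fixes all graphs with at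
most two vertices. -/
theorem app_eq_self (hgn : 5 ≤ 2 * g + n) (Φ : FaceAut g n)
    (h : ∀ (E : Fin (g + 1) → Sym2 (Fin 2)) (m : Fin n → Fin 2) (x : Simplex g n (g + 1)),
      x.HasShape (Shape.plain E m) → Φ.app x = x)
    (x : Simplex g n k) (hx : x.numVertices ≤ 2) : Φ.app x = x := by
  have hpos := x.numVertices_pos
  by_cases h1 : x.numVertices = 1
  · exact eq_of_numVertices_eq_one (by rw [Φ.numVertices_app hgn, h1]) h1
  · have h2 : x.numVertices = 2 := by omega
    refine Φ.app_eq_self_of_two (fun y hy => ?_) (g + 1 - k)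
      (by have := le_of_numVertices_eq_two h2; omega) x h2
    obtain ⟨D, hD⟩ := y.exists_shape (W := Fin 2) (by simpa using hy)
    exact h D.ends D.m y (hD.eq_plain (by simp) ▸ hD)

end FaceAut

/-! ### Pods -/

/-- The ends of the edges of a graph with two vertices in which the edges with labels in `S` join
the two vertices, and all other edges are loops at the vertex `1`. -/
def podEnds {k : ℕ} (S : Finset (Fin k)) (j : Fin k) : Sym2 (Fin 2) :=
  if j ∈ S then s(0, 1) else s(1, 1)

/-- The marking function with two values for which the markings in `C` are at `0`. -/
def podMark {n : ℕ} (C : Finset (Fin n)) (i : Fin n) : Fin 2 := if i ∈ C then 0 else 1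

/-- The map which retains the vertex `none` and merges all other vertices. -/
def podMap {W : Type} (o : Option W) : Fin 2 := o.elim 0 fun _ => 1

theorem eq_of_eq_iff_eq_zero {a b : Fin 2} (h : a = 0 ↔ b = 0) : a = b := by omega

theorem podMark_eq_zero {n : ℕ} {C : Finset (Fin n)} {i : Fin n} : podMark C i = 0 ↔ i ∈ C := by
  simp [podMark]

theorem podMap_eq_zero {W : Type} {o : Option W} : podMap o = 0 ↔ o = none := by
  cases o <;> simp [podMap]

theorem podMap_map_some {W : Type} (s : Sym2 W) : (s.map some).map podMap = s(1, 1) := by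
  induction s using Sym2.ind with
  | _ a b => rfl

namespace Shape

variable {n k : ℕ} {W : Type}

/-- A graph with two vertices of weight zero, one of which, the pod, has no loops. The pod carries
the markings in `C`, and it is joined to the other vertex by the edges in `S`. -/
def pod (S : Finset (Fin k)) (C : Finset (Fin n)) : Shape n k (Fin 2) :=
  plain (podEnds S) (podMark C)

/-- The ends of the edges of `Shape.split`. -/
def splitEnds (E : Fin k → Sym2 W) (p : W) (F : Finset (Fin k)) : Fin (k + 1) → Sym2 (Option W) :=
  Fin.cons s(none, some p) fun j => if j ∈ F then s(none, some p) else (E j).map some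

theorem split_plain (E : Fin k → Sym2 W) (m : Fin n → W) (p : W) (F : Finset (Fin k))
    (N : Finset (Fin n)) : (plain E m).split p F N =
      plain (splitEnds E p F) fun i => if i ∈ N then none else some (m i) := by
  refine Shape.ext rfl (funext fun o => ?_) rfl
  cases o <;> rfl

/-- The labels of the edges at the new vertex after splitting a vertex and contracting the old
edge `d`. -/
def podLabels (F : Finset (Fin k)) (d : Fin k) : Finset (Fin k) :=
  Finset.univ.filter fun i => d.succ.succAbove i = 0 ∨ ∃ f ∈ F, d.succ.succAbove i = f.succ

theorem card_podLabels {F : Finset (Fin k)} {d : Fin k} (hd : d ∉ F) :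
    (podLabels F d).card = F.card + 1 := by
  classical
  have h1 : (podLabels F d).map d.succ.succAboveEmb =
      insert 0 (F.map (Fin.succEmb k)) := by
    ext i
    simp only [podLabels, Finset.mem_map, Finset.mem_filter, Finset.mem_univ, true_and,
      Finset.mem_insert]
    constructor
    · rintro ⟨i, h | ⟨f, hf, h⟩, rfl⟩
      · exact Or.inl h
      · exact Or.inr ⟨f, hf, h.symm⟩
    · intro h
      have hi : i ≠ d.succ := by
        rcases h with rfl | ⟨f, hf, rfl⟩
        · exact (Fin.succ_ne_zero d).symm
        · intro h
          exact hd (Fin.succ_injective _ h ▸ hf)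
      obtain ⟨i', rfl⟩ := Fin.exists_succAbove_eq hi
      refine ⟨i', ?_, rfl⟩
      rcases h with h | ⟨f, hf, h⟩
      · exact Or.inl h
      · exact Or.inr ⟨f, hf, h.symm⟩
  rw [← Finset.card_map d.succ.succAboveEmb, h1, Finset.card_insert_of_notMem, Finset.card_map]
  simp [Fin.succ_ne_zero]

theorem splitEnds_podMap (E : Fin k → Sym2 W) (p : W) (F : Finset (Fin k)) (d i : Fin k) :
    (splitEnds E p F (d.succ.succAbove i)).map podMap = podEnds (podLabels F d) i := by
  unfold podEnds
  split_ifs with h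
  · have h' : splitEnds E p F (d.succ.succAbove i) = s(none, some p) := by
      rcases (Finset.mem_filter.1 h).2 with h | ⟨f, hf, h⟩
      · rw [h]; rfl
      · rw [h]
        exact if_pos hf
    rw [h']
    rfl
  · have h0 : d.succ.succAbove i ≠ 0 := fun h' =>
      h (Finset.mem_filter.2 ⟨Finset.mem_univ _, Or.inl h'⟩)
    obtain ⟨j, hj⟩ := Fin.exists_succ_eq.2 h0
    have hjF : j ∉ F := fun hf =>
      h (Finset.mem_filter.2 ⟨Finset.mem_univ _, Or.inr ⟨j, hf, hj.symm⟩⟩)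
    rw [← hj]
    change (if j ∈ F then s(none, some p) else (E j).map some).map podMap = _
    rw [if_neg hjF, podMap_map_some]

end Shape

namespace Simplex

variable {g n k : ℕ} {W : Type}

open Shape

/-- Contraction of an edge joining the two vertices other than `none`. -/
theorem HasShape.del_some {x : Simplex g n (k + 1)} {E : Fin (k + 1) → Sym2 (Option (Fin 2))}
    {m : Fin n → Option (Fin 2)} (hx : x.HasShape (plain E m)) {j : Fin (k + 1)} {p p' : Fin 2}
    (hp : p ≠ p') (hj : E j = s(some p, some p')) :
    (x.del j).HasShape (plain (fun i => (E (j.succAbove i)).map podMap) (podMap ∘ m)) := by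
  classical
  have hall : ∀ a : Fin 2, a = p ∨ a = p' := by omega
  have h := hx.del_nonloop (W' := Fin 2) (a := some p) (b := some p') hj (by simpa using hp) podMap
    (fun c => by
      fin_cases c
      · exact ⟨none, rfl⟩
      · exact ⟨some 0, rfl⟩)
    (by
      intro x y
      cases x with
      | none => cases y <;> simp [podMap]
      | some a =>
        cases y with
        | none => simp [podMap]
        | some b =>
          rcases hall a with rfl | rfl <;> rcases hall b with rfl | rfl <;>
            simp [podMap])
  convert h using 1
  exact Shape.ext rfl (funext fun c => by simp [plain]) rfl

/-- If the contraction of `j` is a pod with the markings `C`, then the vertex `none` carries the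
markings `C`, unless the vertex `p'` has no edge except `j`. -/
theorem HasShape.marks_of_del_some {u : Simplex g n (k + 1)}
    {E : Fin (k + 1) → Sym2 (Option (Fin 2))}
    {m : Fin n → Option (Fin 2)} (hu : u.HasShape (plain E m)) {j : Fin (k + 1)} {p p' : Fin 2}
    (hp : p ≠ p') (hj : E j = s(some p, some p')) {S : Finset (Fin k)} {C : Finset (Fin n)}
    (h : (u.del j).HasShape (pod S C)) (hS : ∀ i ∈ S, E (j.succAbove i) = s(none, some p))
    (hC : C.card ≤ 2) :
    (∀ t, m t = none ↔ t ∈ C) ∨ (C.card = 2 ∧ ∀ t ∈ C, m t = some p') := by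
  obtain ⟨φ, hφ, -⟩ := (hu.del_some hp hj).exists_equiv h
  have hm : ∀ t, podMark C t = φ (podMap (m t)) := fun t => congrFun (congrArg Shape.m hφ) t
  have hE : ∀ i, podEnds S i = ((E (j.succAbove i)).map podMap).map φ :=
    fun i => congrFun (congrArg Shape.ends hφ) i
  by_cases h0 : φ 0 = 0
  · left
    intro t
    rw [← podMark_eq_zero, hm, ← podMap_eq_zero]
    exact ⟨fun h => by rw [h, h0], fun h => φ.injective (h.trans h0.symm)⟩
  · right
    have h0' : φ 0 = 1 := by omega
    have h1 : φ 1 = 0 := by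
      have := φ.injective.ne (show (0 : Fin 2) ≠ 1 by decide)
      omega
    have hC' : ∀ t, m t = some p' → t ∈ C := by
      intro t ht
      rw [← podMark_eq_zero, hm, ht]
      exact h1
    have hval : (plain E m).val (some p') = 1 := by
      unfold Shape.val
      rw [Fin.sum_univ_succAbove _ j, Finset.sum_eq_zero, add_zero]
      · change mult _ (E j) = 1
        rw [hj]
        simp [mult_mk, hp]
      · intro i _
        change mult _ (E (j.succAbove i)) = 0
        by_cases hi : i ∈ S
        · rw [hS i hi]
          simp [mult_mk, hp]
        · have h2 := hE i
          rw [podEnds, if_neg hi] at h2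
          generalize E (j.succAbove i) = s at h2
          induction s using Sym2.ind with
          | _ a b =>
            replace h2 : 1 = φ (podMap a) ∧ 1 = φ (podMap b) := by
              rw [Sym2.map_mk, Sym2.map_mk, Sym2.eq_iff] at h2
              exact h2.elim id And.symm
            cases a with
            | some a => exact absurd (h2.1.trans h1) (by decide)
            | none =>
              cases b with
              | some b => exact absurd (h2.2.trans h1) (by decide)
              | none => simp [mult_mk]
    have hst := hu.stable.stable (some p')
    have hw : (plain E m).w (some p') = 0 := rfl
    have h3 := (plain E m).marks_le (some p') (C.filter fun t => m t = some p')
      fun t ht => Finset.mem_filter.2 ⟨hC' t ht, ht⟩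
    have h4 := Finset.card_filter_le C fun t => m t = some p'
    have h5 : (C.filter fun t => m t = some p') = C :=
      Finset.eq_of_subset_of_card_le (Finset.filter_subset _ _) (by omega)
    exact ⟨by omega, fun t ht => by
      rw [← h5] at ht
      exact (Finset.mem_filter.1 ht).2⟩


/-- Splitting a vertex and contracting an old edge that joins the two old vertices gives a pod. -/
theorem HasShape.del_splitEnds {z : Simplex g n (k + 2)} {E : Fin (k + 1) → Sym2 (Fin 2)}
    {a : Fin 2} {F : Finset (Fin (k + 1))} {μ : Fin n → Option (Fin 2)}
    (hz : z.HasShape (plain (splitEnds E a F) μ)) {d : Fin (k + 1)} (hd : E d = s(0, 1))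
    (hdF : d ∉ F) {N : Finset (Fin n)} (hN : ∀ t, μ t = none ↔ t ∈ N) :
    (z.del d.succ).HasShape (pod (podLabels F d) N) := by
  have hzd := hz.del_some (j := d.succ) (p := 0) (p' := 1) (by decide) (by
    change (if d ∈ F then s(none, some a) else (E d).map some) = _
    rw [if_neg hdF, hd]; rfl)
  convert hzd using 1
  refine Shape.ext (funext fun i => (splitEnds_podMap E a F d i).symm) rfl (funext fun t => ?_)
  refine eq_of_eq_iff_eq_zero ?_
  change podMark N t = 0 ↔ podMap (μ t) = 0
  rw [podMark_eq_zero, podMap_eq_zero, hN]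

/-- If `z` has three vertices and the contraction of its edge `0` is a graph with two vertices,
then `z` is obtained from that graph by splitting a vertex. The new vertex is chosen so that it is
not an end of the given edge `d`. -/
theorem HasShape.lift_plain {z : Simplex g n (g + 2)} (hz : z.numVertices = 3)
    {E : Fin (g + 1) → Sym2 (Fin 2)} {m' : Fin n → Fin 2}
    (hx' : (z.del 0).HasShape (plain E m')) {d : Fin (g + 1)} (hd : E d = s(0, 1)) :
    ∃ (p p' : Fin 2) (E' : Fin (g + 2) → Sym2 (Option (Fin 2))) (μ : Fin n → Option (Fin 2)),
      p ≠ p' ∧ z.HasShape (plain E' μ) ∧ E' 0 = s(none, some p) ∧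
      E' d.succ = s(some p, some p') ∧ (∀ i, (E' i.succ).map (Option.getD · p) = E i) ∧
      ∀ t, (μ t).getD p = m' t := by
  classical
  obtain ⟨p, D, hD, h0, hE, hm⟩ := hx'.lift (by
    rw [hx'.numVertices_eq, hz]
    simp)
  simp only [Fin.zero_succAbove] at hE
  have hD' := hD.eq_plain (by simp)
  rw [hD'] at hD
  obtain ⟨p', hp⟩ := exists_ne p
  have hE' : s((0 : Fin 2), 1) = s(p, p') := by
    rw [Sym2.eq_iff]; omega
  replace hE : ∀ i, (D.ends i.succ).map (Option.getD · p) = E i := hE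
  replace hm : ∀ t, (D.m t).getD p = m' t := hm
  have h1 := hE d
  rw [hd, hE'] at h1
  -- `d` joins `p'` to one of the two ends of `0`, and these can be interchanged.
  have h2 : D.ends d.succ = s(some p, some p') ∨ D.ends d.succ = s(none, some p') := by
    change Sym2.map (Option.getD · p) (D.ends d.succ) = _ at h1
    generalize D.ends d.succ = s at h1
    induction s using Sym2.ind with
    | _ a b =>
      rw [Sym2.map_mk, Sym2.eq_iff] at h1
      rcases h1 with ⟨ha, hb⟩ | ⟨ha, hb⟩
      · cases b with
        | none => exact absurd hb hp.symm
        | some b =>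
          obtain rfl : b = p' := hb
          cases a with
          | none => exact Or.inr rfl
          | some a => exact Or.inl (by rw [show a = p from ha])
      · cases a with
        | none => exact absurd ha hp.symm
        | some a =>
          obtain rfl : a = p' := ha
          cases b with
          | none => exact Or.inr Sym2.eq_swap
          | some b => exact Or.inl (by rw [show b = p from hb, Sym2.eq_swap])
  rcases h2 with h2 | h2
  · exact ⟨p, p', D.ends, D.m, hp.symm, hD, h0, h2, hE, hm⟩
  · have h3 := hD.of_equiv (Equiv.swap none (some p))
    have hg : (fun o : Option (Fin 2) => (Equiv.swap none (some p) o).getD p) =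
        fun o => o.getD p := by
      funext o
      by_cases ho : o = none
      · rw [ho, Equiv.swap_apply_left]; rfl
      · by_cases ho' : o = some p
        · rw [ho', Equiv.swap_apply_right]; rfl
        · rw [Equiv.swap_apply_of_ne_of_ne ho ho']
    refine ⟨p, p', _, _, hp.symm, h3, ?_, ?_, fun i => ?_, fun t => ?_⟩
    · change (D.ends 0).map _ = _
      rw [h0, Sym2.map_mk, Equiv.swap_apply_left, Equiv.swap_apply_right, Sym2.eq_swap]
    · change (D.ends d.succ).map _ = _
      rw [h2, Sym2.map_mk, Equiv.swap_apply_left,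
        Equiv.swap_apply_of_ne_of_ne (by simp) (by simpa using hp)]
    · change ((D.ends i.succ).map _).map _ = _
      rw [Sym2.map_map, ← hE]
      exact congrFun (congrArg Sym2.map hg) _
    · change (Equiv.swap none (some p) (D.m t)).getD p = _
      rw [← hm]
      exact congrFun hg _

end Simplex

namespace FaceAut

variable {g n k : ℕ}

open Simplex Shape

/-- The markings of the image of a graph `x` can be controlled by splitting off a part `N` of the
markings at a vertex `a` together with a set `F` of loops, when `Φ` fixes the corresponding pods.
The second alternative occurs when the two old vertices, rather than the new one, make up the pod
in the image. -/
theorem marks_app_of_split (hgn : 5 ≤ 2 * g + n) (Φ : FaceAut g n) {x : Simplex g n (g + 1)}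
    {E : Fin (g + 1) → Sym2 (Fin 2)} {m m' : Fin n → Fin 2} (hx : x.HasShape (plain E m))
    (hx' : (Φ.app x).HasShape (plain E m')) {a : Fin 2} {F : Finset (Fin (g + 1))}
    {N : Finset (Fin n)} (hF : ∀ f ∈ F, E f = s(a, a)) (hN : ∀ t ∈ N, m t = a)
    (h0 : 2 ≤ F.card + N.card)
    (h1 : 2 + F.card + N.card ≤ (plain E m).val a + (plain E m).marks a) (hN2 : N.card ≤ 2)
    (hfix : ∀ (S : Finset (Fin (g + 1))) (w : Simplex g n (g + 1)), S.card = F.card + 1 →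
      w.HasShape (pod S N) → Φ.app w = w) :
    ∃ p p' : Fin 2, p ≠ p' ∧ (∀ f ∈ F, E f = s(p, p)) ∧
      ((∀ t ∈ N, m' t = p) ∨ (N.card = 2 ∧ ∀ t ∈ N, m' t = p')) := by
  obtain ⟨d, hd⟩ := hx.stable.exists_nonloop
  change E d = _ at hd
  have hdF : d ∉ F := fun h => by
    have := hF d h
    rw [hd, Sym2.eq_iff] at this
    omega
  obtain ⟨z, hz, rfl⟩ := hx.exists_split (p := a) hF hN h0 (by change _ ≤ 2 * 0 + _ + _; omega)
  rw [split_plain] at hz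
  obtain ⟨b, hab⟩ := exists_ne a
  have hz3 : z.numVertices = 3 := by simpa using hz.numVertices_eq
  have hpod : (z.del d.succ).HasShape (pod (podLabels F d) N) :=
    hz.del_splitEnds hd hdF fun t => by simp
  have hfz := hfix _ _ (card_podLabels hdF) hpod
  obtain ⟨p, p', E', μ, hp, hD, e0, ed, hE, hμ⟩ := HasShape.lift_plain
    ((Φ.numVertices_app hgn z).trans hz3) (by rw [← Φ.app_del]; exact hx') hd
  have hEF : ∀ f ∈ F, E' f.succ = s(none, some p) := by
    intro f hf
    refine sym2_option_eq ?_ ?_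
    · intro h
      have := (Φ.isDiag_app_iff hgn hz hD f.succ).1 h
      change (if f ∈ F then s(none, some a) else (E f).map some).IsDiag at this
      rw [if_pos hf] at this
      simp at this
    · rw [hE, hF f hf]
      simp
  refine ⟨p, p', hp, fun f hf => ?_, ?_⟩
  · rw [← hE, hEF f hf]
    rfl
  · rcases hD.marks_of_del_some hp ed (S := podLabels F d) (C := N)
      (by rw [← Φ.app_del, hfz]; exact hpod) (fun i hi => by
        rcases (Finset.mem_filter.1 hi).2 with h | ⟨f, hf, h⟩
        · rw [h, e0]
        · rw [h, hEF f hf]) hN2 with h | h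
    · refine Or.inl fun t ht => ?_
      rw [← hμ, (h t).2 ht]
      rfl
    · refine Or.inr ⟨h.1, fun t ht => ?_⟩
      rw [← hμ, h.2 t ht]
      rfl

end FaceAut

/-! ### Automorphisms that fix pods -/

namespace Simplex

variable {g n k : ℕ}

open Shape

theorem val_pod_zero (S : Finset (Fin k)) (C : Finset (Fin n)) : (pod S C).val 0 = S.card := by
  have : ∀ j, mult 0 ((pod S C).ends j) = if j ∈ S then 1 else 0 := by
    intro j
    change mult 0 (podEnds S j) = _
    unfold podEnds
    split_ifs <;> simp [mult_mk]
  unfold Shape.val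
  simp [this]

theorem val_pod_one (S : Finset (Fin k)) (C : Finset (Fin n)) :
    (pod S C).val 1 + S.card = 2 * k := by
  have : ∀ j, mult 1 ((pod S C).ends j) + (if j ∈ S then 1 else 0) = 2 := by
    intro j
    change mult 1 (podEnds S j) + _ = _
    unfold podEnds
    split_ifs <;> simp [mult_mk]
  have h := Finset.sum_congr rfl fun j (_ : j ∈ Finset.univ) => this j
  rw [Finset.sum_add_distrib] at h
  unfold Shape.val
  simpa [mul_comm] using h

theorem marks_pod_zero (S : Finset (Fin k)) (C : Finset (Fin n)) : (pod S C).marks 0 = C.card := by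
  classical
  rw [marks_eq]
  congr 1
  ext i
  simp [pod, plain, podMark_eq_zero]

theorem marks_pod_one (S : Finset (Fin k)) (C : Finset (Fin n)) :
    (pod S C).marks 1 + C.card = n := by
  classical
  rw [marks_eq]
  have : (Finset.univ.filter fun i => (pod S C).m i = 1) = Cᶜ := by
    ext i
    simp [pod, plain, podMark]
  rw [this, Finset.card_compl_add_card, Fintype.card_fin]

/-- Pods with three edges and markings in total are stable. -/
theorem exists_pod (hgn : 5 ≤ 2 * g + n) {S : Finset (Fin (g + 1))} {C : Finset (Fin n)}
    (hS : S.Nonempty) (h : S.card + C.card = 3) :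
    ∃ x : Simplex g n (g + 1), x.HasShape (pod S C) := by
  obtain ⟨j, hj⟩ := hS
  refine exists_hasShape ⟨⟨0⟩, fin_two_conn (j := j) (if_pos hj), by simp [pod, plain], fun v => ?_⟩
  have h0 := val_pod_zero S C
  have h1 := val_pod_one S C
  have h2 := marks_pod_zero S C
  have h3 := marks_pod_one S C
  fin_cases v
  · change 3 ≤ 2 * 0 + (pod S C).val 0 + (pod S C).marks 0
    omega
  · change 3 ≤ 2 * 0 + (pod S C).val 1 + (pod S C).marks 1
    omega

/-- The markings on the pod are determined by the isomorphism class of the graph. The two vertices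
can only be interchanged when `2 * g + n = 4`. -/
theorem pod_injective (hgn : 5 ≤ 2 * g + n) {S : Finset (Fin (g + 1))} {C C' : Finset (Fin n)}
    (h : S.card + C.card = 3) (hC : C.card = C'.card) {x : Simplex g n (g + 1)}
    (hx : x.HasShape (pod S C)) (hx' : x.HasShape (pod S C')) : C = C' := by
  obtain ⟨φ, hφ, -⟩ := hx.exists_equiv hx'
  have hm : ∀ t, podMark C' t = φ (podMark C t) := fun t => congrFun (congrArg Shape.m hφ) t
  have hE : ∀ i, podEnds S i = (podEnds S i).map φ := fun i => congrFun (congrArg Shape.ends hφ) i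
  have hinj := φ.injective.ne (show (0 : Fin 2) ≠ 1 by decide)
  by_cases h0 : φ 0 = 0
  · ext t
    rw [← podMark_eq_zero, ← podMark_eq_zero, hm]
    exact ⟨fun h => by rw [h, h0], fun h => φ.injective (h.trans h0.symm)⟩
  · have h1 : φ 1 = 0 := by omega
    have hS : S = Finset.univ := by
      refine Finset.eq_univ_of_forall fun i => ?_
      by_contra hi
      have := hE i
      rw [podEnds, if_neg hi, Sym2.map_mk, h1, Sym2.eq_iff] at this
      omega
    have hCC : C' = Cᶜ := by
      ext t
      rw [Finset.mem_compl, ← podMark_eq_zero, ← podMark_eq_zero, hm]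
      constructor
      · intro h h'
        exact h0 (by rw [h'] at h; exact h)
      · intro h
        rw [show podMark C t = 1 by omega, h1]
    have h2 := Finset.card_compl_add_card C
    rw [← hCC, Fintype.card_fin] at h2
    rw [hS, Finset.card_univ, Fintype.card_fin] at h
    omega

end Simplex

namespace FaceAut

variable {g n k : ℕ}

open Simplex Shape

/-- The automorphism given by a permutation of the markings. -/
def relabel (g : ℕ) (σ : Equiv.Perm (Fin n)) : FaceAut g n where
  app :=
    { toFun := Simplex.relabel σ
      invFun := Simplex.relabel σ⁻¹
      left_inv := fun x => by
        obtain ⟨P, rfl⟩ := mk_surjective x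
        refine congrArg Simplex.mk ((P.relabel_relabel σ σ⁻¹).trans ?_)
        rw [inv_mul_cancel, P.relabel_one]
      right_inv := fun x => by
        obtain ⟨P, rfl⟩ := mk_surjective x
        refine congrArg Simplex.mk ((P.relabel_relabel σ⁻¹ σ).trans ?_)
        rw [mul_inv_cancel, P.relabel_one] }
  app_face ι x := by
    obtain ⟨P, rfl⟩ := mk_surjective x
    exact mk_eq_iff.2 (P.face_relabel σ ι)

theorem _root_.TropModuli.Simplex.HasShape.relabel_pod {x : Simplex g n k} {S : Finset (Fin k)}
    {C : Finset (Fin n)} (hx : x.HasShape (pod S C)) (σ : Equiv.Perm (Fin n)) :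
    (x.relabel σ).HasShape (pod S (C.map σ.toEmbedding)) := by
  convert hx.relabel σ using 1
  refine Shape.ext rfl rfl (funext fun t => eq_of_eq_iff_eq_zero ?_)
  change podMark _ t = 0 ↔ podMark C (σ⁻¹ t) = 0
  rw [podMark_eq_zero, podMark_eq_zero, Finset.mem_map_equiv]
  rfl

/-- The action of `Φ` on the markings of pods does not depend on the labels of the edges, since `Φ`
commutes with the faces along permutations. -/
theorem pod_app_of_card_eq (Φ : FaceAut g n) {S S' : Finset (Fin k)} (hS : S'.card = S.card)
    {C C' : Finset (Fin n)} {x x' : Simplex g n k} (hx : x.HasShape (pod S C))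
    (hΦ : (Φ.app x).HasShape (pod S C')) (hx' : x'.HasShape (pod S' C)) :
    (Φ.app x').HasShape (pod S' C') := by
  classical
  let π : Equiv.Perm (Fin k) := (Finset.equivOfCardEq hS).extendSubtype
  have hπ : ∀ i, π i ∈ S ↔ i ∈ S' := by
    intro i
    by_cases hi : i ∈ S'
    · exact iff_of_true (Equiv.extendSubtype_mem (Finset.equivOfCardEq hS) i hi) hi
    · exact iff_of_false (Equiv.extendSubtype_not_mem (Finset.equivOfCardEq hS) i hi) hi
  have key : ∀ (y : Simplex g n k) (B : Finset (Fin n)), y.HasShape (pod S B) →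
      (face π.toEmbedding y).HasShape (pod S' B) := by
    intro y B hy
    convert hy.permute π using 1
    refine Shape.ext (funext fun i => ?_) rfl rfl
    change podEnds S' i = podEnds S (π i)
    exact (if_congr (hπ i) rfl rfl).symm
  rw [eq_of_hasShape hx' (key x C hx), Φ.app_face]
  exact key _ _ hΦ

/-- An automorphism and its inverse fix the same simplices. -/
theorem symm_app_eq {Φ : FaceAut g n} {x : Simplex g n k} (h : Φ.app x = x) : Φ.symm.app x = x := by
  conv_lhs => rw [← h]
  exact Φ.symm_app_app x

/-- If `Φ` fixes the pods with two edges and one marking, then it fixes all graphs with two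
vertices of weight zero that have a loop. -/
theorem app_eq_of_loop (hgn : 5 ≤ 2 * g + n) (Φ : FaceAut g n)
    (hfix : ∀ (S : Finset (Fin (g + 1))) (t : Fin n) (w : Simplex g n (g + 1)), S.card = 2 →
      w.HasShape (pod S {t}) → Φ.app w = w)
    {x : Simplex g n (g + 1)} {E : Fin (g + 1) → Sym2 (Fin 2)} {m : Fin n → Fin 2}
    (hx : x.HasShape (plain E m)) {f : Fin (g + 1)} (hf : (E f).IsDiag) : Φ.app x = x := by
  obtain ⟨a, ha⟩ : ∃ a, E f = s(a, a) := by
    generalize E f = e at hf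
    induction e using Sym2.ind with
    | _ a b =>
      rw [Sym2.mk_isDiag_iff] at hf
      exact ⟨a, by rw [hf]⟩
  have key : ∀ (Φ : FaceAut g n) (_ : ∀ (S : Finset (Fin (g + 1))) (t : Fin n)
      (w : Simplex g n (g + 1)), S.card = 2 → w.HasShape (pod S {t}) → Φ.app w = w)
      (x : Simplex g n (g + 1)) (m m' : Fin n → Fin 2), x.HasShape (plain E m) →
      (Φ.app x).HasShape (plain E m') → ∀ t, m t = a → m' t = a := by
    intro Φ hfix x m m' hx hx' t ht
    obtain ⟨d, hd⟩ := hx.stable.exists_nonloop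
    have hdf : d ≠ f := by
      rintro rfl
      have : s(a, a) = s((0 : Fin 2), 1) := ha.symm.trans hd
      rw [Sym2.eq_iff] at this
      omega
    have h1 : 3 ≤ (plain E m).val a := by
      have := (plain E m).sum_mult_le_val a {f, d}
      rw [Finset.sum_pair hdf.symm] at this
      have h2 : mult a ((plain E m).ends f) = 2 := by
        change mult a (E f) = 2
        rw [ha, mult_mk]; simp
      have h3 : 1 ≤ mult a ((plain E m).ends d) := one_le_mult (by
        rw [hd, Sym2.mem_iff]; omega)
      omega
    have h2 : 1 ≤ (plain E m).marks a := by
      simpa using (plain E m).le_marks a {t} fun i hi => by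
        rw [Finset.mem_singleton.1 hi]; exact ht
    obtain ⟨p, p', -, hp, h⟩ := Φ.marks_app_of_split hgn hx hx' (a := a) (F := {f}) (N := {t})
      (by simpa using ha) (by simpa using ht) (by simp) (by simp; omega) (by simp)
      (fun S w hS => hfix S t w (by simpa using hS))
    have hp' := hp f (by simp)
    rw [ha, Sym2.eq_iff] at hp'
    rcases h with h | h
    · rw [h t (by simp)]
      omega
    · simp at h
  obtain ⟨m', hx'⟩ := Φ.exists_plain_app hgn hx
  have h1 := key Φ hfix x m m' hx hx'
  have h2 := key Φ.symm (fun S t w hS hw => symm_app_eq (hfix S t w hS hw)) _ m' m hx'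
    (by rw [symm_app_app]; exact hx)
  obtain rfl : m' = m := by
    funext t
    have h3 := h1 t
    have h4 := h2 t
    omega
  exact eq_of_hasShape hx' hx

/-- If `Φ` fixes the pods with one edge and two markings, then it fixes all graphs with two
vertices of weight zero that have no loops. -/
theorem app_eq_of_no_loop (hgn : 5 ≤ 2 * g + n) (Φ : FaceAut g n)
    (hfix : ∀ (S : Finset (Fin (g + 1))) (C : Finset (Fin n)) (w : Simplex g n (g + 1)),
      S.card = 1 → C.card = 2 → w.HasShape (pod S C) → Φ.app w = w)
    {x : Simplex g n (g + 1)} {E : Fin (g + 1) → Sym2 (Fin 2)} {m : Fin n → Fin 2}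
    (hx : x.HasShape (plain E m)) (hE : ∀ j, ¬ (E j).IsDiag) : Φ.app x = x := by
  replace hE : ∀ j, E j = s(0, 1) := fun j => sym2_fin_two (hE j)
  have hEφ : ∀ (φ : Equiv.Perm (Fin 2)) j, E j = (E j).map φ := by
    intro φ j
    rw [hE, Sym2.map_mk]
    refine (sym2_fin_two ?_).symm
    rw [Sym2.mk_isDiag_iff]
    exact φ.injective.ne (by decide)
  -- Two markings at a common vertex stay together; applied to `Φ` and to its inverse, this shows
  -- that `Φ` preserves the partition of the markings.
  have key : ∀ (Φ : FaceAut g n) (_ : ∀ (S : Finset (Fin (g + 1))) (C : Finset (Fin n))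
      (w : Simplex g n (g + 1)), S.card = 1 → C.card = 2 → w.HasShape (pod S C) → Φ.app w = w)
      (x : Simplex g n (g + 1)) (m m' : Fin n → Fin 2), x.HasShape (plain E m) →
      (Φ.app x).HasShape (plain E m') → ∀ s t, m s = m t → m' s = m' t := by
    intro Φ hfix x m m' hx hx' s t hst
    by_cases hne : s = t
    · rw [hne]
    have hcard : ({s, t} : Finset (Fin n)).card = 2 := Finset.card_pair hne
    have hN : ∀ i ∈ ({s, t} : Finset (Fin n)), m i = m t := by
      simpa using hst
    have h1 : (plain E m).val (m t) = g + 1 := by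
      unfold Shape.val
      have : ∀ j, mult (m t) ((plain E m).ends j) = 1 := by
        intro j
        change mult (m t) (E j) = 1
        rw [hE, mult_mk]
        generalize m t = b
        fin_cases b <;> simp
      simp [this]
    have h2 := (plain E m).le_marks (m t) {s, t} hN
    by_cases h3 : 4 ≤ (plain E m).val (m t) + (plain E m).marks (m t)
    · obtain ⟨p, p', -, -, h⟩ := Φ.marks_app_of_split hgn hx hx' (a := m t) (F := ∅)
        (N := {s, t}) (by simp) hN (by simp [hcard]) (by simp [hcard]; omega) (by simp [hcard])
        (fun S w hS => hfix S _ w (by simpa using hS) hcard)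
      rcases h with h | ⟨-, h⟩ <;> rw [h s (by simp), h t (by simp)]
    · -- The vertex `m t` has just one edge and the markings `s` and `t`, so `x` itself is a pod.
      obtain rfl : g = 0 := by omega
      have hx2 := hx.of_equiv (Equiv.swap (m t) 0)
      have hpod : x.HasShape (pod Finset.univ {s, t}) := by
        convert hx2 using 1
        refine Shape.ext (funext fun j => ?_) rfl (funext fun i => eq_of_eq_iff_eq_zero ?_)
        · change podEnds _ j = (E j).map _
          rw [← hEφ, hE]
          exact if_pos (Finset.mem_univ j)
        · change podMark _ i = 0 ↔ Equiv.swap (m t) 0 (m i) = 0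
          rw [podMark_eq_zero]
          constructor
          · intro hi
            rw [hN i hi, Equiv.swap_apply_left]
          · intro hi
            have hi' : m i = m t := by
              rw [← (Equiv.swap (m t) 0).injective.eq_iff, hi, Equiv.swap_apply_left]
            by_contra hi2
            have := (plain E m).le_marks (m t) (insert i {s, t}) (by
              intro j hj
              rcases Finset.mem_insert.1 hj with rfl | hj
              · exact hi'
              · exact hN j hj)
            rw [Finset.card_insert_of_notMem hi2, hcard] at this
            omega
      rw [hfix _ _ _ (by simp) hcard hpod] at hx'
      obtain ⟨φ, hφ, -⟩ := hx.exists_equiv hx'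
      have hm : ∀ t, m' t = φ (m t) := fun t => congrFun (congrArg Shape.m hφ) t
      rw [hm, hm, hst]
  obtain ⟨m', hx'⟩ := Φ.exists_plain_app hgn hx
  have h1 := key Φ hfix x m m' hx hx'
  have h2 := key Φ.symm (fun S C w hS hC hw => symm_app_eq (hfix S C w hS hC hw)) _ m' m hx'
    (by rw [symm_app_app]; exact hx)
  obtain ⟨φ, hφ⟩ : ∃ φ : Equiv.Perm (Fin 2), ∀ t, m' t = φ (m t) := by
    rcases isEmpty_or_nonempty (Fin n) with h | ⟨⟨t₀⟩⟩
    · exact ⟨1, h.elim⟩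
    · refine ⟨Equiv.swap (m t₀) (m' t₀), fun t => ?_⟩
      by_cases ht : m t = m t₀
      · rw [ht, Equiv.swap_apply_left, h1 t t₀ ht]
      · refine fin_two_ne (b := m' t₀) (fun h => ht (h2 t t₀ h)) fun h => ht ?_
        exact (Equiv.swap (m t₀) (m' t₀)).injective (h.trans (Equiv.swap_apply_left _ _).symm)
  refine eq_of_hasShape hx' ?_
  convert hx.of_equiv φ using 1
  exact Shape.ext (funext (hEφ φ)) rfl (funext hφ)

end FaceAut

/-! ### The permutation of the markings in positive genus -/

/-- The ends of the edges of a graph with two vertices that has a loop at `0`, with label `0`, one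
edge that joins the two vertices, with the last label, and loops at `1`. -/
def lollipopEnds (g : ℕ) (j : Fin (g + 1)) : Sym2 (Fin 2) :=
  if j = 0 then s(0, 0) else if j = Fin.last g then s(0, 1) else s(1, 1)

theorem lollipopEnds_zero (g : ℕ) : lollipopEnds g 0 = s(0, 0) := if_pos rfl

theorem lollipopEnds_last {g : ℕ} (hg : 1 ≤ g) : lollipopEnds g (Fin.last g) = s(0, 1) := by
  rw [lollipopEnds, if_neg fun h => by rw [Fin.ext_iff] at h; simp at h; omega, if_pos rfl]

namespace Shape

variable {g n k : ℕ}

theorem val_lollipop_zero (hg : 1 ≤ g) (m : Fin n → Fin 2) :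
    3 ≤ (plain (lollipopEnds g) m).val 0 := by
  have h := (plain (lollipopEnds g) m).sum_mult_le_val 0 {0, Fin.last g}
  have h0 : (0 : Fin (g + 1)) ≠ Fin.last g := fun h => by rw [Fin.ext_iff] at h; simp at h; omega
  rw [Finset.sum_pair h0] at h
  change mult 0 (lollipopEnds g 0) + mult 0 (lollipopEnds g (Fin.last g)) ≤ _ at h
  rw [lollipopEnds_zero, lollipopEnds_last hg] at h
  simpa [mult_mk] using h

theorem val_lollipop_one (hg : 1 ≤ g) (m : Fin n → Fin 2) :
    (plain (lollipopEnds g) m).val 1 + 1 = 2 * g := by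
  obtain ⟨g, rfl⟩ : ∃ g', g = g' + 1 := ⟨g - 1, by omega⟩
  have h : ∀ i : Fin g, mult (1 : Fin 2) (lollipopEnds (g + 1) i.castSucc.succ) = 2 := by
    intro i
    rw [lollipopEnds, if_neg (Fin.succ_ne_zero _), if_neg, mult_mk]
    · simp
    · intro h
      have := congrArg Fin.val h
      simp at this
      omega
  unfold Shape.val
  rw [Fin.sum_univ_succ, Fin.sum_univ_castSucc]
  change mult 1 (lollipopEnds (g + 1) 0) + (∑ i : Fin g, mult (1 : Fin 2)
    (lollipopEnds (g + 1) i.castSucc.succ) +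
      mult 1 (lollipopEnds (g + 1) (Fin.last (g + 1)))) + 1 = _
  rw [Finset.sum_congr rfl fun i _ => h i, lollipopEnds_zero, lollipopEnds_last hg]
  simp [mult_mk]
  omega

end Shape

namespace FaceAut

variable {g n k : ℕ}

open Simplex Shape

/-- The image of a graph with three vertices that arises from splitting off the loop of a
lollipop. The new vertex of the image carries a marking, since its valence is two. -/
theorem exists_splitEnds_app (hgn : 5 ≤ 2 * g + n) (hg : 1 ≤ g) (Φ : FaceAut g n)
    {z : Simplex g n (g + 2)} {μ : Fin n → Option (Fin 2)}
    (hz : z.HasShape (plain (splitEnds (lollipopEnds g) 0 {0}) μ)) {m' : Fin n → Fin 2}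
    (hx' : (Φ.app (z.del 0)).HasShape (plain (lollipopEnds g) m')) :
    ∃ μ' : Fin n → Option (Fin 2),
      (Φ.app z).HasShape (plain (splitEnds (lollipopEnds g) 0 {0}) μ') ∧
      (∀ t, (μ' t).getD 0 = m' t) ∧ ∃ t, μ' t = none := by
  obtain ⟨p, p', E', μ', hp, hD, e0, ed, hE, hμ⟩ := HasShape.lift_plain
    ((Φ.numVertices_app hgn z).trans (by simpa using hz.numVertices_eq))
    (by rw [← Φ.app_del]; exact hx') (d := Fin.last g) (lollipopEnds_last hg)
  have h0 : E' (Fin.succ 0) = s(none, some p) := by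
    refine sym2_option_eq ?_ ?_
    · intro h
      have := (Φ.isDiag_app_iff hgn hz hD (Fin.succ 0)).1 h
      change (if (0 : Fin (g + 1)) ∈ ({0} : Finset _) then s(none, some (0 : Fin 2))
        else (lollipopEnds g 0).map some).IsDiag at this
      rw [if_pos (by simp)] at this
      simp at this
    · rw [hE, lollipopEnds_zero]
      simp
  have hp0 : p = 0 := by
    have := hE 0
    rw [h0, lollipopEnds_zero, Sym2.map_mk, Sym2.eq_iff] at this
    simpa using this
  subst hp0
  obtain rfl : p' = 1 := by omega
  have hE' : E' = splitEnds (lollipopEnds g) 0 {0} := by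
    funext i
    refine Fin.cases e0 (fun j => ?_) i
    change _ = if j ∈ ({0} : Finset _) then s(none, some 0) else (lollipopEnds g j).map some
    by_cases hj : j = 0
    · rw [hj, if_pos (by simp), h0]
    · rw [if_neg (by simpa using hj)]
      by_cases hj' : j = Fin.last g
      · rw [hj', ed, lollipopEnds_last hg]
        rfl
      · have h1 : lollipopEnds g j = s(1, 1) := by rw [lollipopEnds, if_neg hj, if_neg hj']
        have h2 := hE j
        rw [h1] at h2 ⊢
        generalize E' j.succ = e at h2
        induction e using Sym2.ind with
        | _ a b =>
          rw [Sym2.map_mk, Sym2.eq_iff, or_self] at h2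
          have h3 : ∀ o : Option (Fin 2), o.getD 0 = 1 → o = some 1 := by
            rintro (_ | o) ho
            · exact absurd ho (by decide)
            · exact congrArg some ho
          rw [h3 a h2.1, h3 b h2.2]
          rfl
  subst hE'
  refine ⟨μ', hD, hμ, ?_⟩
  by_contra! h
  have hval : (plain (splitEnds (lollipopEnds g) 0 {0}) μ').val none ≤ 2 := by
    unfold Shape.val
    rw [Fin.sum_univ_succ, Fin.sum_univ_succ, Finset.sum_eq_zero]
    · change mult none s(none, some (0 : Fin 2)) + (mult none (splitEnds (lollipopEnds g) 0 {0}
        (Fin.succ 0)) + 0) ≤ 2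
      rw [h0]
      simp [mult_mk]
    · intro i _
      change mult none (if i.succ ∈ ({0} : Finset _) then s(none, some (0 : Fin 2))
        else (lollipopEnds g i.succ).map some) = 0
      rw [if_neg (by simp [Fin.succ_ne_zero]), mult_none_map_some]
  have h1 := (plain (splitEnds (lollipopEnds g) 0 {0}) μ').marks_le none ∅
    fun t ht => absurd ht (h t)
  have h2 := hD.stable.stable none
  change 3 ≤ 2 * 0 + _ + _ at h2
  rw [Finset.card_empty] at h1
  omega

/-- The image of a pod with two edges and one marking is a pod with one marking. -/
theorem exists_pod_app (hgn : 5 ≤ 2 * g + n) (hg : 1 ≤ g) (Φ : FaceAut g n) (x : Fin n) :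
    ∃ y : Fin n, ∀ (S : Finset (Fin (g + 1))) (w : Simplex g n (g + 1)), S.card = 2 →
      w.HasShape (pod S {x}) → (Φ.app w).HasShape (pod S {y}) := by
  classical
  have hlast : Fin.last g ∉ ({0} : Finset (Fin (g + 1))) := fun h => by
    rw [Finset.mem_singleton, Fin.ext_iff] at h
    simp at h
    omega
  obtain ⟨X, hX⟩ := exists_hasShape (g := g) (D := plain (lollipopEnds g) (podMark {x}))
    ⟨⟨0⟩, fin_two_conn (lollipopEnds_last hg), by simp [plain], fun v => by
      change 3 ≤ 2 * 0 + _ + _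
      fin_cases v
      · have := val_lollipop_zero hg (podMark {x})
        exact le_trans this (by simp)
      · have h1 := val_lollipop_one hg (podMark {x})
        have h2 := marks_pod_one (∅ : Finset (Fin (g + 1))) ({x} : Finset (Fin n))
        change (plain (lollipopEnds g) (podMark {x})).marks 1 + _ = n at h2
        simp only [Finset.card_singleton] at h2
        change 3 ≤ 2 * 0 + (plain (lollipopEnds g) (podMark {x})).val 1
          + (plain (lollipopEnds g) (podMark {x})).marks 1
        omega⟩
  have hsplit : ∀ (y : Fin n) (Y : Simplex g n (g + 1)) (m : Fin n → Fin 2),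
      Y.HasShape (plain (lollipopEnds g) m) → m y = 0 → ∃ z : Simplex g n (g + 2),
        z.HasShape (plain (splitEnds (lollipopEnds g) 0 {0})
          fun t => if t ∈ ({y} : Finset _) then none else some (m t)) ∧ z.del 0 = Y := by
    intro y Y m hY hy
    have h1 := val_lollipop_zero hg m
    have h2 := (plain (lollipopEnds g) m).le_marks 0 {y} (by simpa [plain] using hy)
    simp only [Finset.card_singleton] at h2
    obtain ⟨z, hz, hzY⟩ := hY.exists_split (p := 0) (F := {0}) (N := {y})
      (by simpa [plain] using lollipopEnds_zero g) (by simpa [plain] using hy) (by simp)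
      (by simp [plain]; change _ ≤ (plain (lollipopEnds g) m).val 0
            + (plain (lollipopEnds g) m).marks 0; omega)
    rw [split_plain] at hz
    exact ⟨z, hz, hzY⟩
  obtain ⟨z, hz, hzX⟩ := hsplit x X _ hX (by simp [podMark])
  obtain ⟨m', hX'⟩ := Φ.exists_plain_app hgn hX
  obtain ⟨μ, -, hμ, y, hy⟩ := Φ.exists_splitEnds_app hgn hg hz (by rw [hzX]; exact hX')
  obtain ⟨z', hz', hzX'⟩ := hsplit y _ m' hX' (by rw [← hμ, hy]; rfl)
  -- The preimage of `z'` contracts to `X`, so its new vertex carries `x` and no other marking.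
  obtain ⟨μ', hΦz', hμ', t, ht⟩ := Φ.symm.exists_splitEnds_app hgn hg hz'
    (m' := podMark {x}) (by rw [hzX', symm_app_app]; exact hX)
  have key : ∀ s, μ' s = none → s = x := by
    intro s hs
    have h := hμ' s
    rw [hs] at h
    simpa using podMark_eq_zero.1 h.symm
  have hpod := hΦz'.del_splitEnds (lollipopEnds_last hg) hlast (N := {x}) fun s => by
    rw [Finset.mem_singleton]
    refine ⟨key s, ?_⟩
    rintro rfl
    rw [← key t ht, ht]
  have hpod' := hz'.del_splitEnds (lollipopEnds_last hg) hlast (N := {y}) fun s => by simp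
  refine ⟨y, fun S w hS hw => Φ.pod_app_of_card_eq ?_ hpod ?_ hw⟩
  · rw [card_podLabels hlast, hS, Finset.card_singleton]
  · rw [Φ.app_del, app_symm_app]
    exact hpod'

/-- Given a permutation `σ` with which `Φ` acts on pods, the composition of `Φ` with the inverse of
`σ` fixes these pods. -/
theorem trans_relabel_pod (Φ : FaceAut g n) (σ : Equiv.Perm (Fin n)) {S : Finset (Fin k)}
    {C : Finset (Fin n)} {w : Simplex g n k} (hw : w.HasShape (pod S C))
    (h : (Φ.app w).HasShape (pod S (C.map σ.toEmbedding))) :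
    (Φ.trans (relabel g σ⁻¹)).app w = w := by
  refine eq_of_hasShape (h.relabel_pod σ⁻¹) ?_
  convert hw using 2
  rw [Finset.map_map]
  ext t
  simp

theorem eq_relabel_of_trans {Φ : FaceAut g n} {σ : Equiv.Perm (Fin n)} {x : Simplex g n k}
    (h : (Φ.trans (relabel g σ⁻¹)).app x = x) : Φ.app x = x.relabel σ := by
  have h1 : (relabel g σ).app ((Φ.trans (relabel g σ⁻¹)).app x) = Φ.app x :=
    (relabel g σ).app.apply_symm_apply _
  rw [← h1, h]
  rfl

/-- In positive genus, automorphisms act on graphs with at most two vertices by permutations of the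
markings. -/
theorem exists_relabel_of_one_le (hgn : 5 ≤ 2 * g + n) (hg : 1 ≤ g) (Φ : FaceAut g n) :
    ∃ σ : Equiv.Perm (Fin n), ∀ {k : ℕ} (x : Simplex g n k), x.numVertices ≤ 2 →
      Φ.app x = x.relabel σ := by
  classical
  choose σ hσ using Φ.exists_pod_app hgn hg
  obtain ⟨S, hS⟩ : ∃ S : Finset (Fin (g + 1)), S.card = 2 := by
    obtain ⟨S, -, hS⟩ := Finset.exists_subset_card_eq (s := (Finset.univ : Finset (Fin (g + 1))))
      (n := 2) (by simp; omega)
    exact ⟨S, hS⟩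
  have hSne : S.Nonempty := Finset.card_pos.1 (by omega)
  have hinj : Function.Injective σ := by
    intro x x' h
    obtain ⟨w, hw⟩ := exists_pod hgn (C := {x}) hSne (by simp [hS])
    obtain ⟨w', hw'⟩ := exists_pod hgn (C := {x'}) hSne (by simp [hS])
    have h1 := hσ x S w hS hw
    rw [h] at h1
    obtain rfl := Φ.app.injective (eq_of_hasShape h1 (hσ x' S w' hS hw'))
    exact Finset.singleton_injective (pod_injective hgn (by simp [hS]) (by simp) hw hw')
  obtain ⟨σ, rfl⟩ : ∃ σ' : Equiv.Perm (Fin n), ⇑σ' = σ :=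
    ⟨Equiv.ofBijective σ (Finite.injective_iff_bijective.1 hinj), rfl⟩
  refine ⟨σ, fun x hx => eq_relabel_of_trans (app_eq_self hgn _ (fun E m x hx => ?_) x hx)⟩
  have hloop : ∀ {E : Fin (g + 1) → Sym2 (Fin 2)} {m : Fin n → Fin 2} {x : Simplex g n (g + 1)},
      x.HasShape (plain E m) → ∀ {f}, (E f).IsDiag → (Φ.trans (relabel g σ⁻¹)).app x = x :=
    fun hx => app_eq_of_loop hgn _ (fun S t w hS hw => Φ.trans_relabel_pod σ hw (by
      rw [Finset.map_singleton]
      exact hσ t S w hS hw)) hx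
  -- As `g ≥ 1`, the pods with one edge have loops.
  by_cases hE : ∃ f, (E f).IsDiag
  · obtain ⟨f, hf⟩ := hE
    exact hloop hx hf
  · push Not at hE
    refine app_eq_of_no_loop hgn _ (fun S C w hS _ hw => ?_) hx hE
    obtain ⟨f, hf⟩ : ∃ f, f ∉ S := by
      by_contra! h
      rw [Finset.eq_univ_of_forall h, Finset.card_univ, Fintype.card_fin] at hS
      omega
    exact hloop hw (f := f) (by rw [podEnds, if_neg hf]; simp)

end FaceAut

/-! ### Permutations of pairs -/

theorem eq_pair_of_card_eq_two {α : Type} [DecidableEq α] {S : Finset α} (hS : S.card = 2) {x y : α}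
    (hx : x ∈ S) (hy : y ∈ S) (hxy : x ≠ y) : S = {x, y} := by
  refine (Finset.eq_of_subset_of_card_le (fun z hz => ?_) (by rw [hS, Finset.card_pair hxy])).symm
  rcases Finset.mem_insert.1 hz with rfl | hz
  · exact hx
  · rwa [Finset.mem_singleton.1 hz]

/-- A pair that meets the three sides of a triangle is one of them; so if three of at least four
different pairs that meet each other have no common element, there is no fourth one. -/
theorem mem_of_not_disjoint_pairs {α : Type} [DecidableEq α] {A B C D : Finset α}
    (hA : A.card = 2) (hB : B.card = 2) (hC : C.card = 2) (hD : D.card = 2) (hAB : A ≠ B)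
    (hAD : A ≠ D) (hBD : B ≠ D) (hCD : C ≠ D) (hAC' : ¬ Disjoint A C) (hBC' : ¬ Disjoint B C)
    (hAD' : ¬ Disjoint A D) (hBD' : ¬ Disjoint B D) (hCD' : ¬ Disjoint C D) {p : α}
    (hpA : p ∈ A) (hpB : p ∈ B) : p ∈ C := by
  by_contra hpC
  obtain ⟨q, hqA, hqC⟩ := Finset.not_disjoint_iff.1 hAC'
  obtain ⟨r, hrB, hrC⟩ := Finset.not_disjoint_iff.1 hBC'
  have hpq : p ≠ q := fun h => hpC (h ▸ hqC)
  have hpr : p ≠ r := fun h => hpC (h ▸ hrC)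
  have eA := eq_pair_of_card_eq_two hA hpA hqA hpq
  have eB := eq_pair_of_card_eq_two hB hpB hrB hpr
  have hqr : q ≠ r := fun h => hAB (by rw [eA, eB, h])
  have eC := eq_pair_of_card_eq_two hC hqC hrC hqr
  by_cases hpD : p ∈ D
  · obtain ⟨c, hc, hcD⟩ := Finset.not_disjoint_iff.1 hCD'
    rw [eC, Finset.mem_insert, Finset.mem_singleton] at hc
    rcases hc with rfl | rfl
    · exact hAD (by rw [eA, eq_pair_of_card_eq_two hD hpD hcD hpq])
    · exact hBD (by rw [eB, eq_pair_of_card_eq_two hD hpD hcD hpr])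
  · have hmem : ∀ {S : Finset α} {x : α}, S = {p, x} → ¬ Disjoint S D → x ∈ D := by
      intro S x hS h
      obtain ⟨c, hc, hcD⟩ := Finset.not_disjoint_iff.1 h
      rw [hS, Finset.mem_insert, Finset.mem_singleton] at hc
      rcases hc with rfl | rfl
      · exact absurd hcD hpD
      · exact hcD
    exact hCD (by rw [eC, eq_pair_of_card_eq_two hD (hmem eA hAD') (hmem eB hBD') hqr])

/-- A permutation of the pairs of elements of a set with at least five elements that respects
disjointness comes from a permutation of the set. -/
theorem exists_perm_of_pairs {α : Type} [Fintype α] [DecidableEq α] (hα : 5 ≤ Fintype.card α)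
    (F : Finset α → Finset α) (hF : ∀ C, C.card = 2 → (F C).card = 2)
    (hinj : ∀ C D, C.card = 2 → D.card = 2 → F C = F D → C = D)
    (hdisj : ∀ C D, C.card = 2 → D.card = 2 → (Disjoint (F C) (F D) ↔ Disjoint C D)) :
    ∃ σ : Equiv.Perm α, ∀ C, C.card = 2 → F C = C.map σ.toEmbedding := by
  have hfresh : ∀ S : Finset α, S.card ≤ 4 → ∃ a, a ∉ S := by
    intro S hS
    by_contra! h
    rw [Finset.eq_univ_of_forall h, Finset.card_univ] at hS
    omega
  have hstar : ∀ x, ∃ y, ∀ a, x ≠ a → y ∈ F {x, a} := by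
    intro x
    have hne : ∀ {a b}, x ≠ a → x ≠ b → a ≠ b → F {x, a} ≠ F {x, b} := by
      intro a b ha hb hab h
      have h1 := hinj _ _ (Finset.card_pair ha) (Finset.card_pair hb) h
      have h2 : a ∈ ({x, b} : Finset α) := h1 ▸ by simp
      simp only [Finset.mem_insert, Finset.mem_singleton] at h2
      exact h2.elim (fun h => ha h.symm) hab
    have hnd : ∀ {a b}, x ≠ a → x ≠ b → ¬ Disjoint (F {x, a}) (F {x, b}) := by
      intro a b ha hb
      rw [hdisj _ _ (Finset.card_pair ha) (Finset.card_pair hb), Finset.not_disjoint_iff]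
      exact ⟨x, by simp, by simp⟩
    obtain ⟨a, ha⟩ := hfresh {x} (by simp)
    obtain ⟨b, hb⟩ := hfresh {x, a} (Finset.card_le_two.trans (by omega))
    simp only [Finset.mem_insert, Finset.mem_singleton, not_or] at ha hb
    obtain ⟨p, hpa, hpb⟩ := Finset.not_disjoint_iff.1 (hnd (Ne.symm ha) (Ne.symm hb.1))
    refine ⟨p, fun c hc => ?_⟩
    by_cases hca : c = a
    · rwa [hca]
    by_cases hcb : c = b
    · rwa [hcb]
    obtain ⟨d, hd⟩ := hfresh {x, a, b, c} Finset.card_le_four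
    simp only [Finset.mem_insert, Finset.mem_singleton, not_or] at hd
    obtain ⟨hdx, hda, hdb, hdc⟩ := hd
    have hxa := Ne.symm ha
    have hxb := Ne.symm hb.1
    have hxd := Ne.symm hdx
    exact mem_of_not_disjoint_pairs (hF _ (Finset.card_pair hxa)) (hF _ (Finset.card_pair hxb))
      (hF _ (Finset.card_pair hc)) (hF _ (Finset.card_pair hxd)) (hne hxa hxb (Ne.symm hb.2))
      (hne hxa hxd (Ne.symm hda)) (hne hxb hxd (Ne.symm hdb)) (hne hc hxd (Ne.symm hdc))
      (hnd hxa hc) (hnd hxb hc) (hnd hxa hxd) (hnd hxb hxd) (hnd hc hxd) hpa hpb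
  choose σ hσ using hstar
  have hσinj : Function.Injective σ := by
    intro x z h
    by_contra hxz
    obtain ⟨a, ha⟩ := hfresh {x, z} (Finset.card_le_two.trans (by omega))
    obtain ⟨b, hb⟩ := hfresh {x, z, a} (Finset.card_le_three.trans (by omega))
    simp only [Finset.mem_insert, Finset.mem_singleton, not_or] at ha hb
    have h1 := hσ x a (Ne.symm ha.1)
    have h2 := hσ z b (Ne.symm hb.2.1)
    rw [← h] at h2
    refine Finset.not_disjoint_iff.2 ⟨_, h1, h2⟩ ((hdisj _ _ (Finset.card_pair (Ne.symm ha.1))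
      (Finset.card_pair (Ne.symm hb.2.1))).2 ?_)
    rw [Finset.disjoint_left]
    intro t ht ht'
    simp only [Finset.mem_insert, Finset.mem_singleton] at ht ht'
    rcases ht with rfl | rfl <;> rcases ht' with h' | h'
    · exact hxz h'
    · exact hb.1 h'.symm
    · exact ha.2 h'
    · exact hb.2.2 h'.symm
  refine ⟨Equiv.ofBijective σ (Finite.injective_iff_bijective.1 hσinj), fun C hC => ?_⟩
  obtain ⟨x, y, hxy, rfl⟩ := Finset.card_eq_two.1 hC
  rw [Finset.map_insert, Finset.map_singleton]
  refine eq_pair_of_card_eq_two (hF _ hC) (hσ x y hxy) ?_ (hσinj.ne hxy)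
  rw [Finset.pair_comm]
  exact hσ y x hxy.symm

/-! ### Trees with one edge -/

/-- Two subsets of the markings are crossing when they and their complements have nonempty
intersections. -/
def Crossing {n : ℕ} (C D : Finset (Fin n)) : Prop :=
  (∃ t, t ∈ C ∧ t ∈ D) ∧ (∃ t, t ∈ C ∧ t ∉ D) ∧ (∃ t, t ∉ C ∧ t ∈ D) ∧ ∃ t, t ∉ C ∧ t ∉ D

theorem crossing_comm {n : ℕ} {C D : Finset (Fin n)} : Crossing C D ↔ Crossing D C := by
  simp only [Crossing, and_comm (a := _ ∈ C), and_comm (a := _ ∉ C)]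
  tauto

theorem crossing_compl_left {n : ℕ} {C D : Finset (Fin n)} : Crossing Cᶜ D ↔ Crossing C D := by
  simp only [Crossing, Finset.mem_compl, not_not]
  tauto

namespace Simplex

variable {g n k : ℕ}

open Shape

/-- The genus zero graph `x` has one edge, which separates the markings in `C` from the other
ones. -/
def HasSplit (x : Simplex 0 n 1) (C : Finset (Fin n)) : Prop := x.HasShape (pod Finset.univ C)

theorem podEnds_univ (j : Fin k) : podEnds Finset.univ j = s(0, 1) := if_pos (Finset.mem_univ j)

theorem HasSplit.compl {x : Simplex 0 n 1} {C : Finset (Fin n)} (h : x.HasSplit C) :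
    x.HasSplit Cᶜ := by
  unfold HasSplit
  convert h.of_equiv (Equiv.swap 0 1) using 1
  refine Shape.ext (funext fun j => ?_) rfl (funext fun t => eq_of_eq_iff_eq_zero ?_)
  · change podEnds _ j = (podEnds _ j).map _
    rw [podEnds_univ, Sym2.map_mk, Equiv.swap_apply_left, Equiv.swap_apply_right, Sym2.eq_swap]
  · change podMark _ t = 0 ↔ Equiv.swap 0 1 (podMark C t) = 0
    rw [podMark_eq_zero, Finset.mem_compl, ← podMark_eq_zero,
      ← Equiv.eq_symm_apply, Equiv.symm_swap, Equiv.swap_apply_left]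
    omega

theorem hasSplit_compl {x : Simplex 0 n 1} {C : Finset (Fin n)} :
    x.HasSplit Cᶜ ↔ x.HasSplit C :=
  ⟨fun h => by simpa using h.compl, HasSplit.compl⟩

theorem HasSplit.two_le {x : Simplex 0 n 1} {C : Finset (Fin n)} (h : x.HasSplit C) :
    2 ≤ C.card := by
  have h1 := h.stable.stable 0
  rw [val_pod_zero, marks_pod_zero] at h1
  change 3 ≤ 2 * 0 + _ + _ at h1
  simp only [Finset.card_univ, Fintype.card_fin] at h1
  omega

theorem exists_hasSplit_of_two_le {C : Finset (Fin n)} (h : 2 ≤ C.card) (h' : 2 ≤ Cᶜ.card) :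
    ∃ x : Simplex 0 n 1, x.HasSplit C := by
  refine exists_hasShape ⟨⟨0⟩, fin_two_conn (j := 0) (podEnds_univ (0 : Fin 1)),
    by simp [pod, plain], fun v => ?_⟩
  have h0 := val_pod_zero (Finset.univ : Finset (Fin 1)) C
  have h1 := val_pod_one (Finset.univ : Finset (Fin 1)) C
  have h2 := marks_pod_zero (Finset.univ : Finset (Fin 1)) C
  have h3 := marks_pod_one (Finset.univ : Finset (Fin 1)) C
  have h4 := Finset.card_compl_add_card C
  simp only [Finset.card_univ, Fintype.card_fin] at h0 h1 h4
  fin_cases v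
  · change 3 ≤ 2 * 0 + (pod Finset.univ C).val 0 + (pod Finset.univ C).marks 0
    omega
  · change 3 ≤ 2 * 0 + (pod Finset.univ C).val 1 + (pod Finset.univ C).marks 1
    omega

theorem HasShape.hasSplit {x : Simplex 0 n 1} {E : Fin 1 → Sym2 (Fin 2)} {m : Fin n → Fin 2}
    (h : x.HasShape (plain E m)) {C : Finset (Fin n)} (hC : ∀ t, t ∈ C ↔ m t = 0) :
    x.HasSplit C := by
  obtain ⟨j, hj⟩ := h.stable.exists_nonloop
  unfold HasSplit
  convert h using 1
  refine Shape.ext (funext fun i => ?_) rfl (funext fun t => eq_of_eq_iff_eq_zero ?_)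
  · change podEnds _ i = E i
    rw [podEnds_univ, Subsingleton.elim i j]
    exact hj.symm
  · exact podMark_eq_zero.trans (hC t)

/-- In genus zero, every graph with one edge is a tree with two vertices. -/
theorem exists_hasSplit (x : Simplex 0 n 1) : ∃ C, x.HasSplit C := by
  have h0 : (x.del 0).numVertices = 1 := by
    by_contra h
    obtain ⟨l, hl, -⟩ := (x.del 0).exists_numVertices_del h
    omega
  have h1 := (x.numVertices_del_le 0).2
  obtain ⟨D₀, hD₀⟩ := x.exists_shape_fin
  have h2 := hD₀.stable.genus
  rw [Fintype.card_fin] at h2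
  obtain ⟨D, hD⟩ := x.exists_shape (W := Fin 2) (by simp; omega)
  rw [hD.eq_plain (by simp)] at hD
  exact ⟨Finset.univ.filter fun t => D.m t = 0, hD.hasSplit fun t => by simp⟩

theorem HasSplit.eq_or_eq_compl {x : Simplex 0 n 1} {C D : Finset (Fin n)} (hC : x.HasSplit C)
    (hD : x.HasSplit D) : D = C ∨ D = Cᶜ := by
  obtain ⟨φ, hφ, -⟩ := HasShape.exists_equiv hC hD
  have hm : ∀ t, podMark D t = φ (podMark C t) := fun t => congrFun (congrArg Shape.m hφ) t
  have hinj := φ.injective.ne (show (0 : Fin 2) ≠ 1 by decide)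
  by_cases h0 : φ 0 = 0
  · left
    ext t
    rw [← podMark_eq_zero, ← podMark_eq_zero, hm]
    exact ⟨fun h => φ.injective (h.trans h0.symm), fun h => by rw [h, h0]⟩
  · right
    have h1 : φ 1 = 0 := by omega
    ext t
    rw [Finset.mem_compl, ← podMark_eq_zero, ← podMark_eq_zero, hm]
    constructor
    · intro h h'
      rw [h'] at h
      exact h0 h
    · intro h
      rw [show podMark C t = 1 by omega, h1]

/-- Two trees with one edge are compatible when they coincide or are the two contractions of a tree
with two edges. -/
def Compat (x y : Simplex 0 n 1) : Prop :=
  x = y ∨ ∃ z : Simplex 0 n 2, z.del 0 = x ∧ z.del 1 = y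

theorem HasSplit.eq_of_eq {x y : Simplex 0 n 1} {C : Finset (Fin n)} (hx : x.HasSplit C)
    (hy : y.HasSplit C) : x = y := eq_of_hasShape hx hy

theorem compat_of_disjoint {x y : Simplex 0 n 1} {C D : Finset (Fin n)} (hx : x.HasSplit C)
    (hy : y.HasSplit D) (h : Disjoint C D) : Compat x y := by
  classical
  by_cases hCD : D = Cᶜ
  · subst hCD
    exact Or.inl (hx.eq_of_eq (hasSplit_compl.1 hy))
  · right
    have hlt : D.card < Cᶜ.card := Finset.card_lt_card (Finset.ssubset_iff_subset_ne.2
      ⟨fun t ht => Finset.mem_compl.2 (Finset.disjoint_right.1 h ht), hCD⟩)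
    have hval := val_pod_one (Finset.univ : Finset (Fin 1)) C
    have hmarks := marks_pod_one (Finset.univ : Finset (Fin 1)) C
    have hcompl := Finset.card_compl_add_card C
    simp only [Finset.card_univ, Fintype.card_fin] at hval hcompl
    have hD2 := hy.two_le
    obtain ⟨z, hz, hzx⟩ := HasShape.exists_split (p := 1) (F := ∅) (N := D) hx (by simp)
      (fun t ht => if_neg (Finset.disjoint_right.1 h ht)) (by simpa using hD2)
      (by
        change 2 + 0 + _ ≤ 2 * 0 + _ + _
        omega)
    refine ⟨z, hzx, ?_⟩
    rw [pod, split_plain] at hz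
    refine HasSplit.eq_of_eq (C := D) ?_ hy
    have := hz.del_splitEnds (d := 0) (podEnds_univ 0) (by simp) (N := D) fun t => by simp
    have hlabels : podLabels (∅ : Finset (Fin 1)) 0 = Finset.univ :=
      Finset.eq_univ_of_card _ (by rw [card_podLabels (by simp)]; simp)
    rw [hlabels] at this
    exact this

theorem not_crossing_of_compat {x y : Simplex 0 n 1} {C D : Finset (Fin n)} (hx : x.HasSplit C)
    (hy : y.HasSplit D) (h : Compat x y) : ¬ Crossing C D := by
  rcases h with rfl | ⟨z, rfl, rfl⟩
  · rcases hx.eq_or_eq_compl hy with rfl | rfl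
    · rintro ⟨-, ⟨t, ht, ht'⟩, -⟩
      exact ht' ht
    · rintro ⟨⟨t, ht, ht'⟩, -⟩
      exact Finset.mem_compl.1 ht' ht
  · have hz3 : z.numVertices = 3 := by
      obtain ⟨D₀, hD₀⟩ := z.exists_shape_fin
      have h1 := hD₀.stable.genus
      rw [Fintype.card_fin] at h1
      have h2 := (z.numVertices_del_le 0).2
      have h3 : (z.del 0).numVertices = 2 := by simpa using HasShape.numVertices_eq hx
      omega
    obtain ⟨p, p', E', μ, hp, hD, -, ed, -, hμ⟩ := HasShape.lift_plain (g := 0) hz3 hx (d := 0)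
      (podEnds_univ 0)
    have hy' : (z.del 1).HasSplit (Finset.univ.filter fun t => μ t = none) := by
      refine (hD.del_some hp ed).hasSplit fun t => ?_
      simp [podMap_eq_zero]
    have hQ : ∀ t, μ t = none → podMark C t = p := by
      intro t ht
      rw [← show _ = podMark C t from hμ t, ht]
      rfl
    intro hCD
    obtain ⟨⟨s, hs, hs'⟩, -, ⟨t, ht, ht'⟩, -⟩ :
        Crossing C (Finset.univ.filter fun t => μ t = none) := by
      rcases hy'.eq_or_eq_compl hy with rfl | rfl
      · exact hCD
      · rwa [crossing_comm, crossing_compl_left, crossing_comm] at hCD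
    have h1 := hQ s (Finset.mem_filter.1 hs').2
    have h2 := hQ t (Finset.mem_filter.1 ht').2
    rw [← h2, podMark_eq_zero.2 hs] at h1
    exact ht (podMark_eq_zero.1 h1.symm)

/-- The trees with two edges determine which partitions of the markings cross. -/
theorem compat_iff {x y : Simplex 0 n 1} {C D : Finset (Fin n)} (hx : x.HasSplit C)
    (hy : y.HasSplit D) : Compat x y ↔ ¬ Crossing C D := by
  refine ⟨not_crossing_of_compat hx hy, fun h => ?_⟩
  by_cases h1 : ∃ t, t ∈ C ∧ t ∈ D
  · by_cases h2 : ∃ t, t ∈ C ∧ t ∉ D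
    · by_cases h3 : ∃ t, t ∉ C ∧ t ∈ D
      · refine compat_of_disjoint hx.compl hy.compl (Finset.disjoint_left.2 fun t ht ht' => ?_)
        rw [Finset.mem_compl] at ht ht'
        exact h ⟨h1, h2, h3, t, ht, ht'⟩
      · refine compat_of_disjoint hx.compl hy (Finset.disjoint_left.2 fun t ht ht' => ?_)
        exact h3 ⟨t, Finset.mem_compl.1 ht, ht'⟩
    · refine compat_of_disjoint hx hy.compl (Finset.disjoint_left.2 fun t ht ht' => ?_)
      exact h2 ⟨t, ht, Finset.mem_compl.1 ht'⟩
  · exact compat_of_disjoint hx hy (Finset.disjoint_left.2 fun t ht ht' => h1 ⟨t, ht, ht'⟩)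

/-- There are two trees with one edge, compatible with `x` and different from it, such that every
tree with one edge that is compatible with `x` is compatible with one of them. This singles out the
trees with at least three markings at both vertices. -/
def IsDominated (x : Simplex 0 n 1) : Prop :=
  ∃ u v, u ≠ x ∧ v ≠ x ∧ Compat x u ∧ Compat x v ∧ ∀ w, Compat x w → Compat w u ∨ Compat w v

/-- If both sides of `x` have three markings, then `x` is dominated by a pair of markings
from either side. -/
theorem HasSplit.isDominated {x : Simplex 0 n 1} {C : Finset (Fin n)} (hx : x.HasSplit C)
    (h : 3 ≤ C.card) (h' : 3 ≤ Cᶜ.card) : x.IsDominated := by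
  have key : ∀ C : Finset (Fin n), x.HasSplit C → 3 ≤ C.card → 3 ≤ Cᶜ.card →
      ∃ U u, U ⊆ C ∧ HasSplit u U ∧ u ≠ x ∧ Compat x u := by
    intro C hx h h'
    obtain ⟨U, hUC, hU⟩ := Finset.exists_subset_card_eq (show 2 ≤ C.card by omega)
    have h1 := Finset.card_le_card (Finset.compl_subset_compl.2 hUC)
    obtain ⟨u, hu⟩ := exists_hasSplit_of_two_le (C := U) (by omega) (by omega)
    refine ⟨U, u, hUC, hu, ?_, (compat_iff hx hu).2 ?_⟩
    · rintro rfl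
      rcases hx.eq_or_eq_compl hu with e | e
      · rw [e] at hU; omega
      · rw [e] at hU; omega
    · rintro ⟨-, -, ⟨t, ht, ht'⟩, -⟩
      exact ht (hUC ht')
  obtain ⟨U, u, hUC, hu, hux, hxu⟩ := key C hx h h'
  obtain ⟨V, v, hVC, hv, hvx, hxv⟩ := key Cᶜ hx.compl h' (by simpa using h)
  refine ⟨u, v, hux, hvx, hxu, hxv, fun w hw => ?_⟩
  obtain ⟨W, hW⟩ := exists_hasSplit w
  rw [compat_iff hx hW] at hw
  rw [compat_iff hW hu, compat_iff hW hv]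
  by_contra! h2
  obtain ⟨⟨⟨t₁, h1, h1'⟩, -, ⟨t₂, h2, h2'⟩, -⟩, ⟨t₃, h3, h3'⟩, -, ⟨t₄, h4, h4'⟩, -⟩ := h2
  exact hw ⟨⟨t₁, hUC h1', h1⟩, ⟨t₂, hUC h2', h2⟩, ⟨t₃, Finset.mem_compl.1 (hVC h3'), h3⟩,
    ⟨t₄, Finset.mem_compl.1 (hVC h4'), h4⟩⟩

/-- If `C` is a pair and `U`, `V` are proper subsets of its complement that give trees, then some
tree compatible with `C` crosses both: it separates the union of `C` and a common element of `U`
and `V`, or an element of `U` and an element of `V` if these are disjoint. -/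
theorem HasSplit.not_isDominated (hn : 5 ≤ n) {x : Simplex 0 n 1} {C : Finset (Fin n)}
    (hx : x.HasSplit C) (hC : C.card = 2) : ¬ x.IsDominated := by
  classical
  have hne : C.Nonempty := Finset.card_pos.1 (by omega)
  obtain ⟨c, hc⟩ := hne
  have hCc := Finset.card_compl_add_card C
  rw [Fintype.card_fin] at hCc
  -- A tree compatible with `x` has a side that is a proper subset of the complement of `C`.
  have key : ∀ u, u ≠ x → Compat x u → ∃ U, HasSplit u U ∧ Disjoint C U ∧
      ∃ t, t ∉ C ∧ t ∉ U := by
    intro u hux hu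
    have key' : ∀ U, HasSplit u U → ∃ t, t ∉ C ∧ t ∈ U := by
      intro U hU
      by_contra! h
      have h1 : U ⊆ C := fun t ht => by
        by_contra h2
        exact h t h2 ht
      have h2 := Finset.eq_of_subset_of_card_le h1 (by rw [hC]; exact hU.two_le)
      exact hux (hU.eq_of_eq (h2 ▸ hx))
    obtain ⟨U, hU⟩ := exists_hasSplit u
    rw [compat_iff hx hU] at hu
    obtain ⟨s, hs, hs'⟩ := key' U hU
    obtain ⟨t, ht, ht'⟩ := key' Uᶜ hU.compl
    rw [Finset.mem_compl] at ht'
    by_cases h1 : Disjoint C U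
    · exact ⟨U, hU, h1, t, ht, ht'⟩
    · refine ⟨Uᶜ, hU.compl, Finset.disjoint_left.2 fun r hr hr' => ?_, s, hs, by simpa using hs'⟩
      obtain ⟨q, hq, hq'⟩ := Finset.not_disjoint_iff.1 h1
      exact hu ⟨⟨q, hq, hq'⟩, ⟨r, hr, Finset.mem_compl.1 hr'⟩, ⟨s, hs, hs'⟩, t, ht, ht'⟩
  have hother : ∀ {U : Finset (Fin n)} {u}, HasSplit u U → ∀ a, ∃ b ∈ U, b ≠ a := by
    intro U u hU a
    by_contra! h
    have h1 := Finset.card_le_card (show U ⊆ {a} from fun t ht => by simpa using h t ht)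
    have h2 := hU.two_le
    rw [Finset.card_singleton] at h1
    omega
  rintro ⟨u, v, hux, hvx, hxu, hxv, h⟩
  obtain ⟨U, hU, hCU, s, hs, hs'⟩ := key u hux hxu
  obtain ⟨V, hV, hCV, t, ht, ht'⟩ := key v hvx hxv
  rw [Finset.disjoint_left] at hCU hCV
  by_cases hUV : ∃ a, a ∈ U ∧ a ∈ V
  · obtain ⟨a, haU, haV⟩ := hUV
    have haC : a ∉ C := fun h => hCU h haU
    have hcard := Finset.card_insert_of_notMem haC
    have hcard' := Finset.card_compl_add_card (insert a C)
    rw [Fintype.card_fin] at hcard'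
    obtain ⟨w, hw⟩ := exists_hasSplit_of_two_le (C := insert a C) (by omega) (by omega)
    have hcross : ∀ {U : Finset (Fin n)} {u}, HasSplit u U → a ∈ U → (∀ ⦃t⦄, t ∈ C → t ∉ U) →
        ∀ s, s ∉ C → s ∉ U → Crossing (insert a C) U := by
      intro U u hU haU hCU s hs hs'
      obtain ⟨b, hb, hba⟩ := hother hU a
      refine ⟨⟨a, by simp, haU⟩, ⟨c, by simp [hc], hCU hc⟩, ⟨b, ?_, hb⟩, s, ?_, hs'⟩
      · simp only [Finset.mem_insert, not_or]
        exact ⟨hba, fun h => hCU h hb⟩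
      · simp only [Finset.mem_insert, not_or]
        exact ⟨fun h => hs' (h ▸ haU), hs⟩
    rcases h w ((compat_iff hx hw).2 fun h => by
      obtain ⟨-, ⟨t, ht, ht'⟩, -⟩ := h
      exact ht' (by simp [ht])) with h | h
    · exact (compat_iff hw hU).1 h (hcross hU haU hCU s hs hs')
    · exact (compat_iff hw hV).1 h (hcross hV haV hCV t ht ht')
  · push Not at hUV
    obtain ⟨a, ha, -⟩ := hother hU c
    obtain ⟨b, hb, -⟩ := hother hV c
    have hab : a ≠ b := fun h => hUV a ha (h ▸ hb)
    have hcard := Finset.card_pair hab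
    have hcard' := Finset.card_compl_add_card ({a, b} : Finset (Fin n))
    rw [Fintype.card_fin] at hcard'
    obtain ⟨w, hw⟩ := exists_hasSplit_of_two_le (C := {a, b}) (by omega) (by omega)
    have hcross : ∀ {U : Finset (Fin n)} {u} {a b}, HasSplit u U → a ∈ U → b ∉ U →
        (∀ ⦃t⦄, t ∈ C → t ∉ U) → c ≠ a → c ≠ b → Crossing {a, b} U := by
      intro U u a b hU ha hb hCU hca hcb
      obtain ⟨d, hd, hda⟩ := hother hU a
      refine ⟨⟨a, by simp, ha⟩, ⟨b, by simp, hb⟩, ⟨d, ?_, hd⟩, c, ?_, hCU hc⟩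
      · simp only [Finset.mem_insert, Finset.mem_singleton, not_or]
        exact ⟨hda, fun h => hb (h ▸ hd)⟩
      · simp only [Finset.mem_insert, Finset.mem_singleton, not_or]
        exact ⟨hca, hcb⟩
    have hca : c ≠ a := fun h => hCU hc (h ▸ ha)
    have hcb : c ≠ b := fun h => hCV hc (h ▸ hb)
    rcases h w ((compat_iff hx hw).2 fun h => by
      obtain ⟨⟨t, ht, ht'⟩, -⟩ := h
      rw [Finset.mem_insert, Finset.mem_singleton] at ht'
      rcases ht' with rfl | rfl
      · exact hCU ht ha
      · exact hCV ht hb) with h | h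
    · exact (compat_iff hw hU).1 h (hcross hU ha (fun h => hUV b h hb) hCU hca hcb)
    · refine (compat_iff hw hV).1 h ?_
      rw [Finset.pair_comm]
      exact hcross hV hb (fun h => hUV a ha h) hCV hcb hca

theorem isDominated_iff (hn : 5 ≤ n) {x : Simplex 0 n 1} {C : Finset (Fin n)} (hx : x.HasSplit C) :
    x.IsDominated ↔ 3 ≤ C.card ∧ 3 ≤ Cᶜ.card := by
  constructor
  · intro h
    constructor
    · by_contra h'
      exact hx.not_isDominated hn (by have := hx.two_le; omega) h
    · by_contra h'
      exact hx.compl.not_isDominated hn (by have := hx.compl.two_le; omega) h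
  · exact fun h => hx.isDominated h.1 h.2

theorem crossing_iff_of_card_eq_two (hn : 5 ≤ n) {C D : Finset (Fin n)} (hC : C.card = 2)
    (hD : D.card = 2) : Crossing C D ↔ C ≠ D ∧ ¬ Disjoint C D := by
  classical
  constructor
  · rintro ⟨⟨t, ht, ht'⟩, ⟨s, hs, hs'⟩, -⟩
    exact ⟨fun h => hs' (h ▸ hs), Finset.not_disjoint_iff.2 ⟨t, ht, ht'⟩⟩
  · rintro ⟨hne, h⟩
    have h1 : ∀ {C D : Finset (Fin n)}, C.card = 2 → D.card = 2 → C ≠ D → ∃ t, t ∈ C ∧ t ∉ D := by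
      intro C D hC hD hne
      by_contra! h
      exact hne (Finset.eq_of_subset_of_card_le h (by omega))
    obtain ⟨s, hs, hs'⟩ := h1 hD hC hne.symm
    refine ⟨Finset.not_disjoint_iff.1 h, h1 hC hD hne, ⟨s, hs', hs⟩, ?_⟩
    by_contra! h2
    have h3 : C ∪ D = Finset.univ := Finset.eq_univ_of_forall fun t => by
      rw [Finset.mem_union]
      exact or_iff_not_imp_left.2 (h2 t)
    have h4 := Finset.card_union_le C D
    rw [h3, Finset.card_univ, Fintype.card_fin] at h4
    omega

end Simplex

namespace FaceAut

variable {g n k : ℕ}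

open Simplex Shape

theorem compat_app (Φ : FaceAut 0 n) {x y : Simplex 0 n 1} (h : Compat x y) :
    Compat (Φ.app x) (Φ.app y) := by
  rcases h with rfl | ⟨z, rfl, rfl⟩
  · exact Or.inl rfl
  · exact Or.inr ⟨Φ.app z, (Φ.app_del _ _).symm, (Φ.app_del _ _).symm⟩

theorem compat_app_iff (Φ : FaceAut 0 n) {x y : Simplex 0 n 1} :
    Compat (Φ.app x) (Φ.app y) ↔ Compat x y := by
  refine ⟨fun h => ?_, compat_app Φ⟩
  have := compat_app Φ.symm h
  rwa [symm_app_app, symm_app_app] at this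

theorem isDominated_of_app (Φ : FaceAut 0 n) {x : Simplex 0 n 1} (h : (Φ.app x).IsDominated) :
    x.IsDominated := by
  obtain ⟨u, v, hu, hv, hu', hv', h⟩ := h
  obtain ⟨u, rfl⟩ := Φ.app.surjective u
  obtain ⟨v, rfl⟩ := Φ.app.surjective v
  simp only [compat_app_iff] at hu' hv'
  refine ⟨u, v, fun e => hu (by rw [e]), fun e => hv (by rw [e]), hu', hv', fun w hw => ?_⟩
  simpa only [compat_app_iff] using h (Φ.app w) (by rwa [compat_app_iff])

/-- Automorphisms permute the trees with one edge that have a vertex with two markings. -/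
theorem exists_pair_app (hn : 5 ≤ n) (Φ : FaceAut 0 n) {C : Finset (Fin n)} (hC : C.card = 2) :
    ∃ C' : Finset (Fin n), C'.card = 2 ∧
      ∀ x : Simplex 0 n 1, x.HasSplit C → (Φ.app x).HasSplit C' := by
  have hCc := Finset.card_compl_add_card C
  rw [Fintype.card_fin] at hCc
  obtain ⟨x, hx⟩ := exists_hasSplit_of_two_le (C := C) (by omega) (by omega)
  have h1 : ¬ (Φ.app x).IsDominated := fun h => hx.not_isDominated hn hC (Φ.isDominated_of_app h)
  obtain ⟨D, hD⟩ := exists_hasSplit (Φ.app x)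
  rw [isDominated_iff hn hD] at h1
  have h2 := hD.two_le
  have h3 := hD.compl.two_le
  by_cases h4 : D.card = 2
  · exact ⟨D, h4, fun y hy => by rwa [hy.eq_of_eq hx]⟩
  · exact ⟨Dᶜ, by omega, fun y hy => by rw [hy.eq_of_eq hx]; exact hD.compl⟩

/-- In genus zero, automorphisms act on graphs with at most two vertices by permutations of the
markings. -/
theorem exists_relabel_of_genus_zero (hn : 5 ≤ n) (Φ : FaceAut 0 n) :
    ∃ σ : Equiv.Perm (Fin n), ∀ {k : ℕ} (x : Simplex 0 n k), x.numVertices ≤ 2 →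
      Φ.app x = x.relabel σ := by
  classical
  choose! F hF hF' using fun C hC => Φ.exists_pair_app hn (C := C) hC
  have hex : ∀ C : Finset (Fin n), C.card = 2 → ∃ x : Simplex 0 n 1, x.HasSplit C := by
    intro C hC
    have hCc := Finset.card_compl_add_card C
    rw [Fintype.card_fin] at hCc
    exact exists_hasSplit_of_two_le (by omega) (by omega)
  have hinj : ∀ C D, C.card = 2 → D.card = 2 → F C = F D → C = D := by
    intro C D hC hD h
    obtain ⟨x, hx⟩ := hex C hC
    obtain ⟨y, hy⟩ := hex D hD
    have hx' := hF' C hC x hx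
    rw [h] at hx'
    obtain rfl := Φ.app.injective (hx'.eq_of_eq (hF' D hD y hy))
    exact pod_injective (g := 0) (by omega) (by simp [hC]) (by omega) hx hy
  obtain ⟨σ, hσ⟩ := exists_perm_of_pairs (by simpa using hn) F hF hinj fun C D hC hD => by
    obtain ⟨x, hx⟩ := hex C hC
    obtain ⟨y, hy⟩ := hex D hD
    by_cases hCD : C = D
    · subst hCD
      have h1 : C ≠ ∅ := fun h => by simp [h] at hC
      have h2 : F C ≠ ∅ := fun h => by
        have := hF C hC
        simp [h] at this
      simp [h1, h2]
    · have h1 := Φ.compat_app_iff (x := x) (y := y)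
      rw [compat_iff hx hy, compat_iff (hF' C hC x hx) (hF' D hD y hy), not_iff_not,
        crossing_iff_of_card_eq_two hn hC hD,
        crossing_iff_of_card_eq_two hn (hF C hC) (hF D hD)] at h1
      have h2 : F C ≠ F D := fun h => hCD (hinj C D hC hD h)
      simpa [h2, hCD, not_iff_not] using h1
  refine ⟨σ, fun x hx => eq_relabel_of_trans
    (app_eq_self (by omega) _ (fun E m x hx => ?_) x hx)⟩
  obtain ⟨j, hj⟩ := hx.stable.exists_nonloop
  refine app_eq_of_no_loop (by omega) _ (fun S C w hS hC hw => ?_) hx fun i => ?_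
  · obtain rfl : S = Finset.univ := Finset.eq_univ_of_card _ (by simp [hS])
    refine Φ.trans_relabel_pod σ hw ?_
    rw [← hσ C hC]
    exact hF' C hC w hw
  · rw [show i = j from Fin.ext (by omega), show E j = _ from hj]
    simp

end FaceAut

/-! ### Automorphisms of the complex -/

open Simplex Shape

variable {g n : ℕ}

/-- The bijections of simplices given by an automorphism of `Delta g n`. -/
noncomputable def FaceAut.ofAut (Φ : Aut (Delta g n)) : FaceAut g n where
  app {k} :=
    { toFun := fun x => (Φ.hom.app (Opposite.op ⟨k⟩)) x
      invFun := fun x => (Φ.inv.app (Opposite.op ⟨k⟩)) x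
      left_inv := fun x => by
        have := congrArg (fun φ => φ.app (Opposite.op (⟨k⟩ : SymInd)) x) Φ.hom_inv_id
        exact this
      right_inv := fun x => by
        have := congrArg (fun φ => φ.app (Opposite.op (⟨k⟩ : SymInd)) x) Φ.inv_hom_id
        exact this }
  app_face {k l} ι x := by
    have := Φ.hom.naturality (X := Opposite.op ⟨l⟩) (Y := Opposite.op ⟨k⟩)
      (Quiver.Hom.op (show (⟨k⟩ : SymInd) ⟶ ⟨l⟩ from ι))
    exact congrArg (fun φ => φ x) this

/-- Equality of restrictions to `V g n 2` is equality on graphs with at most two vertices. -/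
theorem ι_comp_eq_iff {Φ Ψ : Aut (Delta g n)} :
    (V g n 2).ι ≫ Φ.hom = (V g n 2).ι ≫ Ψ.hom ↔
      ∀ {k : ℕ} (x : Simplex g n k), x.numVertices ≤ 2 →
        (FaceAut.ofAut Φ).app x = (FaceAut.ofAut Ψ).app x := by
  constructor
  · intro h k x hx
    exact congrArg (fun φ => φ.app (Opposite.op (⟨k⟩ : SymInd)) ⟨x, hx⟩) h
  · intro h
    ext a x
    exact h x.1 x.2

/-- Automorphisms act on graphs with at most two vertices by permutations of the markings. -/
theorem FaceAut.exists_relabel (hgn : 5 ≤ 2 * g + n) (Φ : FaceAut g n) :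
    ∃ σ : Equiv.Perm (Fin n), ∀ {k : ℕ} (x : Simplex g n k), x.numVertices ≤ 2 →
      Φ.app x = x.relabel σ := by
  rcases Nat.eq_zero_or_pos g with rfl | hg
  · exact Φ.exists_relabel_of_genus_zero (by omega)
  · exact Φ.exists_relabel_of_one_le hgn hg

/-- Permutations of the markings act faithfully on the graphs with at most two vertices, already on
pods. In genus zero these only determine the images of pairs of markings. -/
theorem perm_eq_of_relabel_eq (hgn : 5 ≤ 2 * g + n) {σ τ : Equiv.Perm (Fin n)}
    (h : ∀ {k : ℕ} (x : Simplex g n k), x.numVertices ≤ 2 → x.relabel σ = x.relabel τ) :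
    σ = τ := by
  classical
  have key : ∀ {S : Finset (Fin (g + 1))} {C : Finset (Fin n)}, S.Nonempty →
      S.card + C.card = 3 → C.map σ.toEmbedding = C.map τ.toEmbedding := by
    intro S C hS hSC
    obtain ⟨x, hx⟩ := exists_pod hgn hS hSC
    have h1 := hx.relabel_pod σ
    rw [h x (by simpa using hx.numVertices_eq.le)] at h1
    exact pod_injective hgn (by simpa using hSC) (by simp) h1 (hx.relabel_pod τ)
  ext1 t
  rcases Nat.eq_zero_or_pos g with rfl | hg
  · have hpair : ∀ a, t ≠ a → σ t = τ t ∨ σ t = τ a := by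
      intro a ha
      have h1 := key (S := Finset.univ) (C := {t, a}) (by simp)
        (by rw [Finset.card_pair ha]; simp)
      simp only [Finset.map_insert, Finset.map_singleton] at h1
      have h2 : σ t ∈ ({τ t, τ a} : Finset (Fin n)) := by
        rw [show ({τ t, τ a} : Finset (Fin n)) = _ from h1.symm]
        exact Finset.mem_insert_self _ _
      simpa using h2
    obtain ⟨a, ha⟩ : ∃ a, a ∉ ({t} : Finset (Fin n)) := by
      by_contra! h
      have := congrArg Finset.card (Finset.eq_univ_of_forall h)
      simp at this
      omega
    obtain ⟨b, hb⟩ : ∃ b, b ∉ ({t, a} : Finset (Fin n)) := by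
      by_contra! h
      have h1 := congrArg Finset.card (Finset.eq_univ_of_forall h)
      have h2 := Finset.card_le_two (a := t) (b := a)
      rw [h1, Finset.card_univ, Fintype.card_fin] at h2
      omega
    simp only [Finset.mem_insert, Finset.mem_singleton, not_or] at ha hb
    rcases hpair a (Ne.symm ha) with h1 | h1
    · exact h1
    · rcases hpair b (Ne.symm hb.1) with h2 | h2
      · exact h2
      · exact absurd (τ.injective (h2.symm.trans h1)) hb.2
  · obtain ⟨S, -, hS⟩ := Finset.exists_subset_card_eq
      (s := (Finset.univ : Finset (Fin (g + 1)))) (n := 2) (by simp; omega)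
    have h1 := key (S := S) (C := {t}) (Finset.card_pos.1 (by omega)) (by simp [hS])
    simpa using h1

end TropModuli

theorem theorem1p6 (g n : ℕ) (hgn : 3 ≤ 2 * (g : ℤ) - 2 + n) (Φ : Aut (TropModuli.Delta g n)) :
    (n = 0 → (TropModuli.V g n 2).ι ≫ Φ.hom = (TropModuli.V g n 2).ι) ∧
    (1 ≤ n → ∃! σ : Equiv.Perm (Fin n),
      (TropModuli.V g n 2).ι ≫ Φ.hom = (TropModuli.V g n 2).ι ≫ (TropModuli.f g n σ).hom) := by
  have hgn' : 5 ≤ 2 * g + n := by omega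
  obtain ⟨σ, hσ⟩ := (TropModuli.FaceAut.ofAut Φ).exists_relabel hgn'
  have h : (TropModuli.V g n 2).ι ≫ Φ.hom =
      (TropModuli.V g n 2).ι ≫ (TropModuli.f g n σ).hom := TropModuli.ι_comp_eq_iff.2 hσ
  refine ⟨?_, fun _ => ⟨σ, h, fun τ hτ => ?_⟩⟩
  · rintro rfl
    rw [h, Subsingleton.elim σ 1]
    ext a x
    obtain ⟨P, hP⟩ := TropModuli.Simplex.mk_surjective x.1
    change TropModuli.Simplex.relabel 1 x.1 = x.1
    rw [← hP]
    rfl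
  · refine TropModuli.perm_eq_of_relabel_eq hgn' fun x hx => ?_
    rw [← hσ x hx]
    exact (TropModuli.ι_comp_eq_iff.1 hτ x hx).symm
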